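/- **Setting.** Let $Y\subseteq\mathbb R^m$ be open and $X\subseteq\mathbb R^n$ open and connected, with coordinates $y^i$ on $Y$ and $x^a$ on $X$, and let $q^\alpha=(y^i,x^a)$ on $U=Y\times X$. On $U$ let a smooth Riemannian metric $g$, a smooth $1$-form $\mu=Q_\alpha\,dq^\alpha$ and a smooth type $(1,1)$ tensor $J$ be given that form a *driven cofactor system* for $K=\mathrm{span}\{\partial/\partial x^a\}$, $K^\perp=\mathrm{span}\{\partial/\partial y^i\}$, that is: * $J$ is nonsingular, symmetric with respect to $g$, and $J_{\alpha\beta|\gamma}=\tfrac12(\alpha_\alpha g_{\beta\gamma}+\alpha_\beta g_{\alpha\gamma})$ for some $1$-form $\alpha$ (a special conformal Killing tensor), and $D_J\mu:=d_J\mu+d(\mathrm{tr}\,J)\wedge\mu=0$; * for the second-order system $\frac{d}{dt}\frac{\partial T}{\partial\dot q^\alpha}-\frac{\partial T}{\partial q^\alpha}=Q_\alpha$, $T=\frac12 g_{\alpha\beta}\dot q^\alpha\dot q^\beta$, the distribution $K$ satisfies $\nabla K\subseteq K$ and $\Phi(K)\subseteq K$ ($\nabla$ the dynamical covariant derivative,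 $\Phi$ the Jacobi endomorphism), while $d\mu(K,K)=0$ and $D^H\mu(K^\perp,K)\not\equiv0$. Then the accelerations $\ddot y^i=f^i(y,\dot y)$ depend on $(y,\dot y)$ only (the *driving system*), and so do $g_{ij}$ and $J_1=(J^i_j)$ on $y$ only. Assume that $J_1$ is nonsingular. Let $P_2$ be the projector on $K$ along $K^\perp$; let $A_{(i)}$ be the coefficient of $a^{i-1}$ in the cofactor tensor of $J+aP_2$, and let $H_{(n)}=\tfrac12A_{(n)}^{\alpha\beta}p_\alpha p_\beta+W_{(n)}$, where $W_{(n)}$ is a smooth function on $U$ with $A_{(n)}\mu=-dW_{(n)}$. Let $V,\psi^i$ be smooth functions on $U$ with $Q_a=-\partial V/\partial x^a$ and $J^i_a=\partial\psi^i/\partial x^a$. Let $y(t)$, $t\in I$ ($I\subseteq\mathbb R$ open), be a solution of the driving system, and put $p_i(t)=g_{ij}\dot y^j$, and define $\tilde p_i(t)$ by $p_i=(J_1)^j_i\,\tilde p_j$. Along this solution the driven system has the time-dependent Hamiltonian $$h(t,x,p)=\tfrac12 g^{ab}(x)p_ap_b+V(x,y(t)).$$ **Proposition.** Assume that the equation $\det(J-\lambda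 P_2)=0$ has $n$ functionally independent smooth solutions $u^a(y,x)$ on $U$, i.e. $\det(J-u^aP_2)\equiv0$ for each $a$ and the Jacobian $(\partial u^a/\partial x^b)$ is nonsingular everywhere. Then: 1. $F_1(x,\tilde p,t)=x^a\tilde p_a+\psi^i(x,y(t))\,\tilde p_i(t)$ is the generating function ($p_a=\partial F_1/\partial x^a$, the positions being unchanged) of a smooth time-dependent canonical transformation $(x^a,p_a)\leftrightarrow(x^a,\tilde p_a)$ of $\{(t,x,p):t\in I,\ x\in X\}$ onto itself. 2. The map $(t,x)\mapsto(t,u(y(t),x))$ is injective near every point of $I\times X$, and on $N\times\mathbb R^n$, for every open $N\subseteq I\times X$ on which it is injective, $F_2(x,s,t)=s_au^a(y(t),x)$ is the generating function ($\tilde p_a=\partial F_2/\partial x^a$, $u^a=\partial F_2/\partial s_a$) of a smooth time-dependent canonical transformation $(x^a,\tilde p_a)\leftrightarrow(u^a,s_a)$ onto an open set. 3. The first transformation followed by the second transforms the Hamiltonian $h$ into $(\det J_1)^{-1}H_{(n)}$, up to an additive function of time: there is a function $c(t)$ on $I$, independent of $N$, such that the transformed Hamiltonian, in which each of the two steps adds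 $\partial F_k/\partial t$, satisfies $$h+\frac{\partial F_1}{\partial t}+\frac{\partial F_2}{\partial t}=(\det J_1)^{-1}H_{(n)}\big(y(t),x,p_i(t),p_a\big)+c(t)$$ at corresponding points. In particular, Hamilton's equations of $h$ in $(x^a,p_a)$ correspond to Hamilton's equations of $(\det J_1)^{-1}H_{(n)}$, expressed in $(t,u^a,s_a)$. -/

import Mathlib

open scoped ContDiff

noncomputable section

namespace DrivenCofactor

/-! ### Coordinate tensor calculus on an open subset of `ι → ℝ` -/

section Tensor

variable {ι : Type*} [Fintype ι] [DecidableEq ι]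

/-- The partial derivative `∂f/∂q^α` at `q`. -/
def pd (f : (ι → ℝ) → ℝ) (α : ι) (q : ι → ℝ) : ℝ :=
  fderiv ℝ f q (Pi.single α 1)

/-- The Christoffel symbol `Γ^γ_{αβ}` of the metric `g`. -/
def christoffel (g : (ι → ℝ) → Matrix ι ι ℝ) (q : ι → ℝ) (γ α β : ι) : ℝ :=
  (1 / 2) * ∑ δ, (g q)⁻¹ γ δ *
    (pd (fun r => g r δ α) β q + pd (fun r => g r δ β) α q - pd (fun r => g r α β) δ q)

/-- `J_{αβ} = g_{ασ} J^σ_β`, for a type (1,1) tensor with matrix `J q α β = J^α_β`. -/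
def lower (g J : (ι → ℝ) → Matrix ι ι ℝ) (q : ι → ℝ) (α β : ι) : ℝ :=
  ∑ σ, g q α σ * J q σ β

/-- The covariant derivative `J_{αβ|γ}` for the Levi-Civita connection of `g`. -/
def covDerivLower (g J : (ι → ℝ) → Matrix ι ι ℝ) (q : ι → ℝ) (α β γ : ι) : ℝ :=
  pd (fun r => lower g J r α β) γ q
    - ∑ σ, christoffel g q σ α γ * lower g J q σ β
    - ∑ σ, christoffel g q σ β γ * lower g J q α σ

/-- `g` is a smooth Riemannian metric on `U`. -/
structure IsRiemannianMetric (U : Set (ι → ℝ)) (g : (ι → ℝ) → Matrix ι ι ℝ) : Prop where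
  smooth : ∀ α β, ContDiffOn ℝ ∞ (fun q => g q α β) U
  posDef : ∀ q ∈ U, (g q).PosDef

/-- `J` is a special conformal Killing tensor of the metric `g` on `U`: it is `g`-symmetric and
`J_{αβ|γ} = ½ (θ_α g_{βγ} + θ_β g_{αγ})` for some 1-form `θ`. -/
structure IsSpecialConformalKilling (U : Set (ι → ℝ)) (g J : (ι → ℝ) → Matrix ι ι ℝ) :
    Prop where
  smooth : ∀ α β, ContDiffOn ℝ ∞ (fun q => J q α β) U
  symm : ∀ q ∈ U, ∀ α β, lower g J q α β = lower g J q β α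
  killing : ∃ θ : (ι → ℝ) → ι → ℝ, ∀ q ∈ U, ∀ α β γ,
    covDerivLower g J q α β γ = (1 / 2) * (θ q α * g q β γ + θ q β * g q α γ)

/-- The components of `d_J μ`, where `μ = Q_α dq^α`; here `d_J` is the degree 1 derivation with
`d_J f = J (df)` on functions and `d_J ∘ d = - d ∘ d_J`. -/
def dJ (J : (ι → ℝ) → Matrix ι ι ℝ) (Q : (ι → ℝ) → ι → ℝ) (q : ι → ℝ) (α β : ι) : ℝ :=
  ∑ σ, (J q σ α * pd (fun r => Q r β) σ q - J q σ β * pd (fun r => Q r α) σ q)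
    - ∑ σ, Q q σ * (pd (fun r => J r σ β) α q - pd (fun r => J r σ α) β q)

/-- The components of `D_J μ = d_J μ + d(tr J) ∧ μ`. -/
def gaugedDJ (J : (ι → ℝ) → Matrix ι ι ℝ) (Q : (ι → ℝ) → ι → ℝ) (q : ι → ℝ) (α β : ι) : ℝ :=
  dJ J Q q α β
    + (pd (fun r => (J r).trace) α q * Q q β - pd (fun r => (J r).trace) β q * Q q α)

/-- `(g, μ, J)` is a cofactor system on `U`, where `μ = Q_α dq^α`. -/
structure IsCofactorSystem (U : Set (ι → ℝ)) (g : (ι → ℝ) → Matrix ι ι ℝ)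
    (Q : (ι → ℝ) → ι → ℝ) (J : (ι → ℝ) → Matrix ι ι ℝ) : Prop where
  metric : IsRiemannianMetric U g
  smooth_form : ∀ α, ContDiffOn ℝ ∞ (fun q => Q q α) U
  scKt : IsSpecialConformalKilling U g J
  nonsingular : ∀ q ∈ U, (J q).det ≠ 0
  gauged_closed : ∀ q ∈ U, ∀ α β, gaugedDJ J Q q α β = 0

/-- The right-hand sides `f^α(q, v)` of the equations of motion
`d/dt (∂T/∂v^α) - ∂T/∂q^α = Q_α`, `T = ½ g_{αβ} v^α v^β`, solved for the accelerations. -/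
def force (g : (ι → ℝ) → Matrix ι ι ℝ) (Q : (ι → ℝ) → ι → ℝ) (q v : ι → ℝ) (α : ι) : ℝ :=
  - ∑ β, ∑ γ, christoffel g q α β γ * v β * v γ + ∑ β, (g q)⁻¹ α β * Q q β

/-- The connection coefficients `Γ^α_β = -½ ∂f^α/∂v^β` of the second-order field
`q'' = f(q, q')`. -/
def conn (f : (ι → ℝ) → (ι → ℝ) → ι → ℝ) (q v : ι → ℝ) (α β : ι) : ℝ :=
  -(1 / 2) * pd (fun w => f q w α) β v

/-- The components of the Jacobi endomorphism,
`Φ^α_β = -∂f^α/∂q^β - Γ^α_γ Γ^γ_β - Γ(Γ^α_β)`, with `Γ = v^σ ∂/∂q^σ + f^σ ∂/∂v^σ`. -/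
def jacobiEndo (f : (ι → ℝ) → (ι → ℝ) → ι → ℝ) (q v : ι → ℝ) (α β : ι) : ℝ :=
  - pd (fun r => f r v α) β q
    - ∑ γ, conn f q v α γ * conn f q v γ β
    - ∑ σ, (v σ * pd (fun r => conn f r v α β) σ q + f q v σ * pd (fun w => conn f q w α β) σ v)

/-- The components `D^H μ(∂_β, ∂_α) = H_β(Q_α) - V_α(Γ^γ_β) Q_γ` of the horizontal covariant
differential of the basic 1-form `μ = Q_α dq^α`, at the velocity `v`. -/
def horizontalDiff (f : (ι → ℝ) → (ι → ℝ) → ι → ℝ) (Q : (ι → ℝ) → ι → ℝ) (q v : ι → ℝ)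
    (β α : ι) : ℝ :=
  pd (fun r => Q r α) β q - ∑ γ, pd (fun w => conn f q w γ β) α v * Q q γ

end Tensor

/-! ### Driven cofactor systems in adapted coordinates `q = (y, x)` -/

section Driven

variable {m n : ℕ}

/-- The point with coordinates `(y, x)`; indices `Sum.inl i` belong to `y`, `Sum.inr a` to `x`. -/
def join (y : Fin m → ℝ) (x : Fin n → ℝ) : Fin m ⊕ Fin n → ℝ := Sum.elim y x

/-- The coordinate domain `Y × X`. -/
def domain (Y : Set (Fin m → ℝ)) (X : Set (Fin n → ℝ)) : Set (Fin m ⊕ Fin n → ℝ) :=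
  {q | (fun i => q (Sum.inl i)) ∈ Y ∧ (fun a => q (Sum.inr a)) ∈ X}

/-- `(g, μ, J)`, with `μ = Q_α dq^α`, is a driven cofactor system for the distribution `K`, in
coordinates `(y, x)` on `Y × X` in which `K = span {∂/∂x^a}` and `K^⊥ = span {∂/∂y^i}`.

As `K` is spanned by coordinate fields, `D^V_Z K ⊆ K` holds identically, and `∇ K ⊆ K`, `Φ K ⊆ K`
mean that the components `Γ^i_a` and `Φ^i_a` vanish. -/
structure IsDrivenCofactorSystem (Y : Set (Fin m → ℝ)) (X : Set (Fin n → ℝ))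
    (g : (Fin m ⊕ Fin n → ℝ) → Matrix (Fin m ⊕ Fin n) (Fin m ⊕ Fin n) ℝ)
    (Q : (Fin m ⊕ Fin n → ℝ) → Fin m ⊕ Fin n → ℝ)
    (J : (Fin m ⊕ Fin n → ℝ) → Matrix (Fin m ⊕ Fin n) (Fin m ⊕ Fin n) ℝ) : Prop where
  isOpen_Y : IsOpen Y
  isOpen_X : IsOpen X
  isConnected_X : IsConnected X
  cofactor : IsCofactorSystem (domain Y X) g Q J
  orthogonal : ∀ q ∈ domain Y X, ∀ i a, g q (Sum.inl i) (Sum.inr a) = 0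
  nabla_mem : ∀ q ∈ domain Y X, ∀ v i a, conn (force g Q) q v (Sum.inl i) (Sum.inr a) = 0
  jacobi_mem : ∀ q ∈ domain Y X, ∀ v i a, jacobiEndo (force g Q) q v (Sum.inl i) (Sum.inr a) = 0
  closed : ∀ q ∈ domain Y X, ∀ a b,
    pd (fun r => Q r (Sum.inr b)) (Sum.inr a) q = pd (fun r => Q r (Sum.inr a)) (Sum.inr b) q
  coupled : ∃ q ∈ domain Y X, ∃ v i a,
    horizontalDiff (force g Q) Q q v (Sum.inl i) (Sum.inr a) ≠ 0

/-- The projector `P₂` on `K`. -/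
def projK (R : Type*) [Zero R] [One R] : Matrix (Fin m ⊕ Fin n) (Fin m ⊕ Fin n) R :=
  Matrix.fromBlocks 0 0 0 1

/-- The tensor `A_(i)`: the coefficient of `a^(i-1)` in the cofactor tensor of `J + a P₂`
(the index `i` runs from `1` to `n + 1`). -/
def cofCoeff (J : Matrix (Fin m ⊕ Fin n) (Fin m ⊕ Fin n) ℝ) (i : ℕ) :
    Matrix (Fin m ⊕ Fin n) (Fin m ⊕ Fin n) ℝ :=
  fun α β =>
    ((J.map (Polynomial.C : ℝ → Polynomial ℝ) + (Polynomial.X : Polynomial ℝ) • projK (Polynomial ℝ)).adjugate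
      α β).coeff (i - 1)

/-- `W` satisfies `A_(i) μ = - dW` on `U`, where `(A μ)_β = A^α_β Q_α`. -/
structure IsCofactorPotential (U : Set (Fin m ⊕ Fin n → ℝ))
    (Q : (Fin m ⊕ Fin n → ℝ) → Fin m ⊕ Fin n → ℝ)
    (J : (Fin m ⊕ Fin n → ℝ) → Matrix (Fin m ⊕ Fin n) (Fin m ⊕ Fin n) ℝ) (i : ℕ)
    (W : (Fin m ⊕ Fin n → ℝ) → ℝ) : Prop where
  smooth : ContDiffOn ℝ ∞ W U
  eq : ∀ q ∈ U, ∀ β, ∑ α, cofCoeff (J q) i α β * Q q α = - pd W β q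

/-- `H_(i) = ½ A_(i)^{αβ} p_α p_β + W_(i)`, with `A^{αβ} = A^α_γ g^{γβ}`. -/
def quadIntegral (g J : (Fin m ⊕ Fin n → ℝ) → Matrix (Fin m ⊕ Fin n) (Fin m ⊕ Fin n) ℝ) (i : ℕ)
    (W : (Fin m ⊕ Fin n → ℝ) → ℝ) (q p : Fin m ⊕ Fin n → ℝ) : ℝ :=
  (1 / 2) * ∑ α, ∑ β, (cofCoeff (J q) i * (g q)⁻¹) α β * p α * p β + W q

/-- `y`, with velocity `v`, solves on `I` the driving equations `y'' = f^i(y, y')`. The components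
`f^i` of a driven cofactor system depend on `(y, y')` only; they are evaluated at `x = x₀`,
`x' = 0`. -/
structure IsDrivingSolution (Y : Set (Fin m → ℝ)) (x₀ : Fin n → ℝ)
    (g : (Fin m ⊕ Fin n → ℝ) → Matrix (Fin m ⊕ Fin n) (Fin m ⊕ Fin n) ℝ)
    (Q : (Fin m ⊕ Fin n → ℝ) → Fin m ⊕ Fin n → ℝ)
    (I : Set ℝ) (y v : ℝ → Fin m → ℝ) : Prop where
  mem : ∀ t ∈ I, y t ∈ Y
  vel : ∀ t ∈ I, HasDerivAt y (v t) t
  acc : ∀ t ∈ I,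
    HasDerivAt v (fun i => force g Q (join (y t) x₀) (join (v t) 0) (Sum.inl i)) t

/-- The momenta `p_i = g_{ij}(y) y'^j` of the driving system. -/
def drivingMomentum (g : (Fin m ⊕ Fin n → ℝ) → Matrix (Fin m ⊕ Fin n) (Fin m ⊕ Fin n) ℝ)
    (x₀ : Fin n → ℝ) (y v : ℝ → Fin m → ℝ) (t : ℝ) : Fin m → ℝ :=
  fun i => ∑ j, g (join (y t) x₀) (Sum.inl i) (Sum.inl j) * v t j

/-- The momenta `p̃_i` of the driving system, determined by `p_i = (J₁)^j_i p̃_j`. -/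
def drivingTildeMomentum
    (g J : (Fin m ⊕ Fin n → ℝ) → Matrix (Fin m ⊕ Fin n) (Fin m ⊕ Fin n) ℝ)
    (x₀ : Fin n → ℝ) (y v : ℝ → Fin m → ℝ) (t : ℝ) : Fin m → ℝ :=
  Matrix.vecMul (drivingMomentum g x₀ y v t) (J (join (y t) x₀)).toBlocks₁₁⁻¹

/-- The Hamiltonian `h(t, x, p) = ½ g^{ab} p_a p_b + V(x, y(t))` of the driven system. -/
def drivenHamiltonian (g : (Fin m ⊕ Fin n → ℝ) → Matrix (Fin m ⊕ Fin n) (Fin m ⊕ Fin n) ℝ)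
    (V : (Fin m ⊕ Fin n → ℝ) → ℝ) (y : ℝ → Fin m → ℝ) :
    ℝ × (Fin n → ℝ) × (Fin n → ℝ) → ℝ :=
  fun z => (1 / 2) * ∑ a, ∑ b, (g (join (y z.1) z.2.1))⁻¹ (Sum.inr a) (Sum.inr b)
      * z.2.2 a * z.2.2 b
    + V (join (y z.1) z.2.1)

/-- The function `(det J₁)⁻¹ H_(n)` along the solution `y` of the driving system, in the variables
`(t, x^a, p_a)`. -/
def reducedHamiltonian (g J : (Fin m ⊕ Fin n → ℝ) → Matrix (Fin m ⊕ Fin n) (Fin m ⊕ Fin n) ℝ)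
    (W : (Fin m ⊕ Fin n → ℝ) → ℝ) (x₀ : Fin n → ℝ) (y v : ℝ → Fin m → ℝ) :
    ℝ × (Fin n → ℝ) × (Fin n → ℝ) → ℝ :=
  fun z => ((J (join (y z.1) z.2.1)).toBlocks₁₁.det)⁻¹ *
    quadIntegral g J n W (join (y z.1) z.2.1) (join (drivingMomentum g x₀ y v z.1) z.2.2)

/-- The generating function `x^a p̃_a + ψ^i(x, y(t)) p̃_i(t)`, as a function of `(t, x, p̃)`. -/
def momentumShiftGen (g J : (Fin m ⊕ Fin n → ℝ) → Matrix (Fin m ⊕ Fin n) (Fin m ⊕ Fin n) ℝ)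
    (ψ : Fin m → (Fin m ⊕ Fin n → ℝ) → ℝ) (x₀ : Fin n → ℝ) (y v : ℝ → Fin m → ℝ) :
    ℝ × (Fin n → ℝ) × (Fin n → ℝ) → ℝ :=
  fun z => ∑ a, z.2.1 a * z.2.2 a
    + ∑ i, ψ i (join (y z.1) z.2.1) * drivingTildeMomentum g J x₀ y v z.1 i

/-- The generating function `s_a u^a(y(t), x)`, as a function of `(t, x, s)`. -/
def pointGen (u : Fin n → (Fin m ⊕ Fin n → ℝ) → ℝ) (y : ℝ → Fin m → ℝ) :
    ℝ × (Fin n → ℝ) × (Fin n → ℝ) → ℝ :=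
  fun z => ∑ a, z.2.2 a * u a (join (y z.1) z.2.1)

/-- `u^1, …, u^n` are functionally independent solutions of `det (J - λ P₂) = 0` on `U`: the
Jacobian matrix `(∂u^a/∂x^b)` is nonsingular. -/
structure IsIndependentEigenfunctions (U : Set (Fin m ⊕ Fin n → ℝ))
    (J : (Fin m ⊕ Fin n → ℝ) → Matrix (Fin m ⊕ Fin n) (Fin m ⊕ Fin n) ℝ)
    (u : Fin n → (Fin m ⊕ Fin n → ℝ) → ℝ) : Prop where
  smooth : ∀ a, ContDiffOn ℝ ∞ (u a) U
  eigen : ∀ q ∈ U, ∀ a, (J q - u a q • projK ℝ).det = 0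
  independent : ∀ q ∈ U, (Matrix.of fun a b => pd (u a) (Sum.inr b) q).det ≠ 0

end Driven

/-! ### Time-dependent canonical transformations

Points of the extended phase space are triples `(t, q, p)`. -/

section Canonical

variable {n : ℕ}

/-- The canonical symplectic form `dp_a ∧ dq^a` on pairs of tangent vectors. -/
def symplecticForm (ξ η : (Fin n → ℝ) × (Fin n → ℝ)) : ℝ :=
  ∑ a, (ξ.2 a * η.1 a - η.2 a * ξ.1 a)

/-- `Φ : (t, q, p) ↦ (t, Q, P)` is a smooth time-dependent canonical transformation, with
generating function `F(t, q, P)` of mixed type: `p_a = ∂F/∂q^a` and `Q^a = ∂F/∂P_a`. -/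
structure IsCanonicalGeneratedBy
    (Φ : OpenPartialHomeomorph (ℝ × (Fin n → ℝ) × (Fin n → ℝ)) (ℝ × (Fin n → ℝ) × (Fin n → ℝ)))
    (F : ℝ × (Fin n → ℝ) × (Fin n → ℝ) → ℝ) : Prop where
  smooth : ContDiffOn ℝ ∞ Φ Φ.source
  smooth_symm : ContDiffOn ℝ ∞ Φ.symm Φ.target
  time : ∀ z ∈ Φ.source, (Φ z).1 = z.1
  symplectic : ∀ z ∈ Φ.source, ∀ ξ η : (Fin n → ℝ) × (Fin n → ℝ),
    symplecticForm (fderiv ℝ Φ z (0, ξ)).2 (fderiv ℝ Φ z (0, η)).2 = symplecticForm ξ η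
  differentiable : ∀ z ∈ Φ.source, DifferentiableAt ℝ F (z.1, z.2.1, (Φ z).2.2)
  old_momentum : ∀ z ∈ Φ.source, ∀ a,
    z.2.2 a = fderiv ℝ F (z.1, z.2.1, (Φ z).2.2) (0, Pi.single a 1, 0)
  new_position : ∀ z ∈ Φ.source, ∀ a,
    (Φ z).2.1 a = fderiv ℝ F (z.1, z.2.1, (Φ z).2.2) (0, 0, Pi.single a 1)

/-- The transformed Hamiltonian `H + ∂F/∂t`, as a function of the new variables. -/
def transformedHamiltonian
    (Φ : OpenPartialHomeomorph (ℝ × (Fin n → ℝ) × (Fin n → ℝ)) (ℝ × (Fin n → ℝ) × (Fin n → ℝ)))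
    (F H : ℝ × (Fin n → ℝ) × (Fin n → ℝ) → ℝ) : ℝ × (Fin n → ℝ) × (Fin n → ℝ) → ℝ :=
  fun w => H (Φ.symm w) + fderiv ℝ F (w.1, (Φ.symm w).2.1, w.2.2) (1, 0, 0)

/-- `(q, p)` solves Hamilton's equations of `H` on the set `S` of times. -/
def IsHamiltonSolution (H : ℝ × (Fin n → ℝ) × (Fin n → ℝ) → ℝ) (S : Set ℝ)
    (c : ℝ → (Fin n → ℝ) × (Fin n → ℝ)) : Prop :=
  ∀ t ∈ S, ∀ a,
    HasDerivAt (fun τ => (c τ).1 a) (fderiv ℝ H (t, c t) (0, 0, Pi.single a 1)) t ∧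
    HasDerivAt (fun τ => (c τ).2 a) (- fderiv ℝ H (t, c t) (0, Pi.single a 1, 0)) t

/-- Under `Φ`, Hamilton's equations of `H` and of `H'` correspond to each other. -/
def IntertwinesHamilton
    (Φ : OpenPartialHomeomorph (ℝ × (Fin n → ℝ) × (Fin n → ℝ)) (ℝ × (Fin n → ℝ) × (Fin n → ℝ)))
    (H H' : ℝ × (Fin n → ℝ) × (Fin n → ℝ) → ℝ) : Prop :=
  ∀ (S : Set ℝ) (c : ℝ → (Fin n → ℝ) × (Fin n → ℝ)), IsOpen S →
    (∀ t ∈ S, (t, c t) ∈ Φ.source) →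
    (IsHamiltonSolution H S c ↔ IsHamiltonSolution H' S (fun t => (Φ (t, c t)).2))

end Canonical

end DrivenCofactor

end

open DrivenCofactor

open scoped ContDiff

noncomputable section

set_option linter.unusedSectionVars false

namespace DrivenCofactor

open Matrix

/-! ### Calculus of the partial derivatives `pd`. -/

section PartialDerivatives

variable {ι κ : Type*} [Fintype ι] [DecidableEq ι]

/-! The vanishing of Γ^i_{aγ}, which is ∇K ⊆ K, and orthogonality make g a product: ∂_a g_ij = 0 and
∂_j g_ab = 0. Then Φ(K) ⊆ K says ∂f^i/∂x^a = 0. Solved for the derivatives of J, the conformal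
Killing equation reads ∂_γ J = [J, Γ_γ] plus two rank-one terms in θ = d tr J
(`exists_pdMatrix_eq`). Its blocks show that J₁ is free of x and how J₁₂ and J₂₁ vary.

Write y' = v = J₁w, so that p̃ = g₁w by the g-symmetry of J. Block elimination in J + aP₂ yields
A_(n) in closed form (`cofCoeff_eq`), and (det J₁)⁻¹H_(n) becomes ½ g^{ab}p_a p_b − p·J₂₁w plus
terms free of p_a (`det_inv_mul_quadIntegral`). So the time derivatives of the generating functions
must supply −p·J₂₁w.

This term comes from F₂. Differentiating det(J − uP₂) = 0 by Jacobi's formula and inserting ∂J gives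
du(J ∂/∂y^i) = 0, first where the u^a are distinct, which is a dense set, then everywhere by
continuity (`sum_J_mul_pd_eq_zero`). Hence v^j ∂_j u = −(J₂₁w)^b ∂_b u. Since s_b ∂_a u^b = p_a −
J^i_a p̃_i, it follows that ∂F₂/∂t = −p·J₂₁w + p̃·J₁₂J₂₁w.

What remains of the difference, `residual`, depends on t and x only. Its x-gradient vanishes
(`pd_residual_inr_eq_zero`): the K-components of A_(n)μ = −dW dispose of V, W and the forces, and
the derivatives of J₁₂, of J₁₂J₂₁ and of tr J₂₂ cancel against the equation of motion of p̃. As X is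
connected, the residual is a function c(t).

Canonicity does not involve the geometry of J. Both generating functions have the form P_a u^a(t,x)
+ S(t,x) (`exists_canonical_affineGen`), and the symmetry of the Hessian of a generating function
gives both the invariance of the symplectic form and the correspondence of Hamilton's equations
(`symplecticForm_fderiv`). -/

theorem pd_congr {f f' : (ι → ℝ) → ℝ} {q : ι → ℝ} (h : f =ᶠ[nhds q] f') (α : ι) :
    pd f α q = pd f' α q := by
  simp only [pd, h.fderiv_eq]

theorem pd_congr_of_isOpen {U : Set (ι → ℝ)} (hU : IsOpen U) {f f' : (ι → ℝ) → ℝ}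
    (h : ∀ q ∈ U, f q = f' q) {q : ι → ℝ} (hq : q ∈ U) (α : ι) : pd f α q = pd f' α q :=
  pd_congr (Filter.eventually_of_mem (hU.mem_nhds hq) h) α

@[simp] theorem pd_const (c : ℝ) (α : ι) (q : ι → ℝ) : pd (fun _ => c) α q = 0 := by
  simp [pd]

theorem pd_eq_zero_of_isOpen {U : Set (ι → ℝ)} (hU : IsOpen U) {f : (ι → ℝ) → ℝ} {c : ℝ}
    (h : ∀ q ∈ U, f q = c) {q : ι → ℝ} (hq : q ∈ U) (α : ι) : pd f α q = 0 := by
  rw [pd_congr_of_isOpen hU (f' := fun _ => c) h hq, pd_const]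

theorem pd_add {f f' : (ι → ℝ) → ℝ} {q : ι → ℝ} (hf : DifferentiableAt ℝ f q)
    (hf' : DifferentiableAt ℝ f' q) (α : ι) :
    pd (fun r => f r + f' r) α q = pd f α q + pd f' α q := by
  simp [pd, fderiv_fun_add hf hf']

theorem pd_sub {f f' : (ι → ℝ) → ℝ} {q : ι → ℝ} (hf : DifferentiableAt ℝ f q)
    (hf' : DifferentiableAt ℝ f' q) (α : ι) :
    pd (fun r => f r - f' r) α q = pd f α q - pd f' α q := by
  simp [pd, fderiv_fun_sub hf hf']

theorem pd_neg (f : (ι → ℝ) → ℝ) (q : ι → ℝ) (α : ι) :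
    pd (fun r => -f r) α q = -pd f α q := by
  simp [pd, fderiv_fun_neg]

theorem pd_mul {f f' : (ι → ℝ) → ℝ} {q : ι → ℝ} (hf : DifferentiableAt ℝ f q)
    (hf' : DifferentiableAt ℝ f' q) (α : ι) :
    pd (fun r => f r * f' r) α q = pd f α q * f' q + f q * pd f' α q := by
  simp [pd, fderiv_fun_mul hf hf']; ring

theorem pd_mul_const {f : (ι → ℝ) → ℝ} {q : ι → ℝ} (hf : DifferentiableAt ℝ f q) (c : ℝ) (α : ι) :
    pd (fun r => f r * c) α q = pd f α q * c := by
  simp [pd_mul hf (differentiableAt_const c)]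

theorem pd_const_mul {f : (ι → ℝ) → ℝ} {q : ι → ℝ} (hf : DifferentiableAt ℝ f q) (c : ℝ) (α : ι) :
    pd (fun r => c * f r) α q = c * pd f α q := by
  simp [pd_mul (differentiableAt_const c) hf]

theorem pd_sum (s : Finset κ) {f : κ → (ι → ℝ) → ℝ} {q : ι → ℝ}
    (hf : ∀ k ∈ s, DifferentiableAt ℝ (f k) q) (α : ι) :
    pd (fun r => ∑ k ∈ s, f k r) α q = ∑ k ∈ s, pd (f k) α q := by
  simp [pd, fderiv_fun_sum hf]

/-- The coordinate function `q^α`. -/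
theorem pd_coord (β α : ι) (q : ι → ℝ) :
    pd (fun r => r β) α q = if β = α then 1 else 0 := by
  have : HasFDerivAt (fun r : ι → ℝ => r β) (ContinuousLinearMap.proj (R := ℝ) (φ := fun _ => ℝ) β)
      q := (ContinuousLinearMap.proj (R := ℝ) (φ := fun _ => ℝ) β).hasFDerivAt
  rw [pd, this.fderiv]
  simp [Pi.single_apply]

theorem fderiv_apply_eq_sum_pd (f : (ι → ℝ) → ℝ) (q v : ι → ℝ) :
    fderiv ℝ f q v = ∑ α, v α * pd f α q := by
  conv_lhs => rw [pi_eq_sum_univ' v]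
  simp only [map_sum, pd, map_smul, smul_eq_mul]

theorem contDiffOn_pd {U : Set (ι → ℝ)} (hU : IsOpen U) {f : (ι → ℝ) → ℝ}
    (hf : ContDiffOn ℝ ∞ f U) (α : ι) : ContDiffOn ℝ ∞ (pd f α) U :=
  (hf.fderiv_of_isOpen hU (m := ∞) (by simp)).clm_apply contDiffOn_const

theorem _root_.ContDiffOn.differentiableAt_of_isOpen {E F : Type*} [NormedAddCommGroup E]
    [NormedSpace ℝ E] [NormedAddCommGroup F] [NormedSpace ℝ F] {U : Set E} (hU : IsOpen U)
    {f : E → F} (hf : ContDiffOn ℝ ∞ f U) {q : E} (hq : q ∈ U) : DifferentiableAt ℝ f q :=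
  (hf.contDiffAt (hU.mem_nhds hq)).differentiableAt (by simp)

theorem pd_comm {U : Set (ι → ℝ)} (hU : IsOpen U) {f : (ι → ℝ) → ℝ}
    (hf : ContDiffOn ℝ ∞ f U) {q : ι → ℝ} (hq : q ∈ U) (α β : ι) :
    pd (pd f α) β q = pd (pd f β) α q := by
  have h : ContDiffAt ℝ ∞ f q := hf.contDiffAt (hU.mem_nhds hq)
  have hs := h.isSymmSndFDerivAt (by simpa using WithTop.coe_le_coe.mpr (le_top : (2 : ℕ∞) ≤ ⊤))
  have hd : DifferentiableAt ℝ (fderiv ℝ f) q :=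
    (hf.fderiv_of_isOpen hU (m := ∞) (by simp)).differentiableAt_of_isOpen hU hq
  have key : ∀ α β : ι, pd (pd f α) β q
      = fderiv ℝ (fderiv ℝ f) q (Pi.single β 1) (Pi.single α 1) := by
    intro α β
    change fderiv ℝ (fun r => fderiv ℝ f r (Pi.single α 1)) q (Pi.single β 1) = _
    rw [fderiv_clm_apply hd (differentiableAt_const _)]
    simp
  rw [key, key, hs.eq]

end PartialDerivatives

/-! ### Entrywise derivatives of matrix functions; Jacobi's formula. -/

section MatrixDerivatives

variable {ι κ l o : Type*} [Fintype ι] [DecidableEq ι]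

/-- The entrywise partial derivative of a matrix-valued function. -/
def pdMatrix (M : (ι → ℝ) → Matrix κ l ℝ) (α : ι) (q : ι → ℝ) : Matrix κ l ℝ :=
  Matrix.of fun i j => pd (fun r => M r i j) α q

theorem pdMatrix_apply (M : (ι → ℝ) → Matrix κ l ℝ) (α : ι) (q : ι → ℝ) (i : κ) (j : l) :
    pdMatrix M α q i j = pd (fun r => M r i j) α q := rfl

theorem pdMatrix_mul [Fintype l] {M : (ι → ℝ) → Matrix κ l ℝ} {N : (ι → ℝ) → Matrix l o ℝ}
    {q : ι → ℝ} (hM : ∀ i j, DifferentiableAt ℝ (fun r => M r i j) q)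
    (hN : ∀ i j, DifferentiableAt ℝ (fun r => N r i j) q) (α : ι) :
    pdMatrix (fun r => M r * N r) α q = pdMatrix M α q * N q + M q * pdMatrix N α q := by
  ext i j
  simp only [pdMatrix_apply, Matrix.mul_apply, Matrix.add_apply]
  rw [pd_sum _ fun k _ => (hM i k).fun_mul (hN k j), ← Finset.sum_add_distrib]
  exact Finset.sum_congr rfl fun k _ => pd_mul (hM i k) (hN k j) α

theorem pd_trace [Fintype κ] {M : (ι → ℝ) → Matrix κ κ ℝ}
    {q : ι → ℝ} (hM : ∀ i, DifferentiableAt ℝ (fun r => M r i i) q) (α : ι) :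
    pd (fun r => (M r).trace) α q = (pdMatrix M α q).trace :=
  pd_sum _ (fun i _ => hM i) α

/-- Jacobi's formula. -/
theorem pd_det [Fintype κ] [DecidableEq κ] {M : (ι → ℝ) → Matrix κ κ ℝ} {q : ι → ℝ}
    (hM : ∀ i j, DifferentiableAt ℝ (fun r => M r i j) q) (α : ι) :
    pd (fun r => (M r).det) α q = ((M q).adjugate * pdMatrix M α q).trace := by
  -- Cramer's rule read backwards: the trace is a sum of determinants with one column
  -- differentiated, which matches the product rule applied to each term of the Leibniz expansion.
  have h1 : ((M q).adjugate * pdMatrix M α q).trace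
      = ∑ i, ((M q).updateCol i fun k => pdMatrix M α q k i).det := by
    simp only [Matrix.trace, Matrix.diag, Matrix.mul_apply]
    refine Finset.sum_congr rfl fun i _ => ?_
    rw [← Matrix.cramer_apply, Matrix.cramer_eq_adjugate_mulVec]
    rfl
  rw [h1]
  simp only [Matrix.det_apply']
  have hp : ∀ σ : Equiv.Perm κ, HasFDerivAt (fun r => ∏ i, M r (σ i) i)
      (∑ i, (∏ j ∈ Finset.univ.erase i, M q (σ j) j) • fderiv ℝ (fun r => M r (σ i) i) q) q :=
    fun σ => HasFDerivAt.finsetProd (u := Finset.univ) (g := fun i r => M r (σ i) i)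
      fun i _ => (hM (σ i) i).hasFDerivAt
  rw [pd_sum _ fun σ _ => (hp σ).differentiableAt.const_mul _, Finset.sum_comm]
  refine Finset.sum_congr rfl fun σ _ => ?_
  rw [pd_const_mul (hp σ).differentiableAt, ← Finset.mul_sum]
  congr 1
  rw [pd, (hp σ).fderiv]
  simp only [_root_.sum_apply, _root_.smul_apply, smul_eq_mul]
  refine Finset.sum_congr rfl fun i _ => ?_
  rw [← Finset.mul_prod_erase _ _ (Finset.mem_univ i), Matrix.updateCol_self, mul_comm]
  congr 1
  refine Finset.prod_congr rfl fun j hj => ?_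
  rw [Matrix.updateCol_ne (Finset.ne_of_mem_erase hj)]

end MatrixDerivatives

/-! ### Smoothness of determinants and inverse matrices. -/

section Smoothness

variable {E : Type*} [NormedAddCommGroup E] [NormedSpace ℝ E] {κ : Type*} [Fintype κ]
  [DecidableEq κ]

theorem contDiffOn_det {U : Set E} {M : E → Matrix κ κ ℝ} {k : ℕ∞ω}
    (hM : ∀ i j, ContDiffOn ℝ k (fun r => M r i j) U) :
    ContDiffOn ℝ k (fun r => (M r).det) U := by
  simp only [Matrix.det_apply']
  exact ContDiffOn.sum fun σ _ => contDiffOn_const.mul (contDiffOn_prod fun i _ => hM _ _)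

theorem contDiffOn_inv_apply {U : Set E} {M : E → Matrix κ κ ℝ} {k : ℕ∞ω}
    (hM : ∀ i j, ContDiffOn ℝ k (fun r => M r i j) U) (h0 : ∀ r ∈ U, (M r).det ≠ 0) (i j : κ) :
    ContDiffOn ℝ k (fun r => (M r)⁻¹ i j) U := by
  simp only [Matrix.inv_def, Ring.inverse_eq_inv, Matrix.smul_apply, smul_eq_mul,
    Matrix.adjugate_apply]
  refine ((contDiffOn_det hM).inv h0).mul (contDiffOn_det fun a b => ?_)
  -- An adjugate entry is the determinant of M with one row replaced by a constant row.
  by_cases h : a = j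
  · subst h; simp only [Matrix.updateRow_self]; exact contDiffOn_const
  · simp only [Matrix.updateRow_ne h]; exact hM a b

end Smoothness

/-! ### The Levi-Civita connection and special conformal Killing tensors in matrix form. -/

section LeviCivita

variable {ι : Type*} [Fintype ι] [DecidableEq ι] {U : Set (ι → ℝ)}
  {g J : (ι → ℝ) → Matrix ι ι ℝ}

/-- The Christoffel symbols of the first kind `Γ_{δ,αβ}`. -/
def christoffelLower (g : (ι → ℝ) → Matrix ι ι ℝ) (q : ι → ℝ) (δ α β : ι) : ℝ :=
  (1 / 2) * (pd (fun r => g r δ α) β q + pd (fun r => g r δ β) α q - pd (fun r => g r α β) δ q)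

/-- The connection matrix `(Γ_γ)^ρ_β = Γ^ρ_{βγ}`. -/
def christoffelMatrix (g : (ι → ℝ) → Matrix ι ι ℝ) (q : ι → ℝ) (γ : ι) : Matrix ι ι ℝ :=
  Matrix.of fun ρ β => christoffel g q ρ β γ

/-- The matrix `Γ_{δ,βγ}`, for fixed `γ`. -/
def christoffelLowerMatrix (g : (ι → ℝ) → Matrix ι ι ℝ) (q : ι → ℝ) (γ : ι) : Matrix ι ι ℝ :=
  Matrix.of fun δ β => christoffelLower g q δ β γ

theorem christoffel_eq_sum (q : ι → ℝ) (γ α β : ι) :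
    christoffel g q γ α β = ∑ δ, (g q)⁻¹ γ δ * christoffelLower g q δ α β := by
  simp only [christoffel, christoffelLower, Finset.mul_sum]
  exact Finset.sum_congr rfl fun _ _ => by ring

theorem christoffelMatrix_eq (q : ι → ℝ) (γ : ι) :
    christoffelMatrix g q γ = (g q)⁻¹ * christoffelLowerMatrix g q γ := by
  ext ρ β
  exact christoffel_eq_sum q ρ β γ

namespace IsRiemannianMetric

variable (hg : IsRiemannianMetric U g)
include hg

theorem apply_comm {q : ι → ℝ} (hq : q ∈ U) (α β : ι) : g q α β = g q β α := by
  simpa using (hg.posDef q hq).isHermitian.apply β α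

theorem transpose_eq {q : ι → ℝ} (hq : q ∈ U) : (g q)ᵀ = g q := by
  ext α β
  exact hg.apply_comm hq β α

theorem det_ne_zero {q : ι → ℝ} (hq : q ∈ U) : (g q).det ≠ 0 := (hg.posDef q hq).det_pos.ne'

theorem isUnit_det {q : ι → ℝ} (hq : q ∈ U) : IsUnit (g q).det := (hg.det_ne_zero hq).isUnit

variable (hU : IsOpen U)
include hU

theorem pd_apply_comm {q : ι → ℝ} (hq : q ∈ U) (α β γ : ι) :
    pd (fun r => g r α β) γ q = pd (fun r => g r β α) γ q :=
  pd_congr_of_isOpen hU (fun _ hr => hg.apply_comm hr α β) hq γ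

theorem christoffelLower_comm {q : ι → ℝ} (hq : q ∈ U) (δ α β : ι) :
    christoffelLower g q δ α β = christoffelLower g q δ β α := by
  rw [christoffelLower, christoffelLower, hg.pd_apply_comm hU hq α β]
  ring

theorem christoffel_comm {q : ι → ℝ} (hq : q ∈ U) (γ α β : ι) :
    christoffel g q γ α β = christoffel g q γ β α := by
  simp only [christoffel_eq_sum, hg.christoffelLower_comm hU hq _ α β]

theorem mul_christoffelMatrix {q : ι → ℝ} (hq : q ∈ U) (γ : ι) :
    g q * christoffelMatrix g q γ = christoffelLowerMatrix g q γ := by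
  rw [christoffelMatrix_eq, Matrix.mul_nonsing_inv_cancel_left _ _ (hg.isUnit_det hq)]

/-- This is metric compatibility ∇g = 0, written for the connection matrices. -/
theorem pdMatrix_eq {q : ι → ℝ} (hq : q ∈ U) (γ : ι) :
    pdMatrix g γ q = g q * christoffelMatrix g q γ + (christoffelMatrix g q γ)ᵀ * g q := by
  have h : (christoffelMatrix g q γ)ᵀ * g q = (christoffelLowerMatrix g q γ)ᵀ := by
    rw [← hg.mul_christoffelMatrix hU hq, Matrix.transpose_mul, hg.transpose_eq hq]
  rw [h, hg.mul_christoffelMatrix hU hq]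
  ext α β
  simp only [pdMatrix_apply, christoffelLowerMatrix, Matrix.add_apply, Matrix.of_apply,
    Matrix.transpose_apply, christoffelLower]
  rw [hg.pd_apply_comm hU hq β α γ]
  ring

theorem differentiableAt {q : ι → ℝ} (hq : q ∈ U) (α β : ι) :
    DifferentiableAt ℝ (fun r => g r α β) q :=
  (hg.smooth α β).differentiableAt_of_isOpen hU hq

end IsRiemannianMetric

namespace IsSpecialConformalKilling

variable (hJ : IsSpecialConformalKilling U g J)
include hJ

theorem mul_eq_transpose_mul (hg : IsRiemannianMetric U g) {q : ι → ℝ} (hq : q ∈ U) :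
    g q * J q = (J q)ᵀ * g q := by
  ext α β
  have h := hJ.symm q hq α β
  simp only [lower] at h
  rw [Matrix.mul_apply, h, Matrix.mul_apply]
  refine Finset.sum_congr rfl fun σ _ => ?_
  rw [Matrix.transpose_apply, hg.apply_comm hq, mul_comm]

variable (hU : IsOpen U)
include hU

theorem differentiableAt {q : ι → ℝ} (hq : q ∈ U) (α β : ι) :
    DifferentiableAt ℝ (fun r => J r α β) q :=
  (hJ.smooth α β).differentiableAt_of_isOpen hU hq

/-- The matrix `½ (θ_α g_{βγ} + θ_β g_{αγ})`, for fixed `γ`. -/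
def _root_.DrivenCofactor.killingMatrix (G : Matrix ι ι ℝ) (θ : ι → ℝ) (γ : ι) : Matrix ι ι ℝ :=
  (1 / 2 : ℝ) • (vecMulVec θ (fun β => G β γ) + vecMulVec (fun α => G α γ) θ)

/-- The Killing equation is a statement about gJ. Expanding ∂(gJ) by metric compatibility, the term
Γᵀ g J cancels, and after multiplication by g⁻¹ the connection enters only through a commutator. -/
theorem pdMatrix_eq_of_covDeriv (hg : IsRiemannianMetric U g) {q : ι → ℝ} (hq : q ∈ U)
    {θ : ι → ℝ}
    (hθ : ∀ α β γ, covDerivLower g J q α β γ = (1 / 2) * (θ α * g q β γ + θ β * g q α γ)) (γ : ι) :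
    pdMatrix J γ q = J q * christoffelMatrix g q γ - christoffelMatrix g q γ * J q
      + (g q)⁻¹ * killingMatrix (g q) θ γ := by
  set Γ := christoffelMatrix g q γ with hΓ
  have h1 : pdMatrix (fun r => g r * J r) γ q - Γᵀ * (g q * J q) - g q * J q * Γ
      = killingMatrix (g q) θ γ := by
    ext α β
    have h := hθ α β γ
    rw [covDerivLower] at h
    simp only [killingMatrix, Matrix.smul_apply, Matrix.add_apply, vecMulVec_apply, smul_eq_mul]
    rw [mul_comm (g q α γ), ← h]
    simp only [Matrix.sub_apply, Matrix.mul_apply, pdMatrix_apply, hΓ, christoffelMatrix,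
      Matrix.transpose_apply, Matrix.of_apply, lower]
    congr 1
    exact Finset.sum_congr rfl fun _ _ => mul_comm _ _
  rw [pdMatrix_mul (hg.differentiableAt hU hq) (hJ.differentiableAt hU hq),
    hg.pdMatrix_eq hU hq] at h1
  rw [← h1]
  simp only [Matrix.mul_add, Matrix.mul_sub, Matrix.add_mul, ← Matrix.mul_assoc,
    Matrix.nonsing_inv_mul _ (hg.isUnit_det hq), Matrix.one_mul]
  rw [← hΓ]
  abel

theorem inv_mul_killingMatrix (hg : IsRiemannianMetric U g) {q : ι → ℝ} (hq : q ∈ U)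
    (θ : ι → ℝ) (γ : ι) :
    (g q)⁻¹ * killingMatrix (g q) θ γ
      = (1 / 2 : ℝ) • (vecMulVec ((g q)⁻¹ *ᵥ θ) (fun β => g q β γ)
          + vecMulVec (Pi.single γ 1) θ) := by
  have h : (g q)⁻¹ *ᵥ (fun α => g q α γ) = Pi.single γ 1 := by
    ext α
    have := congrFun (congrFun (Matrix.nonsing_inv_mul _ (hg.isUnit_det hq)) α) γ
    rw [Matrix.mul_apply] at this
    rw [Matrix.mulVec, dotProduct, this, Matrix.one_apply, Pi.single_apply]
  rw [killingMatrix, Matrix.mul_smul, Matrix.mul_add, Matrix.mul_vecMulVec, Matrix.mul_vecMulVec, h]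

/-- The commutator is traceless and each of the two rank-one matrices has trace θ_γ, so taking
traces identifies the unspecified 1-form of the Killing equation with d tr J. -/
theorem exists_pdMatrix_eq (hg : IsRiemannianMetric U g) {q : ι → ℝ} (hq : q ∈ U) :
    ∃ θ : ι → ℝ, ∀ γ, θ γ = pd (fun r => (J r).trace) γ q ∧
      pdMatrix J γ q = J q * christoffelMatrix g q γ - christoffelMatrix g q γ * J q
      + (1 / 2 : ℝ) • (vecMulVec ((g q)⁻¹ *ᵥ θ) (fun β => g q β γ)
          + vecMulVec (Pi.single γ 1) θ) := by
  obtain ⟨θ, hθ⟩ := hJ.killing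
  refine ⟨θ q, fun γ => ?_⟩
  have h := hJ.pdMatrix_eq_of_covDeriv hU hg hq (hθ q hq) γ
  rw [hJ.inv_mul_killingMatrix hU hg hq] at h
  refine ⟨?_, h⟩
  rw [pd_trace (fun i => hJ.differentiableAt hU hq i i), h]
  have h2 : (fun β => g q β γ) ⬝ᵥ (g q)⁻¹ *ᵥ θ q = θ q γ := by
    have h3 : (fun β => g q β γ) = g q γ := funext fun β => hg.apply_comm hq β γ
    have h4 := congrFun (congrArg (fun M => M *ᵥ θ q)
      (Matrix.mul_nonsing_inv _ (hg.isUnit_det hq))) γ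
    simp only [← Matrix.mulVec_mulVec, Matrix.one_mulVec] at h4
    rw [h3]
    exact h4
  simp only [Matrix.trace_add, Matrix.trace_sub, Matrix.trace_smul, trace_vecMulVec]
  rw [Matrix.trace_mul_comm, dotProduct_comm, h2, single_dotProduct]
  simp
  ring

end IsSpecialConformalKilling

end LeviCivita

/-! ### The splitting q = (y, x) and functions constant along the fibres {y} × X. -/

section Join

variable {m n : ℕ}

@[simp] theorem join_inl (y : Fin m → ℝ) (x : Fin n → ℝ) (i : Fin m) :
    join y x (Sum.inl i) = y i := rfl

@[simp] theorem join_inr (y : Fin m → ℝ) (x : Fin n → ℝ) (a : Fin n) :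
    join y x (Sum.inr a) = x a := rfl

theorem join_mem_domain {Y : Set (Fin m → ℝ)} {X : Set (Fin n → ℝ)} {y : Fin m → ℝ}
    {x : Fin n → ℝ} : join y x ∈ domain Y X ↔ y ∈ Y ∧ x ∈ X := Iff.rfl

theorem isOpen_domain {Y : Set (Fin m → ℝ)} {X : Set (Fin n → ℝ)} (hY : IsOpen Y)
    (hX : IsOpen X) : IsOpen (domain Y X) :=
  (hY.preimage (by fun_prop)).inter (hX.preimage (by fun_prop))

/-- The map `(y, x) ↦ join y x` as a continuous linear map. -/
def joinL (m n : ℕ) : ((Fin m → ℝ) × (Fin n → ℝ)) →L[ℝ] (Fin m ⊕ Fin n → ℝ) :=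
  LinearMap.toContinuousLinearMap
    { toFun := fun z => join z.1 z.2
      map_add' := fun z w => by ext (i | a) <;> rfl
      map_smul' := fun c z => by ext (i | a) <;> rfl }

@[simp] theorem joinL_apply (z : (Fin m → ℝ) × (Fin n → ℝ)) : joinL m n z = join z.1 z.2 := rfl

theorem contDiff_join : ContDiff ℝ ∞ fun z : (Fin m → ℝ) × (Fin n → ℝ) => join z.1 z.2 :=
  (joinL m n).contDiff

theorem hasFDerivAt_comp_join_right {f : (Fin m ⊕ Fin n → ℝ) → ℝ} {y : Fin m → ℝ}
    {x : Fin n → ℝ} (hf : DifferentiableAt ℝ f (join y x)) :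
    HasFDerivAt (fun x => f (join y x))
      ((fderiv ℝ f (join y x)).comp ((joinL m n).comp (ContinuousLinearMap.inr ℝ _ _))) x := by
  have h1 : HasFDerivAt (fun x : Fin n → ℝ => join y x)
      ((joinL m n).comp (ContinuousLinearMap.inr ℝ _ _)) x :=
    (joinL m n).hasFDerivAt.comp x (hasFDerivAt_prodMk_right y x)
  exact hf.hasFDerivAt.comp x h1

theorem fderiv_comp_join_right_single {f : (Fin m ⊕ Fin n → ℝ) → ℝ} {y : Fin m → ℝ}
    {x : Fin n → ℝ} (hf : DifferentiableAt ℝ f (join y x)) (a : Fin n) :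
    fderiv ℝ (fun x => f (join y x)) x (Pi.single a 1) = pd f (Sum.inr a) (join y x) := by
  rw [(hasFDerivAt_comp_join_right hf).fderiv, pd]
  simp only [ContinuousLinearMap.comp_apply, ContinuousLinearMap.inr_apply, joinL_apply]
  congr 1
  ext (i | b)
  · simp
  · simp [Pi.single_apply]

/-- A function whose partial derivatives along the fibre `{y} × X` vanish is constant on it. -/
theorem eq_of_pd_inr_eq_zero {X : Set (Fin n → ℝ)} (hX : IsOpen X) (hX' : IsPreconnected X)
    {f : (Fin m ⊕ Fin n → ℝ) → ℝ} {y : Fin m → ℝ}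
    (hf : ∀ x ∈ X, DifferentiableAt ℝ f (join y x))
    (h0 : ∀ x ∈ X, ∀ a, pd f (Sum.inr a) (join y x) = 0) {x x' : Fin n → ℝ} (hx : x ∈ X)
    (hx' : x' ∈ X) : f (join y x) = f (join y x') := by
  refine hX.is_const_of_fderiv_eq_zero (f := fun x => f (join y x)) (𝕜 := ℝ) hX'
    (fun x hx => (hasFDerivAt_comp_join_right (hf x hx)).differentiableAt.differentiableWithinAt)
    (fun x hx => ?_) hx hx'
  ext w
  rw [fderiv_apply_eq_sum_pd]
  refine Finset.sum_eq_zero fun a _ => ?_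
  change w a * fderiv ℝ (fun x => f (join y x)) x (Pi.single a 1) = 0
  rw [fderiv_comp_join_right_single (hf x hx), h0 x hx, mul_zero]

end Join

/-! ### The forces: velocity dependence and smoothness. -/

section Force

variable {ι : Type*} [Fintype ι] [DecidableEq ι]

theorem hasFDerivAt_coord (α : ι) (v : ι → ℝ) :
    HasFDerivAt (fun w : ι → ℝ => w α)
      (ContinuousLinearMap.proj (R := ℝ) (φ := fun _ => ℝ) α) v :=
  (ContinuousLinearMap.proj (R := ℝ) (φ := fun _ => ℝ) α).hasFDerivAt

theorem pd_velocity_force (g : (ι → ℝ) → Matrix ι ι ℝ) (Q : (ι → ℝ) → ι → ℝ) (q v : ι → ℝ)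
    (α β : ι) :
    pd (fun w => force g Q q w α) β v
      = -∑ γ, (christoffel g q α β γ + christoffel g q α γ β) * v γ := by
  have hd : ∀ γ, DifferentiableAt ℝ (fun w : ι → ℝ => w γ) v :=
    fun γ => (hasFDerivAt_coord γ v).differentiableAt
  have hd2 : ∀ γ δ, DifferentiableAt ℝ (fun w : ι → ℝ => christoffel g q α γ δ * w γ * w δ) v :=
    fun γ δ => by fun_prop
  have hd3 : ∀ γ, DifferentiableAt ℝ
      (fun w : ι → ℝ => ∑ δ, christoffel g q α γ δ * w γ * w δ) v := fun γ => by fun_prop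
  have h1 : ∀ γ δ, pd (fun w : ι → ℝ => christoffel g q α γ δ * w γ * w δ) β v
      = (if γ = β then christoffel g q α γ δ * v δ else 0)
        + (if δ = β then christoffel g q α γ δ * v γ else 0) := by
    intro γ δ
    rw [pd_mul ((hd γ).const_mul _) (hd δ), pd_const_mul (hd γ), pd_coord, pd_coord]
    split_ifs <;> ring
  simp only [force]
  rw [pd_add (DifferentiableAt.neg (by fun_prop)) (differentiableAt_const _), pd_const, pd_neg,
    add_zero, pd_sum _ fun γ _ => hd3 γ]
  simp only [pd_sum _ fun δ _ => hd2 _ δ, h1, Finset.sum_add_distrib]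
  rw [Finset.sum_comm]
  simp only [Finset.sum_ite_eq', Finset.mem_univ, if_true, add_mul, Finset.sum_add_distrib]

theorem conn_force {U : Set (ι → ℝ)} (hU : IsOpen U) {g : (ι → ℝ) → Matrix ι ι ℝ}
    (hg : IsRiemannianMetric U g) (Q : (ι → ℝ) → ι → ℝ) {q : ι → ℝ} (hq : q ∈ U) (v : ι → ℝ)
    (α β : ι) :
    conn (force g Q) q v α β = ∑ γ, christoffel g q α β γ * v γ := by
  rw [conn, pd_velocity_force]
  simp only [hg.christoffel_comm hU hq α _ β]
  rw [mul_neg, neg_mul, neg_neg, Finset.mul_sum]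
  exact Finset.sum_congr rfl fun γ _ => by ring

theorem contDiffOn_christoffel {U : Set (ι → ℝ)} (hU : IsOpen U) {g : (ι → ℝ) → Matrix ι ι ℝ}
    (hg : IsRiemannianMetric U g) (γ α β : ι) :
    ContDiffOn ℝ ∞ (fun q => christoffel g q γ α β) U := by
  have hp : ∀ α β γ, ContDiffOn ℝ ∞ (fun q => pd (fun r => g r α β) γ q) U :=
    fun α β γ => contDiffOn_pd hU (hg.smooth α β) γ
  simp only [christoffel]
  exact contDiffOn_const.mul (ContDiffOn.sum fun δ _ =>
    (contDiffOn_inv_apply hg.smooth (fun r hr => hg.det_ne_zero hr) γ δ).mul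
      (((hp _ _ _).add (hp _ _ _)).sub (hp _ _ _)))

theorem contDiffOn_force {U : Set (ι → ℝ)} (hU : IsOpen U) {g : (ι → ℝ) → Matrix ι ι ℝ}
    (hg : IsRiemannianMetric U g) {Q : (ι → ℝ) → ι → ℝ}
    (hQ : ∀ α, ContDiffOn ℝ ∞ (fun q => Q q α) U) (α : ι) :
    ContDiffOn ℝ ∞ (fun z : (ι → ℝ) × (ι → ℝ) => force g Q z.1 z.2 α) (U ×ˢ Set.univ) := by
  have hfst : ∀ {f : (ι → ℝ) → ℝ}, ContDiffOn ℝ ∞ f U →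
      ContDiffOn ℝ ∞ (fun z : (ι → ℝ) × (ι → ℝ) => f z.1) (U ×ˢ Set.univ) :=
    fun hf => hf.comp contDiff_fst.contDiffOn fun z hz => hz.1
  have hsnd : ∀ α, ContDiffOn ℝ ∞ (fun z : (ι → ℝ) × (ι → ℝ) => z.2 α) (U ×ˢ Set.univ) :=
    fun α => ((contDiff_apply ℝ ℝ α).comp contDiff_snd).contDiffOn
  simp only [force]
  refine ContDiffOn.add (ContDiffOn.neg (ContDiffOn.sum fun β _ => ContDiffOn.sum fun γ _ => ?_))
    (ContDiffOn.sum fun β _ => ?_)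
  · exact ((hfst (contDiffOn_christoffel hU hg α β γ)).mul (hsnd β)).mul (hsnd γ)
  · exact (hfst (contDiffOn_inv_apply hg.smooth (fun r hr => hg.det_ne_zero hr) α β)).mul
      (hfst (hQ β))

end Force

/-! ### Product structure of the metric and autonomy of the driving system. -/

section Product

variable {m n : ℕ} {Y : Set (Fin m → ℝ)} {X : Set (Fin n → ℝ)}
  {g J : (Fin m ⊕ Fin n → ℝ) → Matrix (Fin m ⊕ Fin n) (Fin m ⊕ Fin n) ℝ}
  {Q : (Fin m ⊕ Fin n → ℝ) → Fin m ⊕ Fin n → ℝ}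

namespace IsDrivenCofactorSystem

variable (hs : IsDrivenCofactorSystem Y X g Q J)
include hs

theorem isOpen : IsOpen (domain Y X) := isOpen_domain hs.isOpen_Y hs.isOpen_X

theorem metric : IsRiemannianMetric (domain Y X) g := hs.cofactor.metric

theorem scKt : IsSpecialConformalKilling (domain Y X) g J := hs.cofactor.scKt

variable {q : Fin m ⊕ Fin n → ℝ} (hq : q ∈ domain Y X)
include hq

theorem metric_inl_inr (i : Fin m) (a : Fin n) : g q (Sum.inl i) (Sum.inr a) = 0 :=
  hs.orthogonal q hq i a

theorem metric_inr_inl (i : Fin m) (a : Fin n) : g q (Sum.inr a) (Sum.inl i) = 0 := by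
  rw [hs.metric.apply_comm hq, hs.orthogonal q hq]

theorem pd_metric_inl_inr (i : Fin m) (a : Fin n) (γ) :
    pd (fun r => g r (Sum.inl i) (Sum.inr a)) γ q = 0 :=
  pd_eq_zero_of_isOpen hs.isOpen (fun _ hr => hs.metric_inl_inr hr i a) hq γ

theorem pd_metric_inr_inl (i : Fin m) (a : Fin n) (γ) :
    pd (fun r => g r (Sum.inr a) (Sum.inl i)) γ q = 0 :=
  pd_eq_zero_of_isOpen hs.isOpen (fun _ hr => hs.metric_inr_inl hr i a) hq γ

theorem metric_eq_fromBlocks :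
    g q = fromBlocks (g q).toBlocks₁₁ 0 0 (g q).toBlocks₂₂ := by
  ext (i | a) (j | b)
  · rfl
  · simp [hs.metric_inl_inr hq]
  · simp [hs.metric_inr_inl hq]
  · rfl

theorem det_metric_eq :
    (g q).det = (g q).toBlocks₁₁.det * (g q).toBlocks₂₂.det := by
  conv_lhs => rw [hs.metric_eq_fromBlocks hq]
  rw [det_fromBlocks_zero₁₂]

theorem isUnit_det_metric₁ : IsUnit (g q).toBlocks₁₁.det :=
  isUnit_of_mul_isUnit_left (hs.det_metric_eq hq ▸ hs.metric.isUnit_det hq)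

theorem isUnit_det_metric₂ : IsUnit (g q).toBlocks₂₂.det :=
  isUnit_of_mul_isUnit_right (hs.det_metric_eq hq ▸ hs.metric.isUnit_det hq)

theorem inv_metric_eq :
    (g q)⁻¹ = fromBlocks (g q).toBlocks₁₁⁻¹ 0 0 (g q).toBlocks₂₂⁻¹ := by
  refine Matrix.inv_eq_right_inv ?_
  conv_lhs => rw [hs.metric_eq_fromBlocks hq]
  simp only [toBlocks_fromBlocks₁₁, toBlocks_fromBlocks₂₂]
  rw [fromBlocks_multiply]
  simp [mul_nonsing_inv _ (hs.isUnit_det_metric₁ hq), mul_nonsing_inv _ (hs.isUnit_det_metric₂ hq)]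

theorem christoffel_inl_inr (i : Fin m) (a : Fin n) (γ : Fin m ⊕ Fin n) :
    christoffel g q (Sum.inl i) (Sum.inr a) γ = 0 := by
  -- The connection coefficients are linear in the velocity, so a unit velocity isolates one
  -- Christoffel symbol.
  have h := hs.nabla_mem q hq (Pi.single γ 1) i a
  rw [conn_force hs.isOpen hs.metric Q hq] at h
  simpa [Pi.single_apply] using h

theorem christoffelLower_inl_inr (j : Fin m) (a : Fin n) (γ : Fin m ⊕ Fin n) :
    christoffelLower g q (Sum.inl j) (Sum.inr a) γ = 0 := by
  have h := congrFun (congrFun (hs.metric.mul_christoffelMatrix hs.isOpen hq γ)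
    (Sum.inl j)) (Sum.inr a)
  rw [Matrix.mul_apply, Fintype.sum_sum_type] at h
  simp only [christoffelMatrix, christoffelLowerMatrix, of_apply, hs.christoffel_inl_inr hq,
    hs.metric_inl_inr hq] at h
  simpa using h.symm

/-- With the mixed components of g equal to zero, only −½ ∂_j g_ab survives in Γ_{j,ab}. The next
lemma reads Γ_{j,ak} in the same way, where only ½ ∂_a g_jk survives. -/
theorem pd_metric_inr_inr (a b : Fin n) (j : Fin m) :
    pd (fun r => g r (Sum.inr a) (Sum.inr b)) (Sum.inl j) q = 0 := by
  have h := hs.christoffelLower_inl_inr hq j a (Sum.inr b)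
  rw [christoffelLower, hs.pd_metric_inl_inr hq, hs.pd_metric_inl_inr hq] at h
  linarith

theorem pd_metric_inl_inl (j k : Fin m) (a : Fin n) :
    pd (fun r => g r (Sum.inl j) (Sum.inl k)) (Sum.inr a) q = 0 := by
  have h := hs.christoffelLower_inl_inr hq j a (Sum.inl k)
  rw [christoffelLower, hs.pd_metric_inl_inr hq, hs.pd_metric_inr_inl hq] at h
  linarith

theorem christoffel_inr_eq (a : Fin n) (α β : Fin m ⊕ Fin n) :
    christoffel g q (Sum.inr a) α β
      = ∑ b, (g q).toBlocks₂₂⁻¹ a b * christoffelLower g q (Sum.inr b) α β := by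
  rw [christoffel_eq_sum, Fintype.sum_sum_type, hs.inv_metric_eq hq]
  simp

theorem christoffel_inr_inl (a : Fin n) (i : Fin m) (γ : Fin m ⊕ Fin n) :
    christoffel g q (Sum.inr a) (Sum.inl i) γ = 0 := by
  rw [hs.christoffel_inr_eq hq]
  refine Finset.sum_eq_zero fun b _ => ?_
  rcases γ with j | c
  · simp [christoffelLower, hs.pd_metric_inr_inl hq, hs.pd_metric_inl_inl hq]
  · simp [christoffelLower, hs.pd_metric_inr_inl hq, hs.pd_metric_inl_inr hq,
      hs.pd_metric_inr_inr hq]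

theorem christoffelMatrix_inl (j : Fin m) :
    christoffelMatrix g q (Sum.inl j)
      = fromBlocks (christoffelMatrix g q (Sum.inl j)).toBlocks₁₁ 0 0 0 := by
  ext (i | a) (k | b)
  · rfl
  · simp [christoffelMatrix, hs.christoffel_inl_inr hq]
  · simp [christoffelMatrix, hs.christoffel_inr_inl hq]
  · simp [christoffelMatrix, hs.metric.christoffel_comm hs.isOpen hq _ (Sum.inr b),
      hs.christoffel_inr_inl hq]

theorem christoffelMatrix_inr (c : Fin n) :
    christoffelMatrix g q (Sum.inr c)
      = fromBlocks 0 0 0 (christoffelMatrix g q (Sum.inr c)).toBlocks₂₂ := by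
  ext (i | a) (k | b)
  · simp [christoffelMatrix, hs.metric.christoffel_comm hs.isOpen hq _ (Sum.inl k),
      hs.christoffel_inl_inr hq]
  · simp [christoffelMatrix, hs.christoffel_inl_inr hq]
  · simp [christoffelMatrix, hs.christoffel_inr_inl hq]
  · rfl

/-- K and K^⊥ are both parallel. This allows J to be replaced by J − fP₂ inside the commutator with
Γ_γ when det(J − fP₂) is differentiated. -/
theorem christoffelMatrix_mul_projK (γ : Fin m ⊕ Fin n) :
    christoffelMatrix g q γ * projK ℝ = projK ℝ * christoffelMatrix g q γ := by
  rcases γ with j | c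
  · rw [hs.christoffelMatrix_inl hq, projK, fromBlocks_multiply, fromBlocks_multiply]
    simp
  · rw [hs.christoffelMatrix_inr hq, projK, fromBlocks_multiply, fromBlocks_multiply]
    simp

omit hq in
-- Since Γ^i_a vanishes identically in position and velocity, the quadratic term and the derivative
-- term of Φ^i_a drop out, and −∂f^i/∂x^a is all that is left.
theorem pd_force_inl (hq : q ∈ domain Y X) (v : Fin m ⊕ Fin n → ℝ) (i : Fin m) (a : Fin n) :
    pd (fun r => force g Q r v (Sum.inl i)) (Sum.inr a) q = 0 := by
  have h := hs.jacobi_mem q hq v i a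
  have h1 : ∑ γ, conn (force g Q) q v (Sum.inl i) γ * conn (force g Q) q v γ (Sum.inr a) = 0 := by
    refine Finset.sum_eq_zero fun γ _ => ?_
    rcases γ with j | b
    · rw [hs.nabla_mem q hq, mul_zero]
    · rw [hs.nabla_mem q hq, zero_mul]
  have h2 : ∀ σ, pd (fun r => conn (force g Q) r v (Sum.inl i) (Sum.inr a)) σ q = 0 := fun σ =>
    pd_eq_zero_of_isOpen hs.isOpen (fun r hr => hs.nabla_mem r hr v i a) hq σ
  have h3 : ∀ σ, pd (fun w => conn (force g Q) q w (Sum.inl i) (Sum.inr a)) σ v = 0 := fun σ =>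
    pd_eq_zero_of_isOpen isOpen_univ (fun w _ => hs.nabla_mem q hq w i a) (Set.mem_univ v) σ
  rw [jacobiEndo, h1] at h
  simp only [h2, h3] at h
  simpa using h

omit hq

theorem differentiableAt_force {q : Fin m ⊕ Fin n → ℝ} (hq : q ∈ domain Y X)
    (v : Fin m ⊕ Fin n → ℝ) (α : Fin m ⊕ Fin n) :
    DifferentiableAt ℝ (fun r => force g Q r v α) q :=
  ((contDiffOn_force hs.isOpen hs.metric hs.cofactor.smooth_form α).comp
    (contDiff_prodMk_left v).contDiffOn
    (fun _ hr => ⟨hr, Set.mem_univ _⟩)).differentiableAt_of_isOpen hs.isOpen hq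

/-- The accelerations `f^i` do not depend on `x`. -/
theorem force_inl_eq {y : Fin m → ℝ} (hy : y ∈ Y) {x x' : Fin n → ℝ} (hx : x ∈ X) (hx' : x' ∈ X)
    (v : Fin m ⊕ Fin n → ℝ) (i : Fin m) :
    force g Q (join y x) v (Sum.inl i) = force g Q (join y x') v (Sum.inl i) :=
  eq_of_pd_inr_eq_zero (f := fun r => force g Q r v (Sum.inl i)) hs.isOpen_X
    hs.isConnected_X.isPreconnected
    (fun _ hx => hs.differentiableAt_force (join_mem_domain.2 ⟨hy, hx⟩) v _)
    (fun _ hx a => hs.pd_force_inl (join_mem_domain.2 ⟨hy, hx⟩) v i a) hx hx'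

/-- The metric components `g_{ij}` do not depend on `x`. -/
theorem metric₁_eq {y : Fin m → ℝ} (hy : y ∈ Y) {x x' : Fin n → ℝ} (hx : x ∈ X) (hx' : x' ∈ X)
    (i j : Fin m) : g (join y x) (Sum.inl i) (Sum.inl j)
      = g (join y x') (Sum.inl i) (Sum.inl j) :=
  eq_of_pd_inr_eq_zero (f := fun r => g r (Sum.inl i) (Sum.inl j)) hs.isOpen_X
    hs.isConnected_X.isPreconnected
    (fun _ hx => hs.metric.differentiableAt hs.isOpen (join_mem_domain.2 ⟨hy, hx⟩) _ _)
    (fun _ hx a => hs.pd_metric_inl_inl (join_mem_domain.2 ⟨hy, hx⟩) i j a) hx hx'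

end IsDrivenCofactorSystem

end Product

/-! ### Derivatives of the blocks of J. -/

section Blocks

variable {m n : ℕ} {Y : Set (Fin m → ℝ)} {X : Set (Fin n → ℝ)}
  {g J : (Fin m ⊕ Fin n → ℝ) → Matrix (Fin m ⊕ Fin n) (Fin m ⊕ Fin n) ℝ}
  {Q : (Fin m ⊕ Fin n → ℝ) → Fin m ⊕ Fin n → ℝ}

/-- The differential of `tr J` in the directions `y`. -/
def traceForm₁ (J : (Fin m ⊕ Fin n → ℝ) → Matrix (Fin m ⊕ Fin n) (Fin m ⊕ Fin n) ℝ)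
    (q : Fin m ⊕ Fin n → ℝ) : Fin m → ℝ :=
  fun i => pd (fun r => (J r).trace) (Sum.inl i) q

/-- The differential of `tr J` in the directions `x`. -/
def traceForm₂ (J : (Fin m ⊕ Fin n → ℝ) → Matrix (Fin m ⊕ Fin n) (Fin m ⊕ Fin n) ℝ)
    (q : Fin m ⊕ Fin n → ℝ) : Fin n → ℝ :=
  fun a => pd (fun r => (J r).trace) (Sum.inr a) q

/-- The connection matrix `(Γ_j)^l_i` of the metric `g_{ij}`. -/
def christoffelMatrix₁ (g : (Fin m ⊕ Fin n → ℝ) → Matrix (Fin m ⊕ Fin n) (Fin m ⊕ Fin n) ℝ)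
    (q : Fin m ⊕ Fin n → ℝ) (j : Fin m) : Matrix (Fin m) (Fin m) ℝ :=
  (christoffelMatrix g q (Sum.inl j)).toBlocks₁₁

/-- The connection matrix `(Γ_c)^a_b` of the metric `g_{ab}`. -/
def christoffelMatrix₂ (g : (Fin m ⊕ Fin n → ℝ) → Matrix (Fin m ⊕ Fin n) (Fin m ⊕ Fin n) ℝ)
    (q : Fin m ⊕ Fin n → ℝ) (c : Fin n) : Matrix (Fin n) (Fin n) ℝ :=
  (christoffelMatrix g q (Sum.inr c)).toBlocks₂₂

namespace IsDrivenCofactorSystem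

variable (hs : IsDrivenCofactorSystem Y X g Q J)
include hs

variable {q : Fin m ⊕ Fin n → ℝ} (hq : q ∈ domain Y X)
include hq

theorem pdMatrix_J (γ : Fin m ⊕ Fin n) :
    pdMatrix J γ q = J q * christoffelMatrix g q γ - christoffelMatrix g q γ * J q
      + (1 / 2 : ℝ) • (vecMulVec (Sum.elim ((g q).toBlocks₁₁⁻¹ *ᵥ traceForm₁ J q)
              ((g q).toBlocks₂₂⁻¹ *ᵥ traceForm₂ J q)) (fun β => g q β γ)
          + vecMulVec (Pi.single γ 1) (Sum.elim (traceForm₁ J q) (traceForm₂ J q))) := by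
  obtain ⟨θ, hθ⟩ := hs.scKt.exists_pdMatrix_eq hs.isOpen hs.metric hq
  have h1 : θ = Sum.elim (traceForm₁ J q) (traceForm₂ J q) := by
    ext (i | a)
    · exact (hθ _).1
    · exact (hθ _).1
  rw [(hθ γ).2, h1, hs.inv_metric_eq hq, fromBlocks_mulVec]
  simp

/-- In the direction x^a nothing reaches the upper left block: Γ_a lives in the K-block, the
covector g_{·a} has no y-components, and the unit vector e_a has none either. -/
theorem pd_J_inl_inl (i j : Fin m) (a : Fin n) :
    pd (fun r => J r (Sum.inl i) (Sum.inl j)) (Sum.inr a) q = 0 := by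
  have h := congrFun (congrFun (hs.pdMatrix_J hq (Sum.inr a)) (Sum.inl i)) (Sum.inl j)
  rw [pdMatrix_apply, hs.christoffelMatrix_inr hq, ← fromBlocks_toBlocks (J q),
    fromBlocks_multiply, fromBlocks_multiply] at h
  simpa [vecMulVec_apply, hs.metric_inl_inr hq] using h

theorem pdMatrix_J₁₂_inr (a : Fin n) :
    pdMatrix (fun r => (J r).toBlocks₁₂) (Sum.inr a) q
      = (J q).toBlocks₁₂ * christoffelMatrix₂ g q a
        + (1 / 2 : ℝ) • vecMulVec ((g q).toBlocks₁₁⁻¹ *ᵥ traceForm₁ J q)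
            (fun b => g q (Sum.inr b) (Sum.inr a)) := by
  have h := congrArg toBlocks₁₂ (hs.pdMatrix_J hq (Sum.inr a))
  rw [hs.christoffelMatrix_inr hq] at h
  change toBlocks₁₂ (pdMatrix J (Sum.inr a) q) = _
  rw [h]
  ext i b
  nth_rw 1 2 [← fromBlocks_toBlocks (J q)]
  rw [fromBlocks_multiply, fromBlocks_multiply]
  simp [toBlocks₁₂, vecMulVec_apply, christoffelMatrix₂]

theorem pdMatrix_J₂₁_inr (a : Fin n) :
    pdMatrix (fun r => (J r).toBlocks₂₁) (Sum.inr a) q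
      = -(christoffelMatrix₂ g q a * (J q).toBlocks₂₁)
        + (1 / 2 : ℝ) • vecMulVec (Pi.single a 1) (traceForm₁ J q) := by
  have h := congrArg toBlocks₂₁ (hs.pdMatrix_J hq (Sum.inr a))
  rw [hs.christoffelMatrix_inr hq] at h
  change toBlocks₂₁ (pdMatrix J (Sum.inr a) q) = _
  rw [h]
  ext b i
  nth_rw 1 2 [← fromBlocks_toBlocks (J q)]
  rw [fromBlocks_multiply, fromBlocks_multiply]
  simp [toBlocks₂₁, vecMulVec_apply, christoffelMatrix₂, hs.metric_inl_inr hq, Pi.single_apply]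

theorem pdMatrix_J₁₂_inl (j : Fin m) :
    pdMatrix (fun r => (J r).toBlocks₁₂) (Sum.inl j) q
      = -(christoffelMatrix₁ g q j * (J q).toBlocks₁₂)
        + (1 / 2 : ℝ) • vecMulVec (Pi.single j 1) (traceForm₂ J q) := by
  have h := congrArg toBlocks₁₂ (hs.pdMatrix_J hq (Sum.inl j))
  rw [hs.christoffelMatrix_inl hq] at h
  change toBlocks₁₂ (pdMatrix J (Sum.inl j) q) = _
  rw [h]
  ext i b
  nth_rw 1 2 [← fromBlocks_toBlocks (J q)]
  rw [fromBlocks_multiply, fromBlocks_multiply]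
  simp [toBlocks₁₂, vecMulVec_apply, christoffelMatrix₁, hs.metric_inr_inl hq, Pi.single_apply]

theorem pdMatrix_J₁₁_inl (j : Fin m) :
    pdMatrix (fun r => (J r).toBlocks₁₁) (Sum.inl j) q
      = (J q).toBlocks₁₁ * christoffelMatrix₁ g q j - christoffelMatrix₁ g q j * (J q).toBlocks₁₁
        + (1 / 2 : ℝ) • (vecMulVec ((g q).toBlocks₁₁⁻¹ *ᵥ traceForm₁ J q)
            (fun i => g q (Sum.inl i) (Sum.inl j))
          + vecMulVec (Pi.single j 1) (traceForm₁ J q)) := by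
  have h := congrArg toBlocks₁₁ (hs.pdMatrix_J hq (Sum.inl j))
  rw [hs.christoffelMatrix_inl hq] at h
  change toBlocks₁₁ (pdMatrix J (Sum.inl j) q) = _
  rw [h]
  ext i b
  nth_rw 1 2 [← fromBlocks_toBlocks (J q)]
  rw [fromBlocks_multiply, fromBlocks_multiply]
  simp [toBlocks₁₁, vecMulVec_apply, christoffelMatrix₁, Pi.single_apply]

theorem pdMatrix_metric₁ (j : Fin m) :
    pdMatrix (fun r => (g r).toBlocks₁₁) (Sum.inl j) q
      = (g q).toBlocks₁₁ * christoffelMatrix₁ g q j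
        + (christoffelMatrix₁ g q j)ᵀ * (g q).toBlocks₁₁ := by
  have h := congrArg toBlocks₁₁ (hs.metric.pdMatrix_eq hs.isOpen hq (Sum.inl j))
  change toBlocks₁₁ (pdMatrix g (Sum.inl j) q) = _
  rw [h, hs.christoffelMatrix_inl hq, hs.metric_eq_fromBlocks hq, fromBlocks_transpose,
    fromBlocks_multiply, fromBlocks_multiply]
  ext i k
  simp [toBlocks₁₁, christoffelMatrix₁]

theorem differentiableAt_J (α β : Fin m ⊕ Fin n) :
    DifferentiableAt ℝ (fun r => J r α β) q :=
  hs.scKt.differentiableAt hs.isOpen hq α β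

/-- J₁ is free of x, so the whole x-differential of tr J comes from J₂₂. -/
theorem pd_trace_J₂₂ (a : Fin n) :
    pd (fun r => (J r).toBlocks₂₂.trace) (Sum.inr a) q = traceForm₂ J q a := by
  have h1 : pd (fun r => (J r).trace) (Sum.inr a) q = (pdMatrix J (Sum.inr a) q).trace :=
    pd_trace (fun i => hs.differentiableAt_J hq i i) _
  rw [traceForm₂, h1, pd_trace (M := fun r => (J r).toBlocks₂₂) (fun i => hs.differentiableAt_J hq _ _), Matrix.trace, Matrix.trace,
    Fintype.sum_sum_type]
  simp only [Matrix.diag, pdMatrix_apply, hs.pd_J_inl_inl hq, Finset.sum_const_zero, zero_add]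
  rfl

theorem metric₁_mul_J₁₁ :
    (g q).toBlocks₁₁ * (J q).toBlocks₁₁ = (J q).toBlocks₁₁ᵀ * (g q).toBlocks₁₁ := by
  have h := hs.scKt.mul_eq_transpose_mul hs.metric hq
  rw [hs.metric_eq_fromBlocks hq, ← fromBlocks_toBlocks (J q), fromBlocks_transpose,
    fromBlocks_multiply, fromBlocks_multiply, fromBlocks_inj] at h
  simpa using h.1

theorem metric₁_mul_J₁₂ :
    (g q).toBlocks₁₁ * (J q).toBlocks₁₂ = (J q).toBlocks₂₁ᵀ * (g q).toBlocks₂₂ := by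
  have h := hs.scKt.mul_eq_transpose_mul hs.metric hq
  rw [hs.metric_eq_fromBlocks hq, ← fromBlocks_toBlocks (J q), fromBlocks_transpose,
    fromBlocks_multiply, fromBlocks_multiply, fromBlocks_inj] at h
  simpa using h.2.1

theorem metric₁_transpose : (g q).toBlocks₁₁ᵀ = (g q).toBlocks₁₁ := by
  ext i j
  exact hs.metric.apply_comm hq _ _

/-- The connection terms J₁₂Γ_a and −Γ_aJ₂₁ cancel in the product, which leaves rank-one terms in
the y-part of θ. The relation g₁J₁₂ = J₂₁ᵀg₂ expresses them through column a of J₁₂ alone. -/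
theorem pdMatrix_J₁₂_mul_J₂₁ (a : Fin n) :
    pdMatrix (fun r => (J r).toBlocks₁₂ * (J r).toBlocks₂₁) (Sum.inr a) q
      = (1 / 2 : ℝ) • (vecMulVec ((g q).toBlocks₁₁⁻¹ *ᵥ traceForm₁ J q)
            ((g q).toBlocks₁₁ *ᵥ (fun i => J q (Sum.inl i) (Sum.inr a)))
          + vecMulVec (fun i => J q (Sum.inl i) (Sum.inr a)) (traceForm₁ J q)) := by
  rw [pdMatrix_mul (M := fun r => (J r).toBlocks₁₂) (N := fun r => (J r).toBlocks₂₁)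
    (fun _ _ => hs.differentiableAt_J hq _ _)
    (fun _ _ => hs.differentiableAt_J hq _ _), hs.pdMatrix_J₁₂_inr hq, hs.pdMatrix_J₂₁_inr hq]
  have h1 : (J q).toBlocks₁₂ *ᵥ Pi.single a 1 = fun i => J q (Sum.inl i) (Sum.inr a) := by
    ext i; simp [toBlocks₁₂]
  have h2 : (fun b => g q (Sum.inr b) (Sum.inr a)) ᵥ* (J q).toBlocks₂₁
      = (g q).toBlocks₁₁ *ᵥ (fun i => J q (Sum.inl i) (Sum.inr a)) := by
    ext j
    have h := congrFun (congrFun (hs.metric₁_mul_J₁₂ hq) j) a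
    rw [Matrix.mul_apply, Matrix.mul_apply] at h
    simp only [Matrix.mulVec, dotProduct, Matrix.vecMul]
    refine Eq.trans (Finset.sum_congr rfl fun b _ => ?_) h.symm
    rw [mul_comm]
    rfl
  rw [Matrix.add_mul, Matrix.mul_add, Matrix.smul_mul, Matrix.mul_smul, Matrix.vecMulVec_mul,
    Matrix.mul_vecMulVec, h1, h2, Matrix.mul_neg, smul_add, Matrix.mul_assoc]
  abel

end IsDrivenCofactorSystem

end Blocks

/-! ### Derivatives of scalar expressions linear in a matrix function. -/

section LinearFunctionals

variable {ι κ l : Type*} [Fintype ι] [DecidableEq ι] [Fintype κ] [Fintype l]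

theorem pd_dotProduct_mulVec {M : (ι → ℝ) → Matrix κ l ℝ} {q : ι → ℝ}
    (hM : ∀ i j, DifferentiableAt ℝ (fun r => M r i j) q) (p : κ → ℝ) (w : l → ℝ) (α : ι) :
    pd (fun r => p ⬝ᵥ M r *ᵥ w) α q = p ⬝ᵥ pdMatrix M α q *ᵥ w := by
  simp only [dotProduct, mulVec]
  rw [pd_sum _ fun i _ => (DifferentiableAt.fun_sum fun j _ => (hM i j).mul_const _).const_mul _]
  refine Finset.sum_congr rfl fun i _ => ?_
  rw [pd_const_mul (DifferentiableAt.fun_sum fun j _ => (hM i j).mul_const _),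
    pd_sum _ fun j _ => (hM i j).mul_const _]
  congr 1
  exact Finset.sum_congr rfl fun j _ => pd_mul_const (hM i j) _ α

theorem differentiableAt_dotProduct_mulVec {M : (ι → ℝ) → Matrix κ l ℝ} {q : ι → ℝ}
    (hM : ∀ i j, DifferentiableAt ℝ (fun r => M r i j) q) (p : κ → ℝ) (w : l → ℝ) :
    DifferentiableAt ℝ (fun r => p ⬝ᵥ M r *ᵥ w) q :=
  DifferentiableAt.fun_sum fun i _ =>
    (DifferentiableAt.fun_sum fun j _ => (hM i j).mul_const _).const_mul _

theorem pd_trace_const_mul {M : (ι → ℝ) → Matrix κ l ℝ} {q : ι → ℝ}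
    (hM : ∀ i j, DifferentiableAt ℝ (fun r => M r i j) q) (N : Matrix l κ ℝ) (α : ι) :
    pd (fun r => (N * M r).trace) α q = (N * pdMatrix M α q).trace := by
  simp only [Matrix.trace, Matrix.diag, Matrix.mul_apply]
  rw [pd_sum _ (f := fun i r => ∑ j, N i j * M r j i)
    fun i _ => DifferentiableAt.fun_sum fun j _ => (hM j i).const_mul _]
  refine Finset.sum_congr rfl fun i _ => ?_
  rw [pd_sum _ fun j _ => (hM j i).const_mul _]
  exact Finset.sum_congr rfl fun j _ => pd_const_mul (hM j i) _ α

theorem differentiableAt_trace_const_mul {M : (ι → ℝ) → Matrix κ l ℝ} {q : ι → ℝ}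
    (hM : ∀ i j, DifferentiableAt ℝ (fun r => M r i j) q) (N : Matrix l κ ℝ) :
    DifferentiableAt ℝ (fun r => (N * M r).trace) q :=
  DifferentiableAt.fun_sum fun i _ => DifferentiableAt.fun_sum fun j _ => (hM j i).const_mul _

end LinearFunctionals

/-! ### The momentum-free part of the Hamiltonian identity and its x-gradient. -/

section Residual

variable {m n : ℕ} {Y : Set (Fin m → ℝ)} {X : Set (Fin n → ℝ)}
  {g J : (Fin m ⊕ Fin n → ℝ) → Matrix (Fin m ⊕ Fin n) (Fin m ⊕ Fin n) ℝ}
  {Q : (Fin m ⊕ Fin n → ℝ) → Fin m ⊕ Fin n → ℝ}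

/-- The matrix `v^j Γ^l_{ij}` of the connection of `g_{ij}` along `v`. -/
def connectionAlong (g : (Fin m ⊕ Fin n → ℝ) → Matrix (Fin m ⊕ Fin n) (Fin m ⊕ Fin n) ℝ)
    (q : Fin m ⊕ Fin n → ℝ) (v : Fin m → ℝ) : Matrix (Fin m) (Fin m) ℝ :=
  ∑ j, v j • christoffelMatrix₁ g q j

/-- The time derivative of `p̃` along a solution of the driving system. -/
def tildeMomentumRate
    (g J : (Fin m ⊕ Fin n → ℝ) → Matrix (Fin m ⊕ Fin n) (Fin m ⊕ Fin n) ℝ)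
    (Q : (Fin m ⊕ Fin n → ℝ) → Fin m ⊕ Fin n → ℝ) (q : Fin m ⊕ Fin n → ℝ)
    (v p : Fin m → ℝ) : Fin m → ℝ :=
  p ᵥ* connectionAlong g q v + (fun i => Q q (Sum.inl i)) ᵥ* (J q).toBlocks₁₁⁻¹
    - ((1 / 2) * (p ⬝ᵥ (g q).toBlocks₁₁⁻¹ *ᵥ traceForm₁ J q)) • p
    - ((1 / 2) * (p ⬝ᵥ v)) • (traceForm₁ J q ᵥ* (J q).toBlocks₁₁⁻¹)

/-- The part of `h + ∂F₁/∂t + ∂F₂/∂t - (det J₁)⁻¹ H_(n)` which does not depend on the momenta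
`p_a`, as a function of the position for a fixed state of the driving system. -/
def residual (J : (Fin m ⊕ Fin n → ℝ) → Matrix (Fin m ⊕ Fin n) (Fin m ⊕ Fin n) ℝ)
    (V W : (Fin m ⊕ Fin n → ℝ) → ℝ) (ψ : Fin m → (Fin m ⊕ Fin n → ℝ) → ℝ)
    (N : Matrix (Fin m) (Fin m) ℝ) (d : ℝ) (v w p p' : Fin m → ℝ) (r : Fin m ⊕ Fin n → ℝ) : ℝ :=
  V r + ∑ j, ∑ i, pd (ψ i) (Sum.inl j) r * (p i * v j) + ∑ i, ψ i r * p' i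
    + (1 / 2) * (p ⬝ᵥ ((J r).toBlocks₁₂ * (J r).toBlocks₂₁) *ᵥ w)
    - ((J r).toBlocks₂₂.trace - (N * ((J r).toBlocks₁₂ * (J r).toBlocks₂₁)).trace)
        * ((1 / 2) * (p ⬝ᵥ v))
    - d⁻¹ * W r

theorem differentiableAt_residual (hs : IsDrivenCofactorSystem Y X g Q J)
    {V W : (Fin m ⊕ Fin n → ℝ) → ℝ} (hV : ContDiffOn ℝ ∞ V (domain Y X))
    (hW : ContDiffOn ℝ ∞ W (domain Y X)) {ψ : Fin m → (Fin m ⊕ Fin n → ℝ) → ℝ}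
    (hψ : ∀ i, ContDiffOn ℝ ∞ (ψ i) (domain Y X)) {q : Fin m ⊕ Fin n → ℝ} (hq : q ∈ domain Y X)
    (N : Matrix (Fin m) (Fin m) ℝ) (d : ℝ) (v w p p' : Fin m → ℝ) :
    DifferentiableAt ℝ (residual J V W ψ N d v w p p') q := by
  have hP : ∀ i j, DifferentiableAt ℝ
      (fun r => ((J r).toBlocks₁₂ * (J r).toBlocks₂₁) i j) q := fun i j => by
    simp only [Matrix.mul_apply]
    exact DifferentiableAt.fun_sum fun k _ =>
      (hs.differentiableAt_J hq _ _).fun_mul (hs.differentiableAt_J hq _ _)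
  unfold residual
  refine DifferentiableAt.sub (DifferentiableAt.sub (DifferentiableAt.add (DifferentiableAt.add
    (DifferentiableAt.add (hV.differentiableAt_of_isOpen hs.isOpen hq) ?_) ?_) ?_) ?_) ?_
  · exact DifferentiableAt.fun_sum fun j _ => DifferentiableAt.fun_sum fun i _ =>
      ((contDiffOn_pd hs.isOpen (hψ i) _).differentiableAt_of_isOpen hs.isOpen hq).mul_const _
  · exact DifferentiableAt.fun_sum fun i _ =>
      ((hψ i).differentiableAt_of_isOpen hs.isOpen hq).mul_const _
  · exact (differentiableAt_dotProduct_mulVec hP p w).const_mul _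
  · exact ((DifferentiableAt.fun_sum fun i _ => hs.differentiableAt_J hq _ _).sub
      (differentiableAt_trace_const_mul hP N)).mul_const _
  · exact (hW.differentiableAt_of_isOpen hs.isOpen hq).const_mul _

theorem pd_residual (hs : IsDrivenCofactorSystem Y X g Q J)
    {V W : (Fin m ⊕ Fin n → ℝ) → ℝ} (hV : ContDiffOn ℝ ∞ V (domain Y X))
    (hW : ContDiffOn ℝ ∞ W (domain Y X)) {ψ : Fin m → (Fin m ⊕ Fin n → ℝ) → ℝ}
    (hψ : ∀ i, ContDiffOn ℝ ∞ (ψ i) (domain Y X)) {q : Fin m ⊕ Fin n → ℝ} (hq : q ∈ domain Y X)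
    (N : Matrix (Fin m) (Fin m) ℝ) (d : ℝ) (v w p p' : Fin m → ℝ) (α : Fin m ⊕ Fin n) :
    pd (residual J V W ψ N d v w p p') α q
      = pd V α q + ∑ j, ∑ i, pd (pd (ψ i) (Sum.inl j)) α q * (p i * v j)
        + ∑ i, pd (ψ i) α q * p' i
        + (1 / 2) * (p ⬝ᵥ pdMatrix (fun r => (J r).toBlocks₁₂ * (J r).toBlocks₂₁) α q *ᵥ w)
        - (pd (fun r => (J r).toBlocks₂₂.trace) α q
            - (N * pdMatrix (fun r => (J r).toBlocks₁₂ * (J r).toBlocks₂₁) α q).trace)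
          * ((1 / 2) * (p ⬝ᵥ v))
        - d⁻¹ * pd W α q := by
  have hP : ∀ i j, DifferentiableAt ℝ
      (fun r => ((J r).toBlocks₁₂ * (J r).toBlocks₂₁) i j) q := fun i j => by
    simp only [Matrix.mul_apply]
    exact DifferentiableAt.fun_sum fun k _ =>
      (hs.differentiableAt_J hq _ _).fun_mul (hs.differentiableAt_J hq _ _)
  have dV := hV.differentiableAt_of_isOpen hs.isOpen hq
  have dW := hW.differentiableAt_of_isOpen hs.isOpen hq
  have dψ := fun i => (hψ i).differentiableAt_of_isOpen hs.isOpen hq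
  have dψ' := fun i j => (contDiffOn_pd hs.isOpen (hψ i) (Sum.inl j)).differentiableAt_of_isOpen
    hs.isOpen hq
  have d1 : ∀ j, DifferentiableAt ℝ
      (fun r => ∑ i, pd (ψ i) (Sum.inl j) r * (p i * v j)) q := fun j =>
    DifferentiableAt.fun_sum fun i _ => (dψ' i j).mul_const _
  have d2 : DifferentiableAt ℝ (fun r => ∑ j, ∑ i, pd (ψ i) (Sum.inl j) r * (p i * v j)) q :=
    DifferentiableAt.fun_sum fun j _ => d1 j
  have d3 : DifferentiableAt ℝ (fun r => ∑ i, ψ i r * p' i) q :=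
    DifferentiableAt.fun_sum fun i _ => (dψ i).mul_const _
  have d4 := differentiableAt_dotProduct_mulVec hP p w
  have d5 := differentiableAt_trace_const_mul hP N
  have d6 : DifferentiableAt ℝ (fun r => (J r).toBlocks₂₂.trace) q :=
    DifferentiableAt.fun_sum fun i _ => hs.differentiableAt_J hq _ _
  unfold residual
  rw [pd_sub ((((dV.fun_add d2).fun_add d3).fun_add (d4.const_mul _)).fun_sub
      ((d6.fun_sub d5).mul_const _)) (dW.const_mul _),
    pd_sub (((dV.fun_add d2).fun_add d3).fun_add (d4.const_mul _)) ((d6.fun_sub d5).mul_const _),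
    pd_add ((dV.fun_add d2).fun_add d3) (d4.const_mul _), pd_add (dV.fun_add d2) d3, pd_add dV d2,
    pd_sum _ fun j _ => d1 j, pd_sum _ fun i _ => (dψ i).mul_const _, pd_const_mul d4,
    pd_mul_const (d6.fun_sub d5), pd_sub d6 d5, pd_const_mul dW, pd_dotProduct_mulVec hP,
    pd_trace_const_mul hP]
  simp only [pd_sum _ fun i _ => (dψ' i _).mul_const _, pd_mul_const (dψ' _ _),
    pd_mul_const (dψ _)]

theorem mulVec_dotProduct_eq_of_transpose_eq {κ : Type*} [Fintype κ] {M : Matrix κ κ ℝ}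
    (h : Mᵀ = M) (x z : κ → ℝ) : (M *ᵥ x) ⬝ᵥ z = x ⬝ᵥ M *ᵥ z := by
  rw [dotProduct_mulVec, ← h, vecMul_transpose, h]

/-- The inverse of a g₁-symmetric endomorphism is g₁-symmetric: multiply g₁J₁ = J₁ᵀg₁ by the
inverses on both sides. -/
theorem IsDrivenCofactorSystem.metric₁_mul_inv_J₁₁ (hs : IsDrivenCofactorSystem Y X g Q J)
    {q : Fin m ⊕ Fin n → ℝ} (hq : q ∈ domain Y X) (hJ : IsUnit (J q).toBlocks₁₁.det) :
    (g q).toBlocks₁₁ * (J q).toBlocks₁₁⁻¹ = (J q).toBlocks₁₁⁻¹ᵀ * (g q).toBlocks₁₁ := by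
  have h1 : (J q).toBlocks₁₁⁻¹ᵀ * ((J q).toBlocks₁₁ᵀ * (g q).toBlocks₁₁) * (J q).toBlocks₁₁⁻¹
      = (J q).toBlocks₁₁⁻¹ᵀ * ((g q).toBlocks₁₁ * (J q).toBlocks₁₁) * (J q).toBlocks₁₁⁻¹ := by
    rw [hs.metric₁_mul_J₁₁ hq]
  rw [← Matrix.mul_assoc, ← Matrix.transpose_mul, mul_nonsing_inv _ hJ, Matrix.transpose_one,
    Matrix.one_mul, ← Matrix.mul_assoc, Matrix.mul_assoc, mul_nonsing_inv _ hJ,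
    Matrix.mul_one] at h1
  exact h1

/-- Here p stands for p̃. The cancellations are in groups: Q_a and Q_i between V, p̃' and W; the
connection of g₁ between ∂_a∂_jψ^i and p̃'; the x-part of θ between ∂_a∂_jψ^i and tr J₂₂; the y-part
of θ between p̃' and the two terms in J₁₂J₂₁. -/
theorem pd_residual_inr_eq_zero (hs : IsDrivenCofactorSystem Y X g Q J)
    {V W : (Fin m ⊕ Fin n → ℝ) → ℝ} (hV : ContDiffOn ℝ ∞ V (domain Y X))
    (hW : ContDiffOn ℝ ∞ W (domain Y X)) {ψ : Fin m → (Fin m ⊕ Fin n → ℝ) → ℝ}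
    (hψ : ∀ i, ContDiffOn ℝ ∞ (ψ i) (domain Y X))
    (hψJ : ∀ q ∈ domain Y X, ∀ i a, pd (ψ i) (Sum.inr a) q = J q (Sum.inl i) (Sum.inr a))
    {q : Fin m ⊕ Fin n → ℝ} (hq : q ∈ domain Y X) (hJ : IsUnit (J q).toBlocks₁₁.det)
    {d : ℝ} {v w p : Fin m → ℝ} (hp : p = (g q).toBlocks₁₁ *ᵥ w) (a : Fin n)
    (hVQ : Q q (Sum.inr a) = -pd V (Sum.inr a) q)
    (hWQ : d⁻¹ * pd W (Sum.inr a) q = (fun i => Q q (Sum.inl i)) ⬝ᵥ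
      ((J q).toBlocks₁₁⁻¹ *ᵥ fun i => J q (Sum.inl i) (Sum.inr a)) - Q q (Sum.inr a)) :
    pd (residual J V W ψ (J q).toBlocks₁₁⁻¹ d v w p (tildeMomentumRate g J Q q v p))
      (Sum.inr a) q = 0 := by
  rw [pd_residual hs hV hW hψ hq, hs.pd_trace_J₂₂ hq, hs.pdMatrix_J₁₂_mul_J₂₁ hq, hWQ, hVQ]
  simp only [hψJ q hq]
  set c : Fin m → ℝ := fun i => J q (Sum.inl i) (Sum.inr a) with hc
  set N := (J q).toBlocks₁₁⁻¹ with hN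
  set G := (g q).toBlocks₁₁ with hG
  set θ := traceForm₁ J q with hθ
  set Q₁ : Fin m → ℝ := fun i => Q q (Sum.inl i) with hQ₁
  have hGu : IsUnit G.det := hs.isUnit_det_metric₁ hq
  have hGt : Gᵀ = G := hs.metric₁_transpose hq
  have hGit : (G⁻¹)ᵀ = G⁻¹ := by rw [transpose_nonsing_inv, hGt]
  have hGN : G * N = Nᵀ * G := hs.metric₁_mul_inv_J₁₁ hq hJ
  -- Exchanging the derivatives turns ∂_a∂_jψ^i into ∂_j J^i_a, which the Killing equation supplies.
  have hψ2 : ∑ j, ∑ i, pd (pd (ψ i) (Sum.inl j)) (Sum.inr a) q * (p i * v j)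
      = -((p ᵥ* connectionAlong g q v) ⬝ᵥ c) + (1 / 2) * (p ⬝ᵥ v) * traceForm₂ J q a := by
    have h1 : ∀ i j, pd (pd (ψ i) (Sum.inl j)) (Sum.inr a) q
        = -(christoffelMatrix₁ g q j *ᵥ c) i
          + (1 / 2) * ((Pi.single j 1 : Fin m → ℝ) i * traceForm₂ J q a) := by
      intro i j
      have h2 := congrFun (congrFun (hs.pdMatrix_J₁₂_inl hq j) i) a
      rw [pd_comm hs.isOpen (hψ i) hq, pd_congr_of_isOpen hs.isOpen (fun r hr => hψJ r hr i a) hq]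
      exact h2
    simp only [h1]
    rw [← dotProduct_mulVec, connectionAlong, Matrix.sum_mulVec, dotProduct_sum,
      ← Finset.sum_neg_distrib, show p ⬝ᵥ v = ∑ j, p j * v j from rfl, Finset.mul_sum, Finset.sum_mul,
      ← Finset.sum_add_distrib]
    refine Finset.sum_congr rfl fun j _ => ?_
    simp only [add_mul, Finset.sum_add_distrib]
    congr 1
    · rw [smul_mulVec, dotProduct_smul, dotProduct, smul_eq_mul, Finset.mul_sum,
        ← Finset.sum_neg_distrib]
      exact Finset.sum_congr rfl fun i _ => by ring
    · rw [Finset.sum_eq_single j]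
      · simp; ring
      · intro i _ hij
        simp [hij]
      · simp
  have e1 : (G *ᵥ c) ⬝ᵥ w = p ⬝ᵥ c := by
    rw [mulVec_dotProduct_eq_of_transpose_eq hGt, ← hp, dotProduct_comm]
  have e2 : p ⬝ᵥ G⁻¹ *ᵥ θ = θ ⬝ᵥ w := by
    rw [← mulVec_dotProduct_eq_of_transpose_eq hGit, hp, mulVec_mulVec, nonsing_inv_mul _ hGu,
      one_mulVec, dotProduct_comm]
  -- The g₁-symmetry of J₁⁻¹ makes the traces of the two rank-one terms equal, so together they
  -- balance the coefficient ½ in p̃'.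
  have e3 : (G *ᵥ c) ⬝ᵥ N *ᵥ (G⁻¹ *ᵥ θ) = θ ⬝ᵥ N *ᵥ c := by
    rw [mulVec_dotProduct_eq_of_transpose_eq hGt, mulVec_mulVec, hGN, mulVec_mulVec,
      Matrix.mul_assoc, mul_nonsing_inv _ hGu, Matrix.mul_one, dotProduct_comm, mulVec_transpose,
      ← dotProduct_mulVec]
  have e4 : ∑ i, c i * tildeMomentumRate g J Q q v p i
      = (p ᵥ* connectionAlong g q v) ⬝ᵥ c + Q₁ ⬝ᵥ N *ᵥ c
        - (1 / 2) * (θ ⬝ᵥ w) * (p ⬝ᵥ c) - (1 / 2) * (p ⬝ᵥ v) * (θ ⬝ᵥ N *ᵥ c) := by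
    change c ⬝ᵥ tildeMomentumRate g J Q q v p = _
    rw [dotProduct_comm, tildeMomentumRate]
    simp only [sub_dotProduct, add_dotProduct, smul_dotProduct, smul_eq_mul]
    rw [← hG, ← hθ, ← hN, e2, dotProduct_mulVec Q₁, dotProduct_mulVec θ]
  rw [hψ2, e4]
  simp only [Matrix.mul_smul, Matrix.mul_add, Matrix.trace_smul, Matrix.trace_add, smul_mulVec,
    add_mulVec, dotProduct_smul, dotProduct_add, vecMulVec_mulVec, Matrix.mul_vecMulVec,
    trace_vecMulVec, smul_eq_mul, op_smul_eq_smul]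
  rw [e1, e2, dotProduct_comm _ (G *ᵥ c), e3, dotProduct_comm _ θ]
  ring

end Residual

/-! ### Top coefficients of det(X + S) and adj(X + S). -/

section PolynomialMatrix

open Polynomial

variable {κ : Type*} [Fintype κ] [DecidableEq κ]

theorem charpoly_neg_eq (S : Matrix κ κ ℝ) :
    (-S).charpoly = ((X : ℝ[X]) • (1 : Matrix κ κ ℝ[X]) + S.map C).det := by
  rw [Matrix.charpoly, charmatrix]
  congr 1
  ext i j : 2
  simp [Matrix.one_apply, Matrix.diagonal_apply, Matrix.map_apply]

theorem det_X_add_C_ne_zero (S : Matrix κ κ ℝ) :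
    ((X : ℝ[X]) • (1 : Matrix κ κ ℝ[X]) + S.map C).det ≠ 0 := by
  rw [← charpoly_neg_eq]
  exact (Matrix.charpoly_monic _).ne_zero

theorem coeff_det_X_add_C_pred [Nonempty κ] (S : Matrix κ κ ℝ) :
    ((X : ℝ[X]) • (1 : Matrix κ κ ℝ[X]) + S.map C).det.coeff (Fintype.card κ - 1) = S.trace := by
  have h := Matrix.trace_eq_neg_charpoly_coeff (-S)
  rw [charpoly_neg_eq, Matrix.trace_neg] at h
  linarith

/-- An adjugate entry is the determinant of a linear pencil XA + B in which A is the identity with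
one row set to zero. Its coefficient in degree `card κ` is det A = 0. -/
theorem coeff_adjugate_X_add_C_card (S : Matrix κ κ ℝ) (i j : κ) :
    (((X : ℝ[X]) • (1 : Matrix κ κ ℝ[X]) + S.map C).adjugate i j).coeff (Fintype.card κ) = 0 := by
  have h : ((X : ℝ[X]) • (1 : Matrix κ κ ℝ[X]) + S.map C).updateRow j (Pi.single i 1)
      = (X : ℝ[X]) • ((1 : Matrix κ κ ℝ).updateRow j 0).map C
        + (S.updateRow j (Pi.single i 1)).map C := by
    ext k l : 2
    by_cases hk : k = j
    · subst hk
      by_cases hl : l = i <;> simp [Matrix.map_apply, hl]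
    · by_cases hl : k = l
      · subst hl
        simp [Matrix.map_apply, Matrix.updateRow_ne hk]
      · simp [Matrix.map_apply, Matrix.updateRow_ne hk, Matrix.one_apply_ne hl]
  rw [Matrix.adjugate_apply, h, coeff_det_X_add_C_card]
  exact det_eq_zero_of_row_eq_zero j fun k => by simp

theorem coeff_map_C_mul {l o : Type*} (A : Matrix l κ ℝ) (M : Matrix κ o ℝ[X]) (k : ℕ) :
    (A.map C * M).map (fun p => p.coeff k) = A * M.map (fun p => p.coeff k) := by
  ext i j
  simp [Matrix.mul_apply, Matrix.map_apply]

theorem coeff_mul_map_C {l o : Type*} (A : Matrix κ o ℝ) (M : Matrix l κ ℝ[X]) (k : ℕ) :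
    (M * A.map C).map (fun p => p.coeff k) = M.map (fun p => p.coeff k) * A := by
  ext i j
  simp [Matrix.mul_apply, Matrix.map_apply]

/-- Compare coefficients of degree `card κ` in (X + S) adj(X + S) = det(X + S)·1: multiplication by
X shifts the degree by one, the S-term vanishes by the previous degree bound, and the determinant is
monic. -/
theorem coeff_adjugate_X_add_C_pred [Nonempty κ] (S : Matrix κ κ ℝ) :
    ((X : ℝ[X]) • (1 : Matrix κ κ ℝ[X]) + S.map C).adjugate.map
      (fun p => p.coeff (Fintype.card κ - 1)) = 1 := by
  have hc : Fintype.card κ = Fintype.card κ - 1 + 1 := (Nat.succ_pred Fintype.card_ne_zero).symm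
  have h := Matrix.mul_adjugate ((X : ℝ[X]) • (1 : Matrix κ κ ℝ[X]) + S.map C)
  have h2 := congrArg (fun M : Matrix κ κ ℝ[X] => M.map (fun p => p.coeff (Fintype.card κ))) h
  have h3 : (((X : ℝ[X]) • (1 : Matrix κ κ ℝ[X]) + S.map C).adjugate).map
      (fun p => p.coeff (Fintype.card κ)) = 0 := by
    ext i j
    exact coeff_adjugate_X_add_C_card S i j
  have h4 : ((X : ℝ[X]) • (1 : Matrix κ κ ℝ[X]) + S.map C).det.coeff (Fintype.card κ) = 1 := by
    rw [← charpoly_neg_eq]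
    have := Matrix.charpoly_monic (-S)
    rwa [Monic, leadingCoeff, Matrix.charpoly_natDegree_eq_dim] at this
  set A := ((X : ℝ[X]) • (1 : Matrix κ κ ℝ[X]) + S.map C).adjugate with hA
  rw [Matrix.add_mul, Matrix.smul_mul, Matrix.one_mul] at h2
  have h5 : ((X : ℝ[X]) • A + S.map C * A).map (fun p => p.coeff (Fintype.card κ))
      = A.map (fun p => p.coeff (Fintype.card κ - 1))
        + S * A.map (fun p => p.coeff (Fintype.card κ)) := by
    rw [← coeff_map_C_mul]
    ext i j
    simp only [Matrix.map_apply, Matrix.add_apply, Matrix.smul_apply, smul_eq_mul, coeff_add]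
    congr 1
    rw [hc, coeff_X_mul]
    simp
  rw [h5, h3, Matrix.mul_zero, add_zero] at h2
  rw [h2]
  ext i j
  by_cases hij : i = j <;> simp [Matrix.map_apply, hij, h4, Matrix.one_apply]

end PolynomialMatrix

/-! ### The cofactor tensor of J + aP₂ by block elimination. -/

section CofactorCoefficient

open Polynomial

variable {m n : ℕ}

/-- The Schur complement `J₂₂ - J₂₁ J₁⁻¹ J₁₂`. -/
def schur (J : Matrix (Fin m ⊕ Fin n) (Fin m ⊕ Fin n) ℝ) : Matrix (Fin n) (Fin n) ℝ :=
  J.toBlocks₂₂ - J.toBlocks₂₁ * J.toBlocks₁₁⁻¹ * J.toBlocks₁₂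

/-- Block elimination of `J + a P₂`. -/
theorem add_X_smul_projK_mul (J : Matrix (Fin m ⊕ Fin n) (Fin m ⊕ Fin n) ℝ)
    (hJ : IsUnit J.toBlocks₁₁.det) :
    (J.map C + (X : ℝ[X]) • projK ℝ[X])
      * fromBlocks 1 (-(J.toBlocks₁₁⁻¹ * J.toBlocks₁₂).map C) 0 1
      = fromBlocks (J.toBlocks₁₁.map C) 0 (J.toBlocks₂₁.map C)
          ((X : ℝ[X]) • (1 : Matrix (Fin n) (Fin n) ℝ[X]) + (schur J).map C) := by
  have h1 : J.map C + (X : ℝ[X]) • projK ℝ[X] = fromBlocks (J.toBlocks₁₁.map C)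
      (J.toBlocks₁₂.map C) (J.toBlocks₂₁.map C) (J.toBlocks₂₂.map C + (X : ℝ[X]) • 1) := by
    nth_rw 1 [← fromBlocks_toBlocks J]
    rw [fromBlocks_map, projK, fromBlocks_smul, fromBlocks_add]
    simp
  rw [h1, fromBlocks_multiply]
  congr 1
  · simp
  · rw [Matrix.mul_neg, ← Matrix.map_mul, ← Matrix.mul_assoc, mul_nonsing_inv _ hJ]
    simp
  · simp
  · rw [Matrix.mul_neg, ← Matrix.map_mul, schur, Matrix.mul_one, ← Matrix.mul_assoc,
      Matrix.map_sub _ (fun a b => C_sub)]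
    abel

theorem det_add_X_smul_projK (J : Matrix (Fin m ⊕ Fin n) (Fin m ⊕ Fin n) ℝ)
    (hJ : IsUnit J.toBlocks₁₁.det) :
    (J.map C + (X : ℝ[X]) • projK ℝ[X]).det
      = C J.toBlocks₁₁.det
        * ((X : ℝ[X]) • (1 : Matrix (Fin n) (Fin n) ℝ[X]) + (schur J).map C).det := by
  have h := congrArg Matrix.det (add_X_smul_projK_mul J hJ)
  rw [Matrix.det_mul, det_fromBlocks_zero₂₁, det_fromBlocks_zero₁₂] at h
  simp only [det_one, mul_one] at h
  rw [h]
  congr 1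
  exact (RingHom.map_det C _).symm

/-- The right-hand side is det(J + XP₂) times the inverse suggested by the block factorization. It
is verified by multiplying with J + XP₂ and then cancelling the determinant, a nonzero element of
the domain ℝ[X]. -/
theorem adjugate_add_X_smul_projK (J : Matrix (Fin m ⊕ Fin n) (Fin m ⊕ Fin n) ℝ)
    (hJ : IsUnit J.toBlocks₁₁.det) :
    (J.map C + (X : ℝ[X]) • projK ℝ[X]).adjugate
      = fromBlocks 1 (-(J.toBlocks₁₁⁻¹ * J.toBlocks₁₂).map C) 0 1
        * fromBlocks
          (((X : ℝ[X]) • (1 : Matrix (Fin n) (Fin n) ℝ[X]) + (schur J).map C).det •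
            (J.toBlocks₁₁.det • J.toBlocks₁₁⁻¹).map C) 0 0
          (C J.toBlocks₁₁.det •
            ((X : ℝ[X]) • (1 : Matrix (Fin n) (Fin n) ℝ[X]) + (schur J).map C).adjugate)
        * fromBlocks 1 0 (-(J.toBlocks₂₁ * J.toBlocks₁₁⁻¹).map C) 1 := by
  set M := J.map C + (X : ℝ[X]) • projK ℝ[X] with hM
  set S := (X : ℝ[X]) • (1 : Matrix (Fin n) (Fin n) ℝ[X]) + (schur J).map C with hS
  set d := J.toBlocks₁₁.det with hd
  set K := fromBlocks 1 (-(J.toBlocks₁₁⁻¹ * J.toBlocks₁₂).map C) 0 1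
        * fromBlocks (S.det • (d • J.toBlocks₁₁⁻¹).map C) 0 0 (C d • S.adjugate)
        * fromBlocks 1 0 (-(J.toBlocks₂₁ * J.toBlocks₁₁⁻¹).map C) 1 with hK
  have hsm : (d • J.toBlocks₁₁⁻¹).map C = C d • J.toBlocks₁₁⁻¹.map C := by
    ext i j : 2; simp [Matrix.map_apply]
  have hMK : M * K = M.det • (1 : Matrix (Fin m ⊕ Fin n) (Fin m ⊕ Fin n) ℝ[X]) := by
    rw [hK, ← Matrix.mul_assoc, ← Matrix.mul_assoc, add_X_smul_projK_mul J hJ,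
      det_add_X_smul_projK J hJ, fromBlocks_multiply, fromBlocks_multiply, ← fromBlocks_one,
      fromBlocks_smul]
    have h1 : J.toBlocks₁₁.map C * J.toBlocks₁₁⁻¹.map C = 1 := by
      rw [← Matrix.map_mul, mul_nonsing_inv _ hJ, Matrix.map_one _ C_0 C_1]
    have h2 : S * S.adjugate = S.det • 1 := Matrix.mul_adjugate S
    rw [hsm]
    congr 1
    · simp [← hS, ← hd, h1, smul_smul, mul_comm]
    · simp
    · simp [← hS, h2, smul_smul, mul_comm, Matrix.map_mul]
    · simp [← hS, h2, smul_smul, ← hd]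
  have hdet : M.det ≠ 0 := by
    rw [det_add_X_smul_projK J hJ]
    exact mul_ne_zero (by simpa using hJ.ne_zero) (det_X_add_C_ne_zero _)
  have h3 : M.det • K = M.det • M.adjugate := by
    have := congrArg (fun Z => M.adjugate * Z) hMK
    simpa [← Matrix.mul_assoc, Matrix.adjugate_mul] using this
  exact (smul_right_injective _ hdet h3).symm

/-- In the factorized adjugate only det(X + S) and adj(X + S) depend on X, S being the Schur
complement. Their coefficients in degree n − 1 are tr S and 1. For n = 0 the truncated exponent n −
1 = 0 would select adj J₁ instead. -/
theorem cofCoeff_eq (hn : n ≠ 0) (J : Matrix (Fin m ⊕ Fin n) (Fin m ⊕ Fin n) ℝ)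
    (hJ : IsUnit J.toBlocks₁₁.det) :
    cofCoeff J n = J.toBlocks₁₁.det • fromBlocks
      ((schur J).trace • J.toBlocks₁₁⁻¹
        + J.toBlocks₁₁⁻¹ * J.toBlocks₁₂ * (J.toBlocks₂₁ * J.toBlocks₁₁⁻¹))
      (-(J.toBlocks₁₁⁻¹ * J.toBlocks₁₂)) (-(J.toBlocks₂₁ * J.toBlocks₁₁⁻¹)) 1 := by
  have : Nonempty (Fin n) := ⟨⟨0, Nat.pos_of_ne_zero hn⟩⟩
  change (J.map C + (X : ℝ[X]) • projK ℝ[X]).adjugate.map (fun p => p.coeff (n - 1)) = _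
  rw [adjugate_add_X_smul_projK J hJ]
  set S := (X : ℝ[X]) • (1 : Matrix (Fin n) (Fin n) ℝ[X]) + (schur J).map C with hS
  set d := J.toBlocks₁₁.det with hd
  set N := J.toBlocks₁₁⁻¹ with hN
  have hA : S.adjugate.map (fun p => p.coeff (n - 1)) = 1 := by
    have := coeff_adjugate_X_add_C_pred (schur J)
    rwa [Fintype.card_fin] at this
  have hT : S.det.coeff (n - 1) = (schur J).trace := by
    have := coeff_det_X_add_C_pred (schur J)
    rwa [Fintype.card_fin] at this
  have hCs : ∀ {l o : Type} (M : Matrix l o ℝ[X]), (C d • M).map (fun p => p.coeff (n - 1))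
      = d • M.map (fun p => p.coeff (n - 1)) := by
    intro l o M
    ext i j
    simp [Matrix.map_apply]
  have hNs : ∀ {l o : Type} (M : Matrix l o ℝ[X]), (-M).map (fun p => p.coeff (n - 1))
      = -M.map (fun p => p.coeff (n - 1)) := by
    intro l o M
    ext i j
    simp [Matrix.map_apply]
  rw [fromBlocks_multiply, fromBlocks_multiply, fromBlocks_map, fromBlocks_smul]
  congr 1
  · have h1 : (S.det • (d • N).map C).map (fun p => p.coeff (n - 1))
        = (schur J).trace • d • N := by
      ext i j
      simp only [Matrix.map_apply, Matrix.smul_apply, smul_eq_mul, coeff_mul_C, hT]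
    have h2 : (-(N * J.toBlocks₁₂).map C * (C d • S.adjugate)
        * -(J.toBlocks₂₁ * N).map C).map (fun p => p.coeff (n - 1))
        = d • (N * J.toBlocks₁₂ * (J.toBlocks₂₁ * N)) := by
      rw [Matrix.neg_mul, Matrix.mul_neg, Matrix.neg_mul, neg_neg, coeff_mul_map_C, coeff_map_C_mul, hCs, hA]
      simp
    have h3 : ∀ A B : Matrix (Fin m) (Fin m) ℝ[X], (A + B).map (fun p => p.coeff (n - 1))
        = A.map (fun p => p.coeff (n - 1)) + B.map (fun p => p.coeff (n - 1)) := by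
      intro A B; ext i j; simp [Matrix.map_apply]
    rw [Matrix.one_mul, Matrix.mul_zero, add_zero, Matrix.mul_one, Matrix.mul_zero, zero_add,
      h3, h1, h2, smul_add, smul_comm]
  · rw [Matrix.one_mul, Matrix.mul_zero, zero_add, Matrix.mul_zero, Matrix.mul_one, zero_add,
      Matrix.neg_mul, hNs, coeff_map_C_mul, hCs, hA]
    simp
  · rw [Matrix.zero_mul, Matrix.one_mul, zero_add, Matrix.zero_mul, Matrix.mul_zero, zero_add,
      zero_add]
    rw [Matrix.one_mul, Matrix.mul_neg, hNs, coeff_mul_map_C, hCs, hA]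
    simp
  · simp only [Matrix.zero_mul, Matrix.one_mul, zero_add, Matrix.mul_zero, Matrix.mul_one]
    rw [hCs, hA]

end CofactorCoefficient

/-! ### The quadratic integral H_(n) in closed form. -/

section QuadraticIntegral

variable {m n : ℕ} {Y : Set (Fin m → ℝ)} {X : Set (Fin n → ℝ)}
  {g J : (Fin m ⊕ Fin n → ℝ) → Matrix (Fin m ⊕ Fin n) (Fin m ⊕ Fin n) ℝ}
  {Q : (Fin m ⊕ Fin n → ℝ) → Fin m ⊕ Fin n → ℝ}

theorem trace_schur (J : Matrix (Fin m ⊕ Fin n) (Fin m ⊕ Fin n) ℝ) :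
    (schur J).trace = J.toBlocks₂₂.trace
      - (J.toBlocks₁₁⁻¹ * (J.toBlocks₁₂ * J.toBlocks₂₁)).trace := by
  rw [schur, Matrix.trace_sub, Matrix.mul_assoc, Matrix.trace_mul_comm J.toBlocks₂₁,
    Matrix.mul_assoc]

/-- The quadratic integral `(det J₁)⁻¹ H_(n)`, where `p₁ = g₁ v`, `v = J₁ w` and `p̃ = g₁ w`. -/
theorem det_inv_mul_quadIntegral (hs : IsDrivenCofactorSystem Y X g Q J) (hn : n ≠ 0)
    {q : Fin m ⊕ Fin n → ℝ} (hq : q ∈ domain Y X) (hJ : IsUnit (J q).toBlocks₁₁.det)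
    (W : (Fin m ⊕ Fin n → ℝ) → ℝ) (w : Fin m → ℝ) (p : Fin n → ℝ) :
    (J q).toBlocks₁₁.det⁻¹ * quadIntegral g J n W q
        (join ((g q).toBlocks₁₁ *ᵥ ((J q).toBlocks₁₁ *ᵥ w)) p)
      = (1 / 2) * (p ⬝ᵥ (g q).toBlocks₂₂⁻¹ *ᵥ p) - p ⬝ᵥ (J q).toBlocks₂₁ *ᵥ w
        + (1 / 2) * (schur (J q)).trace * (((g q).toBlocks₁₁ *ᵥ w) ⬝ᵥ (J q).toBlocks₁₁ *ᵥ w)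
        + (1 / 2) * (((g q).toBlocks₁₁ *ᵥ w) ⬝ᵥ ((J q).toBlocks₁₂ * (J q).toBlocks₂₁) *ᵥ w)
        + (J q).toBlocks₁₁.det⁻¹ * W q := by
  set G := (g q).toBlocks₁₁ with hG
  set J₁ := (J q).toBlocks₁₁ with hJ₁
  set J₁₂ := (J q).toBlocks₁₂ with hJ₁₂
  set J₂₁ := (J q).toBlocks₂₁ with hJ₂₁
  set H := (g q).toBlocks₂₂ with hH
  have hGu : IsUnit G.det := hs.isUnit_det_metric₁ hq
  have hHu : IsUnit H.det := hs.isUnit_det_metric₂ hq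
  have hGt : Gᵀ = G := hs.metric₁_transpose hq
  have hGJ : G * J₁ = J₁ᵀ * G := hs.metric₁_mul_J₁₁ hq
  have hGJ₂ : G * J₁₂ = J₂₁ᵀ * H := hs.metric₁_mul_J₁₂ hq
  have hsum : ∀ M : Matrix (Fin m ⊕ Fin n) (Fin m ⊕ Fin n) ℝ, ∀ P : Fin m ⊕ Fin n → ℝ,
      ∑ α, ∑ β, M α β * P α * P β = P ⬝ᵥ M *ᵥ P := by
    intro M P
    simp only [dotProduct, mulVec, Finset.mul_sum]
    exact Finset.sum_congr rfl fun α _ => Finset.sum_congr rfl fun β _ => by ring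
  have hd : J₁.det ≠ 0 := hJ.ne_zero
  have hjoin : ∀ (y : Fin m → ℝ) (x : Fin n → ℝ), join y x = Sum.elim y x := fun _ _ => rfl
  have hGv : G⁻¹ *ᵥ (G *ᵥ (J₁ *ᵥ w)) = J₁ *ᵥ w := by
    rw [mulVec_mulVec, nonsing_inv_mul _ hGu, one_mulVec]
  have hNv : J₁⁻¹ *ᵥ (J₁ *ᵥ w) = w := by
    rw [mulVec_mulVec, nonsing_inv_mul _ hJ, one_mulVec]
  -- The g₁-symmetry of J₁ moves J₁⁻¹ to the left factor and turns the momenta g₁v into g₁w, which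
  -- is p̃.
  have hp : ∀ z, (G *ᵥ (J₁ *ᵥ w)) ⬝ᵥ J₁⁻¹ *ᵥ z = (G *ᵥ w) ⬝ᵥ z := by
    intro z
    rw [mulVec_mulVec, hGJ, ← mulVec_mulVec, mulVec_transpose, ← dotProduct_mulVec,
      mulVec_mulVec, mul_nonsing_inv _ hJ, one_mulVec]
  have hp1 : (G *ᵥ (J₁ *ᵥ w)) ⬝ᵥ w = (G *ᵥ w) ⬝ᵥ J₁ *ᵥ w := by
    have := hp (J₁ *ᵥ w)
    rwa [hNv] at this
  -- The two off-diagonal blocks of A_(n) contribute equal cross terms, because g₁J₁₂ = J₂₁ᵀg₂.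
  have hp2 : (G *ᵥ w) ⬝ᵥ J₁₂ *ᵥ (H⁻¹ *ᵥ p) = p ⬝ᵥ J₂₁ *ᵥ w := by
    rw [mulVec_dotProduct_eq_of_transpose_eq hGt, mulVec_mulVec, hGJ₂, mulVec_mulVec,
      Matrix.mul_assoc, mul_nonsing_inv _ hHu, Matrix.mul_one, mulVec_transpose, dotProduct_comm,
      ← dotProduct_mulVec]
  rw [quadIntegral, hsum, cofCoeff_eq hn _ hJ, hs.inv_metric_eq hq, Matrix.smul_mul, smul_mulVec,
    dotProduct_smul, smul_eq_mul, mul_add, ← mulVec_mulVec, hjoin, fromBlocks_mulVec,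
    fromBlocks_mulVec, sumElim_dotProduct_sumElim]
  simp only [Sum.elim_comp_inl, Sum.elim_comp_inr, zero_mulVec, add_zero, zero_add, one_mulVec,
    ← hG, ← hJ₁, ← hJ₁₂, ← hJ₂₁, ← hH, hGv, add_mulVec, smul_mulVec, neg_mulVec,
    ← mulVec_mulVec, hNv, dotProduct_add, dotProduct_neg, dotProduct_smul, smul_eq_mul, hp, hp1,
    hp2]
  field_simp
  ring

end QuadraticIntegral

/-! ### The differentials of the eigenfunctions. -/

section Eigenfunctions

variable {m n : ℕ} {Y : Set (Fin m → ℝ)} {X : Set (Fin n → ℝ)}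
  {g J : (Fin m ⊕ Fin n → ℝ) → Matrix (Fin m ⊕ Fin n) (Fin m ⊕ Fin n) ℝ}
  {Q : (Fin m ⊕ Fin n → ℝ) → Fin m ⊕ Fin n → ℝ}

theorem adjugate_eq_det_smul_inv {κ : Type*} [Fintype κ] [DecidableEq κ] {G : Matrix κ κ ℝ}
    (hG : IsUnit G.det) : G.adjugate = G.det • G⁻¹ := by
  rw [inv_def, smul_smul, Ring.mul_inverse_cancel _ hG, one_smul]

/-- The hypothesis says Mᵀ = GMG⁻¹; the adjugate reverses products, and the factors det G and det
G⁻¹ cancel. No inverse of M is involved: the lemma is applied to a singular M. -/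
theorem mul_adjugate_mul_inv {κ : Type*} [Fintype κ] [DecidableEq κ] {G M : Matrix κ κ ℝ}
    (hG : IsUnit G.det) (h : G * M = Mᵀ * G) : G * M.adjugate * G⁻¹ = M.adjugateᵀ := by
  have h1 : Mᵀ = G * M * G⁻¹ := by rw [h, Matrix.mul_assoc, mul_nonsing_inv _ hG, Matrix.mul_one]
  rw [adjugate_transpose, h1, adjugate_mul_distrib, adjugate_mul_distrib]
  have h2 : G⁻¹.adjugate = G⁻¹.det • G := by
    have : IsUnit G⁻¹.det := by rw [det_nonsing_inv]; exact hG.ringInverse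
    rw [adjugate_eq_det_smul_inv this, nonsing_inv_nonsing_inv _ hG]
  rw [h2, adjugate_eq_det_smul_inv hG]
  simp only [Matrix.smul_mul, Matrix.mul_smul, smul_smul]
  rw [← det_mul, mul_nonsing_inv _ hG, det_one, one_smul, Matrix.mul_assoc]

/-- Put M = J − fP₂ and differentiate det M = 0 by Jacobi's formula. The commutator [J, Γ_γ] equals
[M, Γ_γ] and is killed by adj M, since M adj M = adj M M = 0. The two rank-one terms contribute
equally by g-symmetry. So tr(adj M P₂) df = θ adj M, and multiplying by M on the right annihilates
θ. -/
theorem trace_adjugate_mul_projK_smul_vecMul (hs : IsDrivenCofactorSystem Y X g Q J)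
    {f : (Fin m ⊕ Fin n → ℝ) → ℝ} (hf : ContDiffOn ℝ ∞ f (domain Y X))
    (h0 : ∀ q ∈ domain Y X, (J q - f q • projK ℝ).det = 0) {q : Fin m ⊕ Fin n → ℝ}
    (hq : q ∈ domain Y X) :
    ((J q - f q • projK ℝ).adjugate * projK ℝ).trace •
      ((fun γ => pd f γ q) ᵥ* (J q - f q • projK ℝ)) = 0 := by
  obtain ⟨θ, hθ⟩ := hs.scKt.exists_pdMatrix_eq hs.isOpen hs.metric hq
  set M := J q - f q • projK ℝ with hM
  have hdf := hf.differentiableAt_of_isOpen hs.isOpen hq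
  have hdet : M.det = 0 := h0 q hq
  have hGu := hs.metric.isUnit_det hq
  have hGM : g q * M = Mᵀ * g q := by
    have hP : g q * projK ℝ = (projK ℝ)ᵀ * g q := by
      rw [hs.metric_eq_fromBlocks hq, projK, fromBlocks_transpose, fromBlocks_multiply,
        fromBlocks_multiply]
      simp
    rw [hM, Matrix.mul_sub, hs.scKt.mul_eq_transpose_mul hs.metric hq, Matrix.mul_smul, hP,
      transpose_sub, transpose_smul, Matrix.sub_mul, Matrix.smul_mul]
  have hpd : ∀ γ, pdMatrix (fun r => J r - f r • projK ℝ) γ q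
      = pdMatrix J γ q - pd f γ q • projK ℝ := by
    intro γ
    ext α β
    simp only [pdMatrix_apply, Matrix.sub_apply, Matrix.smul_apply, smul_eq_mul]
    rw [pd_sub (hs.differentiableAt_J hq α β) (hdf.mul_const _), pd_mul_const hdf]
  have key : ∀ γ, pd f γ q * (M.adjugate * projK ℝ).trace = (θ ᵥ* M.adjugate) γ := by
    intro γ
    have h1 : pd (fun r => (J r - f r • projK ℝ).det) γ q = 0 :=
      pd_eq_zero_of_isOpen hs.isOpen h0 hq γ
    rw [pd_det (M := fun r => J r - f r • projK ℝ)
      (fun α β => (hs.differentiableAt_J hq α β).fun_sub (hdf.mul_const _)), hpd, (hθ γ).2] at h1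
    set Γ := christoffelMatrix g q γ with hΓ
    have hΓP : Γ * projK ℝ = projK ℝ * Γ := hs.christoffelMatrix_mul_projK hq γ
    have hcomm : J q * Γ - Γ * J q = M * Γ - Γ * M := by
      rw [hM, Matrix.sub_mul, Matrix.mul_sub, Matrix.smul_mul, Matrix.mul_smul, hΓP]
      abel
    have ht : (M.adjugate * (M * Γ - Γ * M)).trace = 0 := by
      rw [Matrix.mul_sub, Matrix.trace_sub, ← Matrix.mul_assoc, adjugate_mul, hdet,
        Matrix.trace_mul_comm M.adjugate, Matrix.mul_assoc, mul_adjugate, hdet]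
      simp
    have h2 : (fun β => g q β γ) ⬝ᵥ M.adjugate *ᵥ ((g q)⁻¹ *ᵥ θ) = (θ ᵥ* M.adjugate) γ := by
      have h3 : (fun β => g q β γ) = g q γ := funext fun β => hs.metric.apply_comm hq β γ
      have h4 : g q γ ⬝ᵥ M.adjugate *ᵥ ((g q)⁻¹ *ᵥ θ)
          = ((g q * M.adjugate * (g q)⁻¹) *ᵥ θ) γ := by
        rw [← mulVec_mulVec, ← mulVec_mulVec]; rfl
      rw [h3, h4, mul_adjugate_mul_inv hGu hGM, mulVec_transpose]
    have h5 : θ ⬝ᵥ M.adjugate *ᵥ Pi.single γ 1 = (θ ᵥ* M.adjugate) γ := by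
      rw [dotProduct_mulVec, dotProduct_single_one]
    rw [hcomm, ← hM, Matrix.mul_sub, Matrix.trace_sub, Matrix.mul_add, Matrix.trace_add, ht,
      Matrix.mul_smul, Matrix.trace_smul, Matrix.mul_add, Matrix.trace_add, Matrix.mul_vecMulVec,
      Matrix.mul_vecMulVec, trace_vecMulVec, trace_vecMulVec, dotProduct_comm _ (fun β => g q β γ),
      dotProduct_comm _ θ, h2, h5, Matrix.mul_smul, Matrix.trace_smul, smul_eq_mul,
      smul_eq_mul] at h1
    linarith
  have h6 : (M.adjugate * projK ℝ).trace • (fun γ => pd f γ q) = θ ᵥ* M.adjugate := by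
    ext γ
    rw [Pi.smul_apply, smul_eq_mul, mul_comm, key]
  rw [← smul_vecMul, h6, vecMul_vecMul, adjugate_mul, hdet, zero_smul, vecMul_zero]

open Polynomial in
-- Evaluation at X = −c. The solutions of det(J − cP₂) = 0 are therefore the eigenvalues of the
-- Schur complement.
theorem det_sub_smul_projK (J : Matrix (Fin m ⊕ Fin n) (Fin m ⊕ Fin n) ℝ)
    (hJ : IsUnit J.toBlocks₁₁.det) (c : ℝ) :
    (J - c • projK ℝ).det = J.toBlocks₁₁.det * (-schur J).charpoly.eval (-c) := by
  have h := congrArg (Polynomial.evalRingHom (-c)) (det_add_X_smul_projK J hJ)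
  rw [← charpoly_neg_eq, RingHom.map_mul, RingHom.map_det] at h
  have h2 : (Polynomial.evalRingHom (-c)).mapMatrix (J.map C + (X : ℝ[X]) • projK ℝ[X])
      = J - c • projK ℝ := by
    ext (i | a) (j | b) <;> simp [projK, Matrix.map_apply, Matrix.one_apply]
    split_ifs <;> simp [sub_eq_add_neg]
  rw [h2] at h
  simpa using h

open Polynomial in
theorem charpoly_eq_nodal {κ : Type*} [Fintype κ] [DecidableEq κ] {S : Matrix κ κ ℝ} {c : κ → ℝ}
    (hc : Function.Injective c) (h : ∀ a, S.charpoly.eval (c a) = 0) :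
    S.charpoly = Lagrange.nodal Finset.univ c := by
  refine Polynomial.eq_of_monic_of_dvd_of_natDegree_le Lagrange.nodal_monic
    (Matrix.charpoly_monic S) ?_ ?_
  · exact Finset.prod_dvd_of_coprime
      ((Polynomial.pairwise_coprime_X_sub_C hc).set_pairwise _) fun a _ => dvd_iff_isRoot.2 (h a)
  · rw [Matrix.charpoly_natDegree_eq_dim, Lagrange.natDegree_nodal, Finset.card_univ]

/-- By Jacobi's formula this trace is minus the derivative of c ↦ det(J − cP₂) at c_a. With n
distinct roots in degree n, every root is simple and the derivative is nonzero. -/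
theorem trace_adjugate_mul_projK_ne_zero {J : Matrix (Fin m ⊕ Fin n) (Fin m ⊕ Fin n) ℝ}
    (hJ : IsUnit J.toBlocks₁₁.det) {c : Fin n → ℝ} (hc : Function.Injective c)
    (h : ∀ a, (J - c a • projK ℝ).det = 0) (a : Fin n) :
    ((J - c a • projK ℝ).adjugate * projK ℝ).trace ≠ 0 := by
  have hr : ∀ b, (-schur J).charpoly.eval (-c b) = 0 := fun b => by
    have := h b
    rw [det_sub_smul_projK J hJ] at this
    exact (mul_eq_zero.1 this).resolve_left hJ.ne_zero
  have hnod := charpoly_eq_nodal (c := fun b => -c b) (fun b b' hb => hc (neg_injective hb)) hr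
  -- One real variable is modelled as `Unit → ℝ`, so that `pd_det` applies to an ordinary
  -- derivative.
  set q : Unit → ℝ := fun _ => c a with hq
  have hco : DifferentiableAt ℝ (fun r : Unit → ℝ => r ()) q :=
    (hasFDerivAt_coord () q).differentiableAt
  have h1 : pd (fun r : Unit → ℝ => (J - r () • projK ℝ).det) () q
      = -((J - c a • projK ℝ).adjugate * projK ℝ).trace := by
    rw [pd_det (M := fun r : Unit → ℝ => J - r () • projK ℝ)
      (fun α β => (differentiableAt_const _).fun_sub (hco.mul_const _))]
    have : pdMatrix (fun r : Unit → ℝ => J - r () • projK ℝ) () q = -projK ℝ := by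
      ext α β
      simp only [pdMatrix_apply, Matrix.sub_apply, Matrix.smul_apply, smul_eq_mul]
      rw [pd_sub (differentiableAt_const _) (hco.mul_const _), pd_const, pd_mul_const hco, pd_coord]
      simp
    rw [this, Matrix.mul_neg, Matrix.trace_neg]
  have h2 : pd (fun r : Unit → ℝ => (J - r () • projK ℝ).det) () q
      = -(J.toBlocks₁₁.det * (-schur J).charpoly.derivative.eval (-c a)) := by
    simp only [det_sub_smul_projK J hJ]
    have hneg : HasFDerivAt (fun r : Unit → ℝ => -r ())
        (-ContinuousLinearMap.proj (R := ℝ) (φ := fun _ => ℝ) ()) q := (hasFDerivAt_coord () q).neg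
    have hp := ((-schur J).charpoly.hasDerivAt (-c a)).comp_hasFDerivAt q hneg
    have hp' := hp.const_mul J.toBlocks₁₁.det
    rw [pd]
    erw [hp'.fderiv]
    simp
  have h3 : (-schur J).charpoly.derivative.eval (-c a) ≠ 0 := by
    rw [hnod, Lagrange.eval_nodal_derivative_eval_node_eq (v := fun b => -c b) (Finset.mem_univ a),
      Lagrange.eval_nodal, Finset.prod_ne_zero_iff]
    intro b hb
    have : c b ≠ c a := fun hba => (Finset.ne_of_mem_erase hb) (hc hba)
    intro h0
    exact this (by linarith)
  intro h0
  rw [h1, h0, neg_zero] at h2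
  exact mul_ne_zero hJ.ne_zero h3 (by linarith)

/-- Each nonvanishing set is relatively open by continuity and meets every nonempty open set by
hypothesis, so finitely many of them can be intersected one at a time. -/
theorem exists_mem_forall_ne_zero {E κ : Type*} [TopologicalSpace E] {U : Set E}
    {f : κ → E → ℝ} (hf : ∀ k, ContinuousOn (f k) U) (s : Finset κ)
    (h : ∀ k ∈ s, ∀ V, IsOpen V → V ⊆ U → V.Nonempty → ∃ q ∈ V, f k q ≠ 0) :
    ∀ V, IsOpen V → V ⊆ U → V.Nonempty → ∃ q ∈ V, ∀ k ∈ s, f k q ≠ 0 := by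
  classical
  induction s using Finset.induction_on with
  | empty => exact fun V _ _ ⟨q, hq⟩ => ⟨q, hq, by simp⟩
  | insert k s _ ih =>
    intro V hV hVU hne
    have hV' : IsOpen (V ∩ f k ⁻¹' {0}ᶜ) :=
      ((hf k).mono hVU).isOpen_inter_preimage hV isOpen_compl_singleton
    obtain ⟨q, hq, hq0⟩ := h k (Finset.mem_insert_self _ _) V hV hVU hne
    obtain ⟨q', hq', hq''⟩ := ih (fun k hk => h k (Finset.mem_insert_of_mem hk)) _ hV'
      (Set.inter_subset_left.trans hVU) ⟨q, hq, hq0⟩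
    refine ⟨q', hq'.1, fun k' hk' => ?_⟩
    rcases Finset.mem_insert.1 hk' with rfl | hk'
    · exact hq'.2
    · exact hq'' k' hk'

namespace IsIndependentEigenfunctions

variable {u : Fin n → (Fin m ⊕ Fin n → ℝ) → ℝ}
  (hu : IsIndependentEigenfunctions (domain Y X) J u)
include hu

/-- If two eigenfunctions agreed on a nonempty open set, two rows of the Jacobian would coincide
there. So the eigenvalues are distinct on a dense set. -/
theorem exists_mem_injective {V : Set (Fin m ⊕ Fin n → ℝ)}
    (hV : IsOpen V) (hVU : V ⊆ domain Y X) (hne : V.Nonempty) :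
    ∃ q ∈ V, Function.Injective fun a => u a q := by
  obtain ⟨q, hq, h⟩ := exists_mem_forall_ne_zero (κ := Fin n × Fin n)
    (f := fun k q => u k.1 q - u k.2 q)
    (fun k => (hu.smooth k.1).continuousOn.sub (hu.smooth k.2).continuousOn)
    (Finset.univ.filter fun k => k.1 ≠ k.2) (by
      intro k hk V hV hVU ⟨q, hq⟩
      by_contra! hcon
      have heq : ∀ γ, pd (u k.1) γ q = pd (u k.2) γ q := fun γ =>
        pd_congr_of_isOpen hV (fun r hr => sub_eq_zero.1 (hcon r hr)) hq γ
      refine hu.independent q (hVU hq) (Matrix.det_zero_of_row_eq (Finset.mem_filter.1 hk).2 ?_)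
      ext b
      exact heq _) V hV hVU hne
  refine ⟨q, hq, fun a b hab => ?_⟩
  by_contra hne
  exact h (a, b) (by simp [hne]) (sub_eq_zero.2 hab)

/-- The differentials of the eigenfunctions annihilate the vector fields `J (∂/∂y^i)`. -/
theorem sum_J_mul_pd_eq_zero (hs : IsDrivenCofactorSystem Y X g Q J)
    (hJ₁ : ∀ q ∈ domain Y X, (J q).toBlocks₁₁.det ≠ 0) {q : Fin m ⊕ Fin n → ℝ}
    (hq : q ∈ domain Y X) (a : Fin n) (i : Fin m) :
    ∑ α, pd (u a) α q * J q α (Sum.inl i) = 0 := by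
  by_contra hne
  -- The set where the claim fails is open, so if nonempty it contains a point with distinct
  -- eigenvalues, and at such a point the claim holds.
  have hc : ContinuousOn (fun q => ∑ α, pd (u a) α q * J q α (Sum.inl i)) (domain Y X) :=
    (ContDiffOn.sum fun α _ =>
      (contDiffOn_pd hs.isOpen (hu.smooth a) α).mul (hs.scKt.smooth α _)).continuousOn
  obtain ⟨r, hr, hinj⟩ := hu.exists_mem_injective
    (hc.isOpen_inter_preimage hs.isOpen isOpen_compl_singleton) Set.inter_subset_left ⟨q, hq, hne⟩
  refine hr.2 ?_
  have h1 := trace_adjugate_mul_projK_smul_vecMul hs (hu.smooth a)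
    (fun q hq => hu.eigen q hq a) hr.1
  have h2 := trace_adjugate_mul_projK_ne_zero (hJ₁ r hr.1).isUnit hinj (hu.eigen r hr.1) a
  -- P₂ has no columns in the y-directions, so there J − u^aP₂ may be replaced by J.
  have h3 := congrFun ((smul_eq_zero.1 h1).resolve_left h2) (Sum.inl i)
  simpa [Matrix.vecMul, dotProduct, projK, Fintype.sum_sum_type] using h3

end IsIndependentEigenfunctions

end Eigenfunctions

/-! ### Generating functions, the symplectic form and Hamilton's equations. -/

section CanonicalTransformations

variable {n : ℕ}
  {Φ : OpenPartialHomeomorph (ℝ × (Fin n → ℝ) × (Fin n → ℝ)) (ℝ × (Fin n → ℝ) × (Fin n → ℝ))}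
  {F H : ℝ × (Fin n → ℝ) × (Fin n → ℝ) → ℝ} {O : Set (ℝ × (Fin n → ℝ) × (Fin n → ℝ))}

theorem map_position_eq_sum (L : ℝ × (Fin n → ℝ) × (Fin n → ℝ) →L[ℝ] ℝ) (x : Fin n → ℝ) :
    L (0, x, 0) = ∑ a, x a * L (0, Pi.single a 1, 0) := by
  have h : ((0, x, 0) : ℝ × (Fin n → ℝ) × (Fin n → ℝ))
      = ∑ a, x a • ((0, Pi.single a 1, 0) : ℝ × (Fin n → ℝ) × (Fin n → ℝ)) := by
    refine Prod.ext (by simp [Prod.fst_sum]) (Prod.ext ?_ (by simp [Prod.snd_sum]))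
    simp only [Prod.snd_sum, Prod.fst_sum, Prod.smul_snd, Prod.smul_fst]
    exact pi_eq_sum_univ' x
  rw [h, map_sum]
  simp only [map_smul, smul_eq_mul]

theorem map_momentum_eq_sum (L : ℝ × (Fin n → ℝ) × (Fin n → ℝ) →L[ℝ] ℝ) (x : Fin n → ℝ) :
    L (0, 0, x) = ∑ a, x a * L (0, 0, Pi.single a 1) := by
  have h : ((0, 0, x) : ℝ × (Fin n → ℝ) × (Fin n → ℝ))
      = ∑ a, x a • ((0, 0, Pi.single a 1) : ℝ × (Fin n → ℝ) × (Fin n → ℝ)) := by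
    refine Prod.ext (by simp [Prod.fst_sum]) (Prod.ext (by simp [Prod.snd_sum, Prod.fst_sum]) ?_)
    simp only [Prod.snd_sum, Prod.smul_snd]
    exact pi_eq_sum_univ' x
  rw [h, map_sum]
  simp only [map_smul, smul_eq_mul]

/-- The point `(t, q, P)` at which the generating function is evaluated. -/
def mixedPoint (Φ : OpenPartialHomeomorph (ℝ × (Fin n → ℝ) × (Fin n → ℝ))
    (ℝ × (Fin n → ℝ) × (Fin n → ℝ))) (z : ℝ × (Fin n → ℝ) × (Fin n → ℝ)) :
    ℝ × (Fin n → ℝ) × (Fin n → ℝ) :=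
  (z.1, z.2.1, (Φ z).2.2)

/-- The derivative of `mixedPoint`. -/
def mixedVector (Φ : OpenPartialHomeomorph (ℝ × (Fin n → ℝ) × (Fin n → ℝ))
    (ℝ × (Fin n → ℝ) × (Fin n → ℝ))) (z ζ : ℝ × (Fin n → ℝ) × (Fin n → ℝ)) :
    ℝ × (Fin n → ℝ) × (Fin n → ℝ) :=
  (ζ.1, ζ.2.1, (fderiv ℝ Φ z ζ).2.2)

theorem fderiv_comp_mixedPoint (hsm : ContDiffOn ℝ ∞ Φ Φ.source) (hO : IsOpen O)
    (hF : ContDiffOn ℝ ∞ F O) {z : ℝ × (Fin n → ℝ) × (Fin n → ℝ)} (hz : z ∈ Φ.source)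
    (hzO : mixedPoint Φ z ∈ O) (e : ℝ × (Fin n → ℝ) × (Fin n → ℝ)) :
    DifferentiableAt ℝ (fun z => fderiv ℝ F (mixedPoint Φ z) e) z ∧
    ∀ ζ, fderiv ℝ (fun z => fderiv ℝ F (mixedPoint Φ z) e) z ζ
      = fderiv ℝ (fderiv ℝ F) (mixedPoint Φ z) (mixedVector Φ z ζ) e := by
  have hd : DifferentiableAt ℝ Φ z := hsm.differentiableAt_of_isOpen Φ.open_source hz
  have hm : HasFDerivAt (mixedPoint Φ) ((ContinuousLinearMap.fst ℝ _ _).prod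
      (((ContinuousLinearMap.fst ℝ _ _).comp (ContinuousLinearMap.snd ℝ _ _)).prod
        ((ContinuousLinearMap.snd ℝ _ _).comp ((ContinuousLinearMap.snd ℝ _ _).comp
          (fderiv ℝ Φ z))))) z :=
    hasFDerivAt_fst.prodMk (hasFDerivAt_snd.fst.prodMk hd.hasFDerivAt.snd.snd)
  have hF2 : DifferentiableAt ℝ (fderiv ℝ F) (mixedPoint Φ z) :=
    (hF.fderiv_of_isOpen hO (m := ∞) (by simp)).differentiableAt_of_isOpen hO hzO
  have h := (hF2.hasFDerivAt.comp z hm).clm_apply (hasFDerivAt_const e z)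
  refine ⟨h.differentiableAt, fun ζ => ?_⟩
  have h2 := DFunLike.congr_fun h.fderiv ζ
  simp only [Function.comp_def] at h2
  rw [h2]
  simp [mixedVector]

theorem isSymmSndFDerivAt_of_isOpen {E : Type*} [NormedAddCommGroup E] [NormedSpace ℝ E]
    {O : Set E} (hO : IsOpen O) {F : E → ℝ} (hF : ContDiffOn ℝ ∞ F O) {w : E} (hw : w ∈ O) :
    IsSymmSndFDerivAt ℝ F w :=
  (hF.contDiffAt (hO.mem_nhds hw)).isSymmSndFDerivAt
    (by simpa using WithTop.coe_le_coe.mpr (le_top : (2 : ℕ∞) ≤ ⊤))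

/-- The behaviour of the symplectic form under a transformation given by a generating function. -/
theorem symplecticForm_fderiv (hsm : ContDiffOn ℝ ∞ Φ Φ.source) (hO : IsOpen O)
    (hF : ContDiffOn ℝ ∞ F O) (hmix : ∀ z ∈ Φ.source, mixedPoint Φ z ∈ O)
    (hold : ∀ z ∈ Φ.source, ∀ a,
      z.2.2 a = fderiv ℝ F (mixedPoint Φ z) (0, Pi.single a 1, 0))
    (hnew : ∀ z ∈ Φ.source, ∀ a,
      (Φ z).2.1 a = fderiv ℝ F (mixedPoint Φ z) (0, 0, Pi.single a 1))
    {z : ℝ × (Fin n → ℝ) × (Fin n → ℝ)} (hz : z ∈ Φ.source) (τ : ℝ)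
    (ξ η : (Fin n → ℝ) × (Fin n → ℝ)) :
    symplecticForm (fderiv ℝ Φ z (τ, ξ)).2 (fderiv ℝ Φ z (0, η)).2
      = symplecticForm ξ η
        - τ * fderiv ℝ (fderiv ℝ F) (mixedPoint Φ z) (mixedVector Φ z (0, η)) (1, 0, 0) := by
  have hd : DifferentiableAt ℝ Φ z := hsm.differentiableAt_of_isOpen Φ.open_source hz
  have hold' : ∀ ζ : ℝ × (Fin n → ℝ) × (Fin n → ℝ), ∀ a, ζ.2.2 a
      = fderiv ℝ (fderiv ℝ F) (mixedPoint Φ z) (mixedVector Φ z ζ) (0, Pi.single a 1, 0) := by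
    intro ζ a
    rw [← (fderiv_comp_mixedPoint hsm hO hF hz (hmix z hz) _).2]
    have h1 : HasFDerivAt (fun z : ℝ × (Fin n → ℝ) × (Fin n → ℝ) => z.2.2 a)
        ((ContinuousLinearMap.proj (R := ℝ) (φ := fun _ => ℝ) a).comp
          ((ContinuousLinearMap.snd ℝ _ _).comp (ContinuousLinearMap.snd ℝ _ _))) z :=
      (ContinuousLinearMap.proj (R := ℝ) (φ := fun _ => ℝ) a).hasFDerivAt.comp z
        (hasFDerivAt_snd (p := z)).snd
    rw [← (Filter.eventuallyEq_of_mem (Φ.open_source.mem_nhds hz)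
      fun z hz => hold z hz a).fderiv_eq, h1.fderiv]
    rfl
  have hnew' : ∀ ζ : ℝ × (Fin n → ℝ) × (Fin n → ℝ), ∀ a, (fderiv ℝ Φ z ζ).2.1 a
      = fderiv ℝ (fderiv ℝ F) (mixedPoint Φ z) (mixedVector Φ z ζ) (0, 0, Pi.single a 1) := by
    intro ζ a
    rw [← (fderiv_comp_mixedPoint hsm hO hF hz (hmix z hz) _).2]
    have h1 : HasFDerivAt (fun z => (Φ z).2.1 a)
        ((ContinuousLinearMap.proj (R := ℝ) (φ := fun _ => ℝ) a).comp
          ((ContinuousLinearMap.fst ℝ _ _).comp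
            ((ContinuousLinearMap.snd ℝ _ _).comp (fderiv ℝ Φ z)))) z :=
      (ContinuousLinearMap.proj (R := ℝ) (φ := fun _ => ℝ) a).hasFDerivAt.comp z
        hd.hasFDerivAt.snd.fst
    rw [← (Filter.eventuallyEq_of_mem (Φ.open_source.mem_nhds hz)
      fun z hz => hnew z hz a).fderiv_eq, h1.fderiv]
    rfl
  set B := fderiv ℝ (fderiv ℝ F) (mixedPoint Φ z) with hB
  have hsymm : ∀ u v, B u v = B v u := fun u v =>
    (isSymmSndFDerivAt_of_isOpen hO hF (hmix z hz)).eq u v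
  set ξ' := (fderiv ℝ Φ z (τ, ξ)).2 with hξ'
  set η' := (fderiv ℝ Φ z (0, η)).2 with hη'
  -- The claim is the symmetry of the Hessian B on the mixed vectors of (τ, ξ) and (0, η), written
  -- in components. Paired with a position direction, B gives the variation of an old momentum;
  -- paired with a momentum direction, that of a new position. The pairing with the time direction
  -- is the defect.
  have e1 : symplecticForm ξ' η' = B (mixedVector Φ z (0, η)) (0, 0, ξ'.2)
      - B (mixedVector Φ z (τ, ξ)) (0, 0, η'.2) := by
    rw [map_momentum_eq_sum, map_momentum_eq_sum, symplecticForm, Finset.sum_sub_distrib]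
    simp only [← hnew']
    rfl
  have e2 : symplecticForm ξ η = B (mixedVector Φ z (τ, ξ)) (0, η.1, 0)
      - B (mixedVector Φ z (0, η)) (0, ξ.1, 0) := by
    rw [map_position_eq_sum, map_position_eq_sum, symplecticForm, Finset.sum_sub_distrib]
    simp only [← hold']
    congr 1 <;> exact Finset.sum_congr rfl fun a _ => mul_comm _ _
  have e3 : mixedVector Φ z (τ, ξ) = τ • (1, 0, 0) + (0, ξ.1, 0) + (0, 0, ξ'.2) := by
    refine Prod.ext ?_ (Prod.ext ?_ ?_) <;> simp [mixedVector, hξ']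
  have e4 : mixedVector Φ z (0, η) = (0, η.1, 0) + (0, 0, η'.2) := by
    refine Prod.ext ?_ (Prod.ext ?_ ?_) <;> simp [mixedVector, hη']
  have e5 : B (mixedVector Φ z (0, η)) (mixedVector Φ z (τ, ξ))
      = τ * B (mixedVector Φ z (0, η)) (1, 0, 0) + B (mixedVector Φ z (0, η)) (0, ξ.1, 0)
        + B (mixedVector Φ z (0, η)) (0, 0, ξ'.2) := by
    conv_lhs => rw [e3]
    rw [map_add, map_add, map_smul, smul_eq_mul]
  have e6 : B (mixedVector Φ z (τ, ξ)) (mixedVector Φ z (0, η))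
      = B (mixedVector Φ z (τ, ξ)) (0, η.1, 0) + B (mixedVector Φ z (τ, ξ)) (0, 0, η'.2) := by
    conv_lhs => rw [e4]
    rw [map_add]
  have e7 := hsymm (mixedVector Φ z (0, η)) (mixedVector Φ z (τ, ξ))
  rw [e1, e2]
  linarith

theorem IsCanonicalGeneratedBy.of_generating (hsm : ContDiffOn ℝ ∞ Φ Φ.source)
    (hsm' : ContDiffOn ℝ ∞ Φ.symm Φ.target) (htime : ∀ z ∈ Φ.source, (Φ z).1 = z.1)
    (hO : IsOpen O) (hF : ContDiffOn ℝ ∞ F O) (hmix : ∀ z ∈ Φ.source, mixedPoint Φ z ∈ O)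
    (hold : ∀ z ∈ Φ.source, ∀ a,
      z.2.2 a = fderiv ℝ F (mixedPoint Φ z) (0, Pi.single a 1, 0))
    (hnew : ∀ z ∈ Φ.source, ∀ a,
      (Φ z).2.1 a = fderiv ℝ F (mixedPoint Φ z) (0, 0, Pi.single a 1)) :
    IsCanonicalGeneratedBy Φ F where
  smooth := hsm
  smooth_symm := hsm'
  time := htime
  symplectic z hz ξ η := by
    rw [symplecticForm_fderiv hsm hO hF hmix hold hnew hz, zero_mul, sub_zero]
  differentiable z hz := hF.differentiableAt_of_isOpen hO (hmix z hz)
  old_momentum := hold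
  new_position := hnew

/-- Hamilton's equations at one instant. -/
theorem hamilton_iff {c : ℝ → (Fin n → ℝ) × (Fin n → ℝ)} {t : ℝ} :
    (∀ a, HasDerivAt (fun τ => (c τ).1 a) (fderiv ℝ H (t, c t) (0, 0, Pi.single a 1)) t ∧
      HasDerivAt (fun τ => (c τ).2 a) (- fderiv ℝ H (t, c t) (0, Pi.single a 1, 0)) t) ↔
    ∃ c', HasDerivAt c c' t ∧ ∀ η, symplecticForm c' η = -fderiv ℝ H (t, c t) (0, η) := by
  constructor
  · intro h
    refine ⟨(fun a => fderiv ℝ H (t, c t) (0, 0, Pi.single a 1),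
      fun a => -fderiv ℝ H (t, c t) (0, Pi.single a 1, 0)), ?_, fun η => ?_⟩
    · exact (hasDerivAt_pi.2 fun a => (h a).1).prodMk (hasDerivAt_pi.2 fun a => (h a).2)
    · have h1 : ((0, η) : ℝ × (Fin n → ℝ) × (Fin n → ℝ)) = (0, η.1, 0) + (0, 0, η.2) := by
        refine Prod.ext ?_ (Prod.ext ?_ ?_) <;> simp
      rw [h1, map_add, map_position_eq_sum, map_momentum_eq_sum, symplecticForm, neg_add,
        ← Finset.sum_neg_distrib, ← Finset.sum_neg_distrib, ← Finset.sum_add_distrib]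
      exact Finset.sum_congr rfl fun a _ => by ring
  · rintro ⟨c', hc', h⟩ a
    have h1 := h (Pi.single a 1, 0)
    have h2 := h (0, Pi.single a 1)
    simp only [symplecticForm, Pi.single_apply, mul_ite, mul_one, mul_zero, ite_mul, one_mul,
      zero_mul, Pi.zero_apply, sub_zero, zero_sub, Finset.sum_ite_eq', Finset.mem_univ, if_true,
      Finset.sum_neg_distrib, neg_inj] at h1 h2
    rw [← h1, ← h2]
    exact ⟨hasDerivAt_pi.1 hc'.fst a, hasDerivAt_pi.1 hc'.snd a⟩

namespace IsCanonicalGeneratedBy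

variable (hΦ : IsCanonicalGeneratedBy Φ F)
include hΦ

theorem eq_mk {z : ℝ × (Fin n → ℝ) × (Fin n → ℝ)} (hz : z ∈ Φ.source) :
    Φ z = (z.1, (Φ z).2) := Prod.ext (hΦ.time z hz) rfl

theorem fderiv_fst {z : ℝ × (Fin n → ℝ) × (Fin n → ℝ)} (hz : z ∈ Φ.source)
    (ζ : ℝ × (Fin n → ℝ) × (Fin n → ℝ)) : (fderiv ℝ Φ z ζ).1 = ζ.1 := by
  have hd := hΦ.smooth.differentiableAt_of_isOpen Φ.open_source hz
  have h1 : HasFDerivAt (fun z => (Φ z).1)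
      ((ContinuousLinearMap.fst ℝ _ _).comp (fderiv ℝ Φ z)) z := hd.hasFDerivAt.fst
  have h2 := (Filter.eventuallyEq_of_mem (Φ.open_source.mem_nhds hz) hΦ.time).fderiv_eq (𝕜 := ℝ)
  rw [h1.fderiv, (hasFDerivAt_fst (𝕜 := ℝ) (p := z)).fderiv] at h2
  exact DFunLike.congr_fun h2 ζ

/-- The differential of `Φ` is surjective on vectors tangent to the fibres of `t`. -/
theorem exists_fderiv_eq {z : ℝ × (Fin n → ℝ) × (Fin n → ℝ)} (hz : z ∈ Φ.source)
    (ρ : (Fin n → ℝ) × (Fin n → ℝ)) : ∃ η, fderiv ℝ Φ z (0, η) = (0, ρ) := by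
  have hd := hΦ.smooth.differentiableAt_of_isOpen Φ.open_source hz
  have hd' : DifferentiableAt ℝ Φ.symm (Φ z) :=
    hΦ.smooth_symm.differentiableAt_of_isOpen Φ.open_target (Φ.map_source hz)
  have h1 : HasFDerivAt (fun w => Φ (Φ.symm w)) ((fderiv ℝ Φ z).comp (fderiv ℝ Φ.symm (Φ z)))
      (Φ z) := by
    refine HasFDerivAt.comp (Φ z) ?_ hd'.hasFDerivAt
    rw [Φ.left_inv hz]
    exact hd.hasFDerivAt
  have h2 := (Filter.eventuallyEq_of_mem (Φ.open_target.mem_nhds (Φ.map_source hz))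
    (fun w hw => Φ.right_inv hw : ∀ w ∈ Φ.target, Φ (Φ.symm w) = id w)).fderiv_eq (𝕜 := ℝ)
  rw [h1.fderiv, fderiv_fun_id] at h2
  have h3 : fderiv ℝ Φ z (fderiv ℝ Φ.symm (Φ z) (0, ρ)) = (0, ρ) :=
    DFunLike.congr_fun h2 (0, ρ)
  have h4 : (fderiv ℝ Φ.symm (Φ z) (0, ρ)).1 = 0 := by
    rw [← hΦ.fderiv_fst hz, h3]
  refine ⟨(fderiv ℝ Φ.symm (Φ z) (0, ρ)).2, Eq.trans ?_ h3⟩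
  congr 1
  exact Prod.ext h4.symm rfl

theorem transformedHamiltonian_apply {z : ℝ × (Fin n → ℝ) × (Fin n → ℝ)} (hz : z ∈ Φ.source) :
    transformedHamiltonian Φ F H (Φ z) = H z + fderiv ℝ F (mixedPoint Φ z) (1, 0, 0) := by
  rw [transformedHamiltonian, Φ.left_inv hz, hΦ.time z hz, mixedPoint]

variable (hO : IsOpen O) (hF : ContDiffOn ℝ ∞ F O) (hmix : ∀ z ∈ Φ.source, mixedPoint Φ z ∈ O)
include hO hF hmix

theorem differentiableAt_transformedHamiltonian {z : ℝ × (Fin n → ℝ) × (Fin n → ℝ)}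
    (hz : z ∈ Φ.source) (hH : DifferentiableAt ℝ H z) :
    DifferentiableAt ℝ (transformedHamiltonian Φ F H) (Φ z) := by
  have hd' : DifferentiableAt ℝ Φ.symm (Φ z) :=
    hΦ.smooth_symm.differentiableAt_of_isOpen Φ.open_target (Φ.map_source hz)
  have h1 : DifferentiableAt ℝ (fun z => H z + fderiv ℝ F (mixedPoint Φ z) (1, 0, 0))
      (Φ.symm (Φ z)) := by
    rw [Φ.left_inv hz]
    exact hH.add (fderiv_comp_mixedPoint hΦ.smooth hO hF hz (hmix z hz) _).1
  refine (h1.comp (Φ z) hd').congr_of_eventuallyEq ?_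
  refine Filter.eventuallyEq_of_mem (Φ.open_target.mem_nhds (Φ.map_source hz)) fun w hw => ?_
  have := hΦ.transformedHamiltonian_apply (H := H) (Φ.map_target hw)
  rwa [Φ.right_inv hw] at this

theorem fderiv_transformedHamiltonian {z : ℝ × (Fin n → ℝ) × (Fin n → ℝ)}
    (hz : z ∈ Φ.source) (hH : DifferentiableAt ℝ H z) (ζ : ℝ × (Fin n → ℝ) × (Fin n → ℝ)) :
    fderiv ℝ (transformedHamiltonian Φ F H) (Φ z) (fderiv ℝ Φ z ζ) = fderiv ℝ H z ζ
      + fderiv ℝ (fderiv ℝ F) (mixedPoint Φ z) (mixedVector Φ z ζ) (1, 0, 0) := by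
  have hd := hΦ.smooth.differentiableAt_of_isOpen Φ.open_source hz
  have hG := fderiv_comp_mixedPoint hΦ.smooth hO hF hz (hmix z hz) (1, 0, 0)
  have h1 := ((hΦ.differentiableAt_transformedHamiltonian hO hF hmix hz hH).hasFDerivAt.comp z
    hd.hasFDerivAt).fderiv
  have h2 := (Filter.eventuallyEq_of_mem (Φ.open_source.mem_nhds hz)
    (fun z hz => hΦ.transformedHamiltonian_apply hz :
      ∀ z ∈ Φ.source, (transformedHamiltonian Φ F H ∘ Φ) z = _)).fderiv_eq (𝕜 := ℝ)
  simp only [Function.comp_def] at h1 h2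
  rw [h1, fderiv_fun_add hH hG.1] at h2
  have h3 := DFunLike.congr_fun h2 ζ
  simp only [ContinuousLinearMap.comp_apply, _root_.add_apply] at h3
  rw [h3, hG.2]

/-- Along a curve the tangent vector is (1, c'), and the defect of the symplectic form at τ = 1 is
exactly the differential of the term ∂F/∂t added to H. Hence both Hamilton conditions agree when
tested on η and on its image, and every vertical vector is such an image. -/
theorem intertwinesHamilton (hH : ∀ z ∈ Φ.source, DifferentiableAt ℝ H z) :
    IntertwinesHamilton Φ H (transformedHamiltonian Φ F H) := by
  intro S c hS hc
  have key : ∀ t ∈ S, ∀ c', ∀ η,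
      (symplecticForm c' η = -fderiv ℝ H (t, c t) (0, η) ↔
        symplecticForm (fderiv ℝ Φ (t, c t) (1, c')).2 (fderiv ℝ Φ (t, c t) (0, η)).2
          = -fderiv ℝ (transformedHamiltonian Φ F H) (t, (Φ (t, c t)).2)
            (0, (fderiv ℝ Φ (t, c t) (0, η)).2)) := by
    intro t ht c' η
    have hz := hc t ht
    have e1 := symplecticForm_fderiv hΦ.smooth hO hF hmix hΦ.old_momentum hΦ.new_position hz 1 c' η
    have e2 := hΦ.fderiv_transformedHamiltonian hO hF hmix hz (hH _ hz) (0, η)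
    have e3 : fderiv ℝ Φ (t, c t) (0, η) = (0, (fderiv ℝ Φ (t, c t) (0, η)).2) :=
      Prod.ext (hΦ.fderiv_fst hz _) rfl
    rw [hΦ.eq_mk hz, e3] at e2
    rw [e1, e2]
    constructor <;> intro h <;> linarith
  have hcurve : ∀ t ∈ S, ∀ c', HasDerivAt c c' t →
      HasDerivAt (fun t => (Φ (t, c t)).2) (fderiv ℝ Φ (t, c t) (1, c')).2 t := by
    intro t ht c' hc'
    have hd := hΦ.smooth.differentiableAt_of_isOpen Φ.open_source (hc t ht)
    exact hd.hasFDerivAt.snd.comp_hasDerivAt t ((hasDerivAt_id t).prodMk hc')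
  refine forall₂_congr fun t ht => ?_
  rw [hamilton_iff, hamilton_iff]
  have hz := hc t ht
  constructor
  · rintro ⟨c', hc', h⟩
    refine ⟨_, hcurve t ht c' hc', fun ρ => ?_⟩
    obtain ⟨η, hη⟩ := hΦ.exists_fderiv_eq hz ρ
    have := (key t ht c' η).1 (h η)
    rwa [hη] at this
  · rintro ⟨C', hC', h⟩
    have hd' : DifferentiableAt ℝ Φ.symm (t, (Φ (t, c t)).2) := by
      have := hΦ.smooth_symm.differentiableAt_of_isOpen Φ.open_target (Φ.map_source hz)
      rwa [hΦ.eq_mk hz] at this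
    have h1 := hd'.hasFDerivAt.snd.comp_hasDerivAt (f := fun t => (t, (Φ (t, c t)).2)) t
      ((hasDerivAt_id t).prodMk hC')
    -- The original curve is recovered near t by applying `Φ.symm` to its image; this uses that S is
    -- open.
    have h2 : DifferentiableAt ℝ c t := by
      refine h1.differentiableAt.congr_of_eventuallyEq ?_
      refine Filter.eventuallyEq_of_mem (hS.mem_nhds ht) fun s hs => ?_
      have : (s, (Φ (s, c s)).2) = Φ (s, c s) := (hΦ.eq_mk (hc s hs)).symm
      simp only [Function.comp_apply]
      rw [this, Φ.left_inv (hc s hs)]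
    refine ⟨_, h2.hasDerivAt, fun η => (key t ht _ η).2 ?_⟩
    rw [← hC'.unique (hcurve t ht _ h2.hasDerivAt)]
    exact h _

end IsCanonicalGeneratedBy

theorem IntertwinesHamilton.trans {Φ₁ Φ₂ : OpenPartialHomeomorph
      (ℝ × (Fin n → ℝ) × (Fin n → ℝ)) (ℝ × (Fin n → ℝ) × (Fin n → ℝ))}
    {H₀ H₁ H₂ : ℝ × (Fin n → ℝ) × (Fin n → ℝ) → ℝ}
    (htime : ∀ z ∈ Φ₁.source, (Φ₁ z).1 = z.1)
    (h₁ : IntertwinesHamilton Φ₁ H₀ H₁) (h₂ : IntertwinesHamilton Φ₂ H₁ H₂) :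
    IntertwinesHamilton (Φ₁.trans Φ₂) H₀ H₂ := by
  intro S c hS hc
  have hc1 : ∀ t ∈ S, (t, c t) ∈ Φ₁.source := fun t ht => (hc t ht).1
  have heq : ∀ t ∈ S, (t, (Φ₁ (t, c t)).2) = Φ₁ (t, c t) := fun t ht =>
    Prod.ext (htime _ (hc1 t ht)).symm rfl
  rw [h₁ S c hS hc1, h₂ S _ hS fun t ht => by rw [heq t ht]; exact (hc t ht).2]
  have hcongr : ∀ t ∈ S, (Φ₂ (t, (Φ₁ (t, c t)).2)).2 = ((Φ₁.trans Φ₂) (t, c t)).2 := by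
    intro t ht
    rw [heq t ht]
    rfl
  have hev : ∀ t ∈ S, (fun t => (Φ₂ (t, (Φ₁ (t, c t)).2)).2)
      =ᶠ[nhds t] fun t => ((Φ₁.trans Φ₂) (t, c t)).2 := fun t ht =>
    Filter.eventuallyEq_of_mem (hS.mem_nhds ht) hcongr
  refine forall₂_congr fun t ht => ?_
  rw [hamilton_iff, hamilton_iff]
  refine exists_congr fun c' => and_congr ?_ ?_
  · exact (hev t ht).hasDerivAt_iff
  · rw [hcongr t ht]

/-- Hamilton's equations are unchanged when a function of time is added to the Hamiltonian. -/
theorem IntertwinesHamilton.congr_of_eq_add_time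
    {H₁ H₂ : ℝ × (Fin n → ℝ) × (Fin n → ℝ) → ℝ} {c : ℝ → ℝ}
    (h : IntertwinesHamilton Φ H H₁) (htime : ∀ z ∈ Φ.source, (Φ z).1 = z.1)
    (hd₁ : ∀ w ∈ Φ.target, DifferentiableAt ℝ H₁ w)
    (hd₂ : ∀ w ∈ Φ.target, DifferentiableAt ℝ H₂ w)
    (heq : ∀ w ∈ Φ.target, H₁ w = H₂ w + c w.1) : IntertwinesHamilton Φ H H₂ := by
  have key : ∀ w ∈ Φ.target, ∀ η, fderiv ℝ H₁ w (0, η) = fderiv ℝ H₂ w (0, η) := by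
    intro w hw η
    have h1 : fderiv ℝ (fun w => H₁ w - H₂ w) w (0, η) = 0 := by
      rw [(Filter.eventuallyEq_of_mem (Φ.open_target.mem_nhds hw) (fun w hw => by
        rw [heq w hw]; ring : ∀ w ∈ Φ.target, H₁ w - H₂ w = c w.1)).fderiv_eq]
      -- Nothing is assumed about c itself; its pullback is differentiable as a difference of
      -- differentiable functions.
      have hdc : DifferentiableAt ℝ (fun w : ℝ × (Fin n → ℝ) × (Fin n → ℝ) => c w.1) w :=
        ((hd₁ w hw).sub (hd₂ w hw)).congr_of_eventuallyEq
          (Filter.eventuallyEq_of_mem (Φ.open_target.mem_nhds hw) fun w hw => by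
            simp only [Pi.sub_apply]; rw [heq w hw]; ring)
      -- On the line through w with direction (0, η) the time is constant, so the pullback of c is
      -- constant too.
      have hl : HasDerivAt (fun s : ℝ => w + s • ((0, η) : ℝ × (Fin n → ℝ) × (Fin n → ℝ)))
          (0, η) 0 := by
        simpa using ((hasDerivAt_id (0 : ℝ)).smul_const
          ((0, η) : ℝ × (Fin n → ℝ) × (Fin n → ℝ))).const_add w
      have hw0 : w + (0 : ℝ) • ((0, η) : ℝ × (Fin n → ℝ) × (Fin n → ℝ)) = w := by simp
      have h2 : HasDerivAt (fun s : ℝ => c (w + s • ((0, η) :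
          ℝ × (Fin n → ℝ) × (Fin n → ℝ))).1)
          (fderiv ℝ (fun w : ℝ × (Fin n → ℝ) × (Fin n → ℝ) => c w.1) w (0, η)) 0 := by
        refine HasFDerivAt.comp_hasDerivAt (l := fun w : ℝ × (Fin n → ℝ) × (Fin n → ℝ) => c w.1)
          (0 : ℝ) ?_ hl
        rw [hw0]
        exact hdc.hasFDerivAt
      have h3 : (fun s : ℝ => c (w + s • ((0, η) :
          ℝ × (Fin n → ℝ) × (Fin n → ℝ))).1) = fun _ => c w.1 := by
        ext s; simp
      rw [h3] at h2
      exact h2.unique (hasDerivAt_const _ _)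
    rw [fderiv_fun_sub (hd₁ w hw) (hd₂ w hw)] at h1
    exact sub_eq_zero.1 h1
  intro S c' hS hc
  rw [h S c' hS hc]
  refine forall₂_congr fun t ht => ?_
  have hmem : (t, (Φ (t, c' t)).2) ∈ Φ.target := by
    have := Φ.map_source (hc t ht)
    rwa [show Φ (t, c' t) = (t, (Φ (t, c' t)).2) from
      Prod.ext (htime _ (hc t ht)) rfl] at this
  rw [hamilton_iff, hamilton_iff]
  simp only [key _ hmem]

end CanonicalTransformations

/-! ### The driving system: smoothness of solutions and evolution of p̃. -/

/-- Solutions of a smooth autonomous differential equation are smooth. -/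
theorem contDiffOn_of_hasDerivAt_comp {E : Type*} [NormedAddCommGroup E] [NormedSpace ℝ E]
    {I : Set ℝ} (hI : IsOpen I) {S : Set E} {f : E → E} (hf : ContDiffOn ℝ ∞ f S) {z : ℝ → E}
    (hmem : ∀ t ∈ I, z t ∈ S) (hz : ∀ t ∈ I, HasDerivAt z (f (z t)) t) : ContDiffOn ℝ ∞ z I := by
  refine contDiffOn_infty.2 fun k => ?_
  -- Bootstrapping: if z is C^k then so is z' = f(z), hence z is C^(k+1).
  induction k with
  | zero =>
    exact contDiffOn_zero.2 fun t ht => (hz t ht).continuousAt.continuousWithinAt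
  | succ k ih =>
    push_cast
    refine (contDiffOn_succ_iff_deriv_of_isOpen hI).2 ⟨fun t ht =>
      (hz t ht).differentiableAt.differentiableWithinAt, by simp, ?_⟩
    exact ((hf.of_le (by exact_mod_cast le_top)).comp ih hmem).congr fun t ht => (hz t ht).deriv

section Driving

variable {m n : ℕ} {Y : Set (Fin m → ℝ)} {X : Set (Fin n → ℝ)}
  {g J : (Fin m ⊕ Fin n → ℝ) → Matrix (Fin m ⊕ Fin n) (Fin m ⊕ Fin n) ℝ}
  {Q : (Fin m ⊕ Fin n → ℝ) → Fin m ⊕ Fin n → ℝ}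
  (hs : IsDrivenCofactorSystem Y X g Q J)
  {I : Set ℝ} {y v : ℝ → Fin m → ℝ}

include hs

theorem IsDrivenCofactorSystem.J₁₁_eq {y : Fin m → ℝ} (hy : y ∈ Y) {x x' : Fin n → ℝ} (hx : x ∈ X)
    (hx' : x' ∈ X) : (J (join y x)).toBlocks₁₁ = (J (join y x')).toBlocks₁₁ := by
  ext i j
  exact eq_of_pd_inr_eq_zero (f := fun r => J r (Sum.inl i) (Sum.inl j)) hs.isOpen_X
    hs.isConnected_X.isPreconnected
    (fun _ hx => hs.differentiableAt_J (join_mem_domain.2 ⟨hy, hx⟩) _ _)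
    (fun _ hx a => hs.pd_J_inl_inl (join_mem_domain.2 ⟨hy, hx⟩) i j a) hx hx'

/-- Because f^i is free of x, the reference point is immaterial. It can be moved to the position at
which the driven system is being examined. -/
theorem IsDrivingSolution.change_base {x₀ : Fin n → ℝ} (hx₀ : x₀ ∈ X)
    (hy : IsDrivingSolution Y x₀ g Q I y v) {x : Fin n → ℝ} (hx : x ∈ X) :
    IsDrivingSolution Y x g Q I y v where
  mem := hy.mem
  vel := hy.vel
  acc t ht := by
    simp only [fun i => hs.force_inl_eq (hy.mem t ht) hx hx₀ (join (v t) 0) i]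
    exact hy.acc t ht

theorem drivingMomentum_change_base {t : ℝ} (hyt : y t ∈ Y) {x x' : Fin n → ℝ} (hx : x ∈ X)
    (hx' : x' ∈ X) : drivingMomentum g x y v t = drivingMomentum g x' y v t := by
  ext i
  exact Finset.sum_congr rfl fun j _ => by rw [hs.metric₁_eq hyt hx hx']

theorem drivingTildeMomentum_change_base {t : ℝ} (hyt : y t ∈ Y) {x x' : Fin n → ℝ} (hx : x ∈ X)
    (hx' : x' ∈ X) :
    drivingTildeMomentum g J x y v t = drivingTildeMomentum g J x' y v t := by
  rw [drivingTildeMomentum, drivingTildeMomentum, drivingMomentum_change_base hs hyt hx hx',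
    hs.J₁₁_eq hyt hx hx']

namespace IsDrivingSolution

variable {x : Fin n → ℝ} (hy : IsDrivingSolution Y x g Q I y v) (hx : x ∈ X)

omit hs in
include hy in
theorem hasDerivAt_comp_join {f : (Fin m ⊕ Fin n → ℝ) → ℝ} {t : ℝ} (ht : t ∈ I) (x' : Fin n → ℝ)
    (hf : DifferentiableAt ℝ f (join (y t) x')) :
    HasDerivAt (fun t => f (join (y t) x'))
      (∑ j, v t j * pd f (Sum.inl j) (join (y t) x')) t := by
  have h1 : HasDerivAt (fun t => join (y t) x') (join (v t) 0) t :=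
    (joinL m n).hasFDerivAt.comp_hasDerivAt t ((hy.vel t ht).prodMk (hasDerivAt_const t x'))
  have h2 := hf.hasFDerivAt.comp_hasDerivAt t h1
  rw [fderiv_apply_eq_sum_pd, Fintype.sum_sum_type] at h2
  simpa [Function.comp_def] using h2

include hy hx

theorem contDiffOn (hI : IsOpen I) : ContDiffOn ℝ ∞ y I ∧ ContDiffOn ℝ ∞ v I := by
  have hjoin : ∀ x : Fin n → ℝ, ContDiff ℝ ∞ fun y : Fin m → ℝ => join y x := fun x =>
    contDiff_join.comp (contDiff_prodMk_left x)
  have hpair : ContDiff ℝ ∞ fun z : (Fin m → ℝ) × (Fin m → ℝ) =>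
      (join z.1 x, join z.2 (0 : Fin n → ℝ)) :=
    ((hjoin x).comp contDiff_fst).prodMk ((hjoin 0).comp contDiff_snd)
  have hforce : ∀ i, ContDiffOn ℝ ∞ (fun z : (Fin m → ℝ) × (Fin m → ℝ) =>
      force g Q (join z.1 x) (join z.2 0) (Sum.inl i)) (Y ×ˢ Set.univ) := by
    intro i
    have h1 := contDiffOn_force hs.isOpen hs.metric hs.cofactor.smooth_form (Sum.inl i)
    have h2 : Set.MapsTo (fun z : (Fin m → ℝ) × (Fin m → ℝ) =>
        (join z.1 x, join z.2 (0 : Fin n → ℝ))) (Y ×ˢ Set.univ) (domain Y X ×ˢ Set.univ) := by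
      intro z hz
      exact Set.mk_mem_prod (join_mem_domain.2 ⟨hz.1, hx⟩) (Set.mem_univ _)
    have h3 := h1.comp hpair.contDiffOn h2
    simp only [Function.comp_def] at h3
    exact h3
  have hfield : ContDiffOn ℝ ∞ (fun z : (Fin m → ℝ) × (Fin m → ℝ) =>
      (z.2, fun i => force g Q (join z.1 x) (join z.2 0) (Sum.inl i))) (Y ×ˢ Set.univ) :=
    contDiff_snd.contDiffOn.prodMk (contDiffOn_pi.2 hforce)
  have h : ContDiffOn ℝ ∞ (fun t => (y t, v t)) I :=
    contDiffOn_of_hasDerivAt_comp hI hfield (fun t ht => ⟨hy.mem t ht, Set.mem_univ _⟩)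
      (fun t ht => (hy.vel t ht).prodMk (hy.acc t ht))
  exact ⟨contDiff_fst.comp_contDiffOn h, contDiff_snd.comp_contDiffOn h⟩

theorem contDiffOn_comp_join (hI : IsOpen I) {f : (Fin m ⊕ Fin n → ℝ) → ℝ}
    (hf : ContDiffOn ℝ ∞ f (domain Y X)) : ContDiffOn ℝ ∞ (fun t => f (join (y t) x)) I :=
  hf.comp (contDiff_join.comp_contDiffOn ((hy.contDiffOn hs hx hI).1.prodMk contDiffOn_const))
    fun t ht => join_mem_domain.2 ⟨hy.mem t ht, hx⟩

theorem contDiffOn_drivingMomentum (hI : IsOpen I) (i : Fin m) :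
    ContDiffOn ℝ ∞ (fun t => drivingMomentum g x y v t i) I :=
  ContDiffOn.sum fun j _ => (hy.contDiffOn_comp_join hs hx hI (hs.metric.smooth _ _)).mul
    (contDiffOn_pi.1 (hy.contDiffOn hs hx hI).2 j)

theorem contDiffOn_drivingTildeMomentum (hJ₁ : ∀ q ∈ domain Y X, (J q).toBlocks₁₁.det ≠ 0)
    (hI : IsOpen I) (i : Fin m) :
    ContDiffOn ℝ ∞ (fun t => drivingTildeMomentum g J x y v t i) I := by
  change ContDiffOn ℝ ∞ (fun t => ∑ j, drivingMomentum g x y v t j *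
    (J (join (y t) x)).toBlocks₁₁⁻¹ j i) I
  exact ContDiffOn.sum fun j _ => (hy.contDiffOn_drivingMomentum hs hx hI j).mul
    (hy.contDiffOn_comp_join hs hx hI
      (contDiffOn_inv_apply (M := fun q => (J q).toBlocks₁₁) (fun _ _ => hs.scKt.smooth _ _) hJ₁ j i))

omit hs hx in
theorem hasDerivAt_matrix {κ l : Type*} [Fintype κ] [Fintype l]
    {M : (Fin m ⊕ Fin n → ℝ) → Matrix κ l ℝ} {t : ℝ} (ht : t ∈ I)
    (hM : ∀ i j, DifferentiableAt ℝ (fun r => M r i j) (join (y t) x)) (i : κ) (j : l) :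
    HasDerivAt (fun t => M (join (y t) x) i j)
      ((∑ k, v t k • pdMatrix M (Sum.inl k) (join (y t) x)) i j) t := by
  have h := hy.hasDerivAt_comp_join ht x (hM i j)
  rwa [show ∑ k, v t k * pd (fun r => M r i j) (Sum.inl k) (join (y t) x)
    = (∑ k, v t k • pdMatrix M (Sum.inl k) (join (y t) x)) i j by
      simp [Matrix.sum_apply, pdMatrix_apply]] at h

theorem force_inl {t : ℝ} (ht : t ∈ I) :
    (fun i => force g Q (join (y t) x) (join (v t) 0) (Sum.inl i))
      = -(connectionAlong g (join (y t) x) (v t) *ᵥ v t)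
        + (g (join (y t) x)).toBlocks₁₁⁻¹ *ᵥ fun i => Q (join (y t) x) (Sum.inl i) := by
  have hq : join (y t) x ∈ domain Y X := join_mem_domain.2 ⟨hy.mem t ht, hx⟩
  ext i
  rw [force, hs.inv_metric_eq hq]
  simp only [Fintype.sum_sum_type, join_inl, join_inr, Pi.zero_apply, mul_zero,
    Finset.sum_const_zero, add_zero, fromBlocks_apply₁₁, fromBlocks_apply₁₂, Matrix.zero_apply,
    zero_mul, Pi.add_apply, Pi.neg_apply]
  congr 2
  simp only [mulVec, dotProduct, connectionAlong, Matrix.sum_apply, Matrix.smul_apply, smul_eq_mul,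
    Finset.sum_mul]
  refine Finset.sum_congr rfl fun j _ => Finset.sum_congr rfl fun k _ => ?_
  change _ = v t k * christoffel g (join (y t) x) (Sum.inl i) (Sum.inl j) (Sum.inl k) * v t j
  ring

/-- Differentiate p̃J₁ = g₁v along the solution in two ways. Metric compatibility and the equation
of motion reduce the right side to (p̃J₁)Γ + Q₁, Γ being the connection along v; the Killing
equation gives the derivative of J₁ on the left. The terms (p̃J₁)Γ cancel, and J₁ is inverted. -/
theorem hasDerivAt_drivingTildeMomentum (hJ₁ : ∀ q ∈ domain Y X, (J q).toBlocks₁₁.det ≠ 0)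
    (hI : IsOpen I) {t : ℝ} (ht : t ∈ I) :
    HasDerivAt (drivingTildeMomentum g J x y v)
      (tildeMomentumRate g J Q (join (y t) x) (v t) (drivingTildeMomentum g J x y v t)) t := by
  set q := join (y t) x with hqdef
  have hq : q ∈ domain Y X := join_mem_domain.2 ⟨hy.mem t ht, hx⟩
  have hJu : IsUnit (J q).toBlocks₁₁.det := (hJ₁ q hq).isUnit
  set pt := drivingTildeMomentum g J x y v with hpt
  -- Differentiability is known from smoothness, so the derivative only has to be identified.
  have hdiff : DifferentiableAt ℝ pt t := differentiableAt_pi.2 fun i =>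
    (hy.contDiffOn_drivingTildeMomentum hs hx hJ₁ hI i).differentiableAt_of_isOpen hI ht
  set p' := deriv pt t with hp'
  have hd : HasDerivAt pt p' t := hdiff.hasDerivAt
  set Γ := connectionAlong g q (v t) with hΓ
  set J₁ := (J q).toBlocks₁₁ with hJ₁def
  set G := (g q).toBlocks₁₁ with hG
  set θ := traceForm₁ J q with hθ
  set Q₁ : Fin m → ℝ := fun i => Q q (Sum.inl i) with hQ₁
  have hGt : Gᵀ = G := hs.metric₁_transpose hq
  have hrel : ∀ s ∈ I, pt s ᵥ* (J (join (y s) x)).toBlocks₁₁ = drivingMomentum g x y v s := by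
    intro s hs'
    rw [hpt, drivingTildeMomentum, vecMul_vecMul, nonsing_inv_mul _
      (hJ₁ _ (join_mem_domain.2 ⟨hy.mem s hs', hx⟩)).isUnit, vecMul_one]
  have hGv : drivingMomentum g x y v t = G *ᵥ v t := rfl
  have hG' : ∑ k, v t k • pdMatrix (fun r => (g r).toBlocks₁₁) (Sum.inl k) q
      = G * Γ + Γᵀ * G := by
    simp only [hs.pdMatrix_metric₁ hq, smul_add, Finset.sum_add_distrib, hΓ, connectionAlong,
      Matrix.transpose_sum, Matrix.mul_sum, Matrix.sum_mul, Matrix.mul_smul, Matrix.smul_mul,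
      Matrix.transpose_smul]
    rfl
  have hv1 : ∑ k, v t k • vecMulVec (G⁻¹ *ᵥ θ) (fun i => g q (Sum.inl i) (Sum.inl k))
      = vecMulVec (G⁻¹ *ᵥ θ) (G *ᵥ v t) := by
    ext i j
    simp only [Matrix.sum_apply, Matrix.smul_apply, vecMulVec_apply, smul_eq_mul]
    rw [show (G *ᵥ v t) j = ∑ k, g q (Sum.inl j) (Sum.inl k) * v t k from rfl, Finset.mul_sum]
    exact Finset.sum_congr rfl fun k _ => by ring
  have hv2 : ∑ k, v t k • vecMulVec (Pi.single k 1) θ = vecMulVec (v t) θ := by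
    ext i j
    simp [Matrix.sum_apply, vecMulVec_apply, Pi.single_apply]
  have hJ' : ∑ k, v t k • pdMatrix (fun r => (J r).toBlocks₁₁) (Sum.inl k) q
      = J₁ * Γ - Γ * J₁
        + (1 / 2 : ℝ) • (vecMulVec (G⁻¹ *ᵥ θ) (G *ᵥ v t) + vecMulVec (v t) θ) := by
    rw [← hv1, ← hv2]
    simp only [hs.pdMatrix_J₁₁_inl hq, smul_add, smul_sub, Finset.sum_add_distrib,
      Finset.sum_sub_distrib, hΓ, connectionAlong, Matrix.mul_sum, Matrix.sum_mul, Matrix.mul_smul,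
      Matrix.smul_mul, Finset.smul_sum, smul_comm (1 / 2 : ℝ) (v t _)]
    rfl
  have e1 : HasDerivAt (drivingMomentum g x y v)
      ((G * Γ + Γᵀ * G) *ᵥ v t + G *ᵥ (-(Γ *ᵥ v t) + G⁻¹ *ᵥ Q₁)) t := by
    refine hasDerivAt_pi.2 fun i => ?_
    have h := HasDerivAt.fun_sum (u := Finset.univ) fun j _ =>
      (hy.hasDerivAt_matrix (M := fun r => (g r).toBlocks₁₁) ht
        (fun _ _ => hs.metric.differentiableAt hs.isOpen hq _ _) i j).mul
        (hasDerivAt_pi.1 (hy.acc t ht) j)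
    rw [← hqdef, hG', Finset.sum_add_distrib] at h
    have hf := hy.force_inl hs hx ht
    rw [← hqdef, ← hΓ, ← hG, ← hQ₁] at hf
    rw [← hf]
    exact h
  have e2 : HasDerivAt (fun s => pt s ᵥ* (J (join (y s) x)).toBlocks₁₁)
      (p' ᵥ* J₁ + pt t ᵥ* (J₁ * Γ - Γ * J₁
        + (1 / 2 : ℝ) • (vecMulVec (G⁻¹ *ᵥ θ) (G *ᵥ v t) + vecMulVec (v t) θ))) t := by
    refine hasDerivAt_pi.2 fun i => ?_
    have h := HasDerivAt.fun_sum (u := Finset.univ) fun j _ =>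
      (hasDerivAt_pi.1 hd j).mul (hy.hasDerivAt_matrix (M := fun r => (J r).toBlocks₁₁) ht
        (fun _ _ => hs.differentiableAt_J hq _ _) j i)
    rw [← hqdef, hJ', Finset.sum_add_distrib] at h
    exact h
  have e3 := e2.unique (e1.congr_of_eventuallyEq
    (Filter.eventuallyEq_of_mem (hI.mem_nhds ht) hrel))
  have hptJ : pt t ᵥ* J₁ = G *ᵥ v t := hrel t ht
  have e4 : p' ᵥ* J₁ = (pt t ᵥ* Γ) ᵥ* J₁ + Q₁ - ((1 / 2) * (pt t ⬝ᵥ G⁻¹ *ᵥ θ)) • (pt t ᵥ* J₁)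
      - ((1 / 2) * (pt t ⬝ᵥ v t)) • θ := by
    have h1 : (G * Γ + Γᵀ * G) *ᵥ v t + G *ᵥ (-(Γ *ᵥ v t) + G⁻¹ *ᵥ Q₁)
        = (pt t ᵥ* J₁) ᵥ* Γ + Q₁ := by
      rw [add_mulVec, mulVec_add, mulVec_neg, mulVec_mulVec, mulVec_mulVec,
        mul_nonsing_inv _ (hs.isUnit_det_metric₁ hq), one_mulVec, hptJ, ← mulVec_mulVec _ Γᵀ,
        mulVec_transpose]
      abel
    rw [h1] at e3
    have h2 : pt t ᵥ* (J₁ * Γ - Γ * J₁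
        + (1 / 2 : ℝ) • (vecMulVec (G⁻¹ *ᵥ θ) (G *ᵥ v t) + vecMulVec (v t) θ))
        = (pt t ᵥ* J₁) ᵥ* Γ - (pt t ᵥ* Γ) ᵥ* J₁
          + ((1 / 2) * (pt t ⬝ᵥ G⁻¹ *ᵥ θ)) • (pt t ᵥ* J₁) + ((1 / 2) * (pt t ⬝ᵥ v t)) • θ := by
      rw [vecMul_add, vecMul_sub, vecMul_smul, vecMul_add, vecMul_vecMulVec, vecMul_vecMulVec,
        vecMul_vecMul, vecMul_vecMul, hptJ, smul_add, smul_smul, smul_smul, add_assoc]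
    rw [h2] at e3
    rw [eq_sub_of_add_eq e3]
    abel
  have e5 : p' = tildeMomentumRate g J Q q (v t) (pt t) := by
    have h := congrArg (fun z => z ᵥ* J₁⁻¹) e4
    simp only [sub_vecMul, add_vecMul, smul_vecMul, vecMul_vecMul, mul_nonsing_inv _ hJu,
      vecMul_one] at h
    rw [h, tildeMomentumRate]
    simp only [Matrix.mul_assoc, mul_nonsing_inv _ hJu, Matrix.mul_one]
    rfl
  rw [← e5]
  exact hd

end IsDrivingSolution

end Driving

/-! ### The inverse function theorem for injective maps. -/

section InverseFunction

variable {E : Type*} [NormedAddCommGroup E] [NormedSpace ℝ E] [FiniteDimensional ℝ E]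

theorem exists_hasFDerivAt_equiv {f : E → E} {x : E} (hf : DifferentiableAt ℝ f x)
    (hinj : Function.Injective (fderiv ℝ f x)) :
    ∃ L : E ≃L[ℝ] E, HasFDerivAt f (L : E →L[ℝ] E) x := by
  refine ⟨(LinearEquiv.ofInjectiveEndo (fderiv ℝ f x : E →ₗ[ℝ] E) hinj).toContinuousLinearEquiv, ?_⟩
  convert hf.hasFDerivAt using 1
  ext v
  rfl

/-- A smooth injective map with invertible derivatives is a diffeomorphism onto an open set. -/
theorem exists_openPartialHomeomorph_of_injOn {f : E → E} {N : Set E} (hN : IsOpen N)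
    (hf : ContDiffOn ℝ ∞ f N) (hd : ∀ x ∈ N, Function.Injective (fderiv ℝ f x))
    (hinj : Set.InjOn f N) :
    ∃ e : OpenPartialHomeomorph E E, e.source = N ∧ (∀ x, e x = f x) ∧ e.target = f '' N ∧
      ContDiffOn ℝ ∞ e.symm e.target := by
  have : CompleteSpace E := FiniteDimensional.complete ℝ E
  -- The inverse function theorem makes f open on open subsets of N, which gives continuity of the
  -- global inverse.
  have hopen : ∀ V, IsOpen V → V ⊆ N → IsOpen (f '' V) := by
    intro V hV hVN
    rw [isOpen_iff_mem_nhds]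
    rintro _ ⟨x, hx, rfl⟩
    have hc : ContDiffAt ℝ ∞ f x := hf.contDiffAt (hN.mem_nhds (hVN hx))
    obtain ⟨L, hL⟩ := exists_hasFDerivAt_equiv (hc.differentiableAt (by simp)) (hd x (hVN hx))
    have hs : HasStrictFDerivAt f (L : E →L[ℝ] E) x := hc.hasStrictFDerivAt' hL (by simp)
    rw [← hs.map_nhds_eq_of_equiv]
    exact Filter.image_mem_map (hV.mem_nhds hx)
  have hmap : IsOpenMap (N.domRestrict f) := by
    intro V hV
    obtain ⟨V', hV', rfl⟩ := isOpen_induced_iff.1 hV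
    have : N.domRestrict f '' (Subtype.val ⁻¹' V') = f '' (N ∩ V') := by
      ext z
      constructor
      · rintro ⟨⟨x, hx⟩, hxV, rfl⟩
        exact ⟨x, ⟨hx, hxV⟩, rfl⟩
      · rintro ⟨x, ⟨hx, hxV⟩, rfl⟩
        exact ⟨⟨x, hx⟩, hxV, rfl⟩
    rw [this]
    exact hopen _ (hN.inter hV') Set.inter_subset_left
  let e := OpenPartialHomeomorph.ofContinuousOpenRestrict (hinj.toPartialEquiv f N)
    hf.continuousOn hmap hN
  refine ⟨e, rfl, fun _ => rfl, rfl, fun w hw => ?_⟩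
  have hx : e.symm w ∈ N := e.map_target hw
  have hc : ContDiffAt ℝ ∞ f (e.symm w) := hf.contDiffAt (hN.mem_nhds hx)
  obtain ⟨L, hL⟩ := exists_hasFDerivAt_equiv (hc.differentiableAt (by simp)) (hd _ hx)
  exact (e.contDiffAt_symm hw hL hc).contDiffWithinAt

theorem exists_isOpen_injOn {f : E → E} {x : E} {N : Set E} (hN : IsOpen N) (hx : x ∈ N)
    (hf : ContDiffOn ℝ ∞ f N) (hd : Function.Injective (fderiv ℝ f x)) :
    ∃ V, IsOpen V ∧ x ∈ V ∧ V ⊆ N ∧ Set.InjOn f V := by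
  have : CompleteSpace E := FiniteDimensional.complete ℝ E
  have hc : ContDiffAt ℝ ∞ f x := hf.contDiffAt (hN.mem_nhds hx)
  obtain ⟨L, hL⟩ := exists_hasFDerivAt_equiv (hc.differentiableAt (by simp)) hd
  refine ⟨(hc.toOpenPartialHomeomorph f hL (by simp)).source ∩ N,
    (OpenPartialHomeomorph.open_source _).inter hN,
    ⟨hc.mem_toOpenPartialHomeomorph_source hL (by simp), hx⟩, Set.inter_subset_right, ?_⟩
  exact ((hc.toOpenPartialHomeomorph f hL (by simp)).injOn).mono Set.inter_subset_left

end InverseFunction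

/-! ### Point transformations lifted to phase space, with a momentum shift. -/

section LiftedTransformations

variable {n : ℕ}

/-- The map `(t, x) ↦ (t, u(t, x))`. -/
def baseMap (u : Fin n → ℝ × (Fin n → ℝ) → ℝ) (w : ℝ × (Fin n → ℝ)) : ℝ × (Fin n → ℝ) :=
  (w.1, fun a => u a w)

/-- The Jacobian matrix `∂u^a/∂x^b`. -/
def baseJacobian (u : Fin n → ℝ × (Fin n → ℝ) → ℝ) (w : ℝ × (Fin n → ℝ)) :
    Matrix (Fin n) (Fin n) ℝ :=
  Matrix.of fun a b => fderiv ℝ (u a) w (0, Pi.single b 1)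

/-- The generating function `P_a u^a(t, x) + S(t, x)`. -/
def affineGen (u : Fin n → ℝ × (Fin n → ℝ) → ℝ) (S : ℝ × (Fin n → ℝ) → ℝ)
    (z : ℝ × (Fin n → ℝ) × (Fin n → ℝ)) : ℝ :=
  ∑ a, z.2.2 a * u a (z.1, z.2.1) + S (z.1, z.2.1)

variable {u : Fin n → ℝ × (Fin n → ℝ) → ℝ} {S : ℝ × (Fin n → ℝ) → ℝ} {N : Set (ℝ × (Fin n → ℝ))}

/-- The derivative is block triangular, with 1 in the time direction and the Jacobian in the
position directions. -/
theorem injective_fderiv_baseMap {w : ℝ × (Fin n → ℝ)} (hu : ∀ a, DifferentiableAt ℝ (u a) w)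
    (hdet : (baseJacobian u w).det ≠ 0) : Function.Injective (fderiv ℝ (baseMap u) w) := by
  have h : HasFDerivAt (baseMap u) ((ContinuousLinearMap.fst ℝ _ _).prod
      (ContinuousLinearMap.pi fun a => fderiv ℝ (u a) w)) w :=
    hasFDerivAt_fst.prodMk (hasFDerivAt_pi.2 fun a => (hu a).hasFDerivAt)
  rw [h.fderiv, injective_iff_map_eq_zero]
  rintro ⟨τ, ξ⟩ h0
  have hτ : τ = 0 := congrArg Prod.fst h0
  subst hτ
  have h1 : baseJacobian u w *ᵥ ξ = 0 := by
    ext a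
    have h2 : fderiv ℝ (u a) w (0, ξ) = 0 := congrFun (congrArg Prod.snd h0) a
    have h3 : ((0, ξ) : ℝ × (Fin n → ℝ)) = ∑ b, ξ b • ((0, Pi.single b 1) : ℝ × (Fin n → ℝ)) := by
      refine Prod.ext (by simp [Prod.fst_sum]) ?_
      simp only [Prod.snd_sum, Prod.smul_snd]
      exact pi_eq_sum_univ' ξ
    rw [h3, map_sum] at h2
    simp only [map_smul, smul_eq_mul] at h2
    rw [Pi.zero_apply, ← h2, mulVec, dotProduct]
    exact Finset.sum_congr rfl fun b _ => mul_comm _ _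
  have h4 := congrArg (fun z => (baseJacobian u w)⁻¹ *ᵥ z) h1
  simp only [mulVec_mulVec, nonsing_inv_mul _ hdet.isUnit, one_mulVec, mulVec_zero] at h4
  rw [h4]
  rfl

theorem contDiffOn_baseMap (hu : ∀ a, ContDiffOn ℝ ∞ (u a) N) : ContDiffOn ℝ ∞ (baseMap u) N :=
  contDiff_fst.contDiffOn.prodMk (contDiffOn_pi.2 hu)

theorem contDiffOn_baseJacobian (hN : IsOpen N) (hu : ∀ a, ContDiffOn ℝ ∞ (u a) N)
    (a b : Fin n) : ContDiffOn ℝ ∞ (fun w => baseJacobian u w a b) N :=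
  ((hu a).fderiv_of_isOpen hN (m := ∞) (by simp)).clm_apply contDiffOn_const

theorem contDiffOn_affineGen (hu : ∀ a, ContDiffOn ℝ ∞ (u a) N) (hS : ContDiffOn ℝ ∞ S N) :
    ContDiffOn ℝ ∞ (affineGen u S) {z | (z.1, z.2.1) ∈ N} := by
  have hπ : ContDiff ℝ ∞ fun z : ℝ × (Fin n → ℝ) × (Fin n → ℝ) => (z.1, z.2.1) :=
    contDiff_fst.prodMk (contDiff_fst.comp contDiff_snd)
  have hP : ∀ a, ContDiff ℝ ∞ fun z : ℝ × (Fin n → ℝ) × (Fin n → ℝ) => z.2.2 a := fun a =>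
    (contDiff_apply ℝ ℝ a).comp (contDiff_snd.comp contDiff_snd)
  exact (ContDiffOn.sum fun a _ => (hP a).contDiffOn.mul
    ((hu a).comp hπ.contDiffOn fun z hz => hz)).add (hS.comp hπ.contDiffOn fun z hz => hz)

theorem hasFDerivAt_affineGen {z : ℝ × (Fin n → ℝ) × (Fin n → ℝ)}
    (hu : ∀ a, DifferentiableAt ℝ (u a) (z.1, z.2.1)) (hS : DifferentiableAt ℝ S (z.1, z.2.1)) :
    DifferentiableAt ℝ (affineGen u S) z ∧ ∀ ζ, fderiv ℝ (affineGen u S) z ζ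
      = ∑ a, (z.2.2 a * fderiv ℝ (u a) (z.1, z.2.1) (ζ.1, ζ.2.1)
          + ζ.2.2 a * u a (z.1, z.2.1)) + fderiv ℝ S (z.1, z.2.1) (ζ.1, ζ.2.1) := by
  have hπ : HasFDerivAt (fun z : ℝ × (Fin n → ℝ) × (Fin n → ℝ) => (z.1, z.2.1))
      ((ContinuousLinearMap.fst ℝ _ _).prod ((ContinuousLinearMap.fst ℝ _ _).comp
        (ContinuousLinearMap.snd ℝ _ _))) z := hasFDerivAt_fst.prodMk hasFDerivAt_snd.fst
  have hP : ∀ a, HasFDerivAt (fun z : ℝ × (Fin n → ℝ) × (Fin n → ℝ) => z.2.2 a)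
      ((ContinuousLinearMap.proj (R := ℝ) (φ := fun _ => ℝ) a).comp
        ((ContinuousLinearMap.snd ℝ _ _).comp (ContinuousLinearMap.snd ℝ _ _))) z := fun a =>
    (ContinuousLinearMap.proj (R := ℝ) (φ := fun _ => ℝ) a).hasFDerivAt.comp z
      (hasFDerivAt_snd (p := z)).snd
  have h := (HasFDerivAt.fun_sum (u := Finset.univ) fun a _ =>
    (hP a).mul ((hu a).hasFDerivAt.comp z hπ)).add (hS.hasFDerivAt.comp z hπ)
  refine ⟨h.differentiableAt, fun ζ => ?_⟩
  have h2 : fderiv ℝ (affineGen u S) z = _ := h.fderiv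
  rw [h2]
  simp [_root_.sum_apply, mul_comm]

/-- A time-dependent point transformation, combined with a shift of the momenta by a gradient, is
a canonical transformation. -/
theorem exists_canonical_affineGen (hN : IsOpen N) (hu : ∀ a, ContDiffOn ℝ ∞ (u a) N)
    (hS : ContDiffOn ℝ ∞ S N) (hdet : ∀ w ∈ N, (baseJacobian u w).det ≠ 0)
    (hinj : Set.InjOn (baseMap u) N) :
    ∃ Φ : OpenPartialHomeomorph (ℝ × (Fin n → ℝ) × (Fin n → ℝ))
        (ℝ × (Fin n → ℝ) × (Fin n → ℝ)),
      Φ.source = {z | (z.1, z.2.1) ∈ N} ∧ Φ.target = {z | (z.1, z.2.1) ∈ baseMap u '' N} ∧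
      IsCanonicalGeneratedBy Φ (affineGen u S) := by
  obtain ⟨e, hes, hef, het, hesymm⟩ := exists_openPartialHomeomorph_of_injOn hN
    (contDiffOn_baseMap hu)
    (fun w hw => injective_fderiv_baseMap
      (fun a => (hu a).differentiableAt_of_isOpen hN hw) (hdet w hw)) hinj
  set D := baseJacobian u with hD
  set dS : ℝ × (Fin n → ℝ) → Fin n → ℝ := fun w b => fderiv ℝ S w (0, Pi.single b 1) with hdS
  have hDs := contDiffOn_baseJacobian hN hu
  have hdSs : ∀ b, ContDiffOn ℝ ∞ (fun w => dS w b) N := fun b =>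
    (hS.fderiv_of_isOpen hN (m := ∞) (by simp)).clm_apply contDiffOn_const
  have he1 : ∀ w ∈ N, (e w).1 = w.1 := fun w _ => by rw [hef]; rfl
  have he2 : ∀ w ∈ e.target, (e.symm w).1 = w.1 := fun w hw => by
    have := he1 _ (hes ▸ e.map_target hw)
    rw [e.right_inv hw] at this
    exact this.symm
  have hπ : ContDiff ℝ ∞ fun z : ℝ × (Fin n → ℝ) × (Fin n → ℝ) => (z.1, z.2.1) :=
    contDiff_fst.prodMk (contDiff_fst.comp contDiff_snd)
  have hP : ∀ a, ContDiff ℝ ∞ fun z : ℝ × (Fin n → ℝ) × (Fin n → ℝ) => z.2.2 a := fun a =>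
    (contDiff_apply ℝ ℝ a).comp (contDiff_snd.comp contDiff_snd)
  set A : Set (ℝ × (Fin n → ℝ) × (Fin n → ℝ)) := {z | (z.1, z.2.1) ∈ N} with hA
  set B : Set (ℝ × (Fin n → ℝ) × (Fin n → ℝ)) := {z | (z.1, z.2.1) ∈ e.target} with hB
  have hAo : IsOpen A := hN.preimage hπ.continuous
  have hBo : IsOpen B := e.open_target.preimage hπ.continuous
  -- The generating relation is p = P·D + dS, where D is the Jacobian and dS the position gradient
  -- of S. Solving it for P gives the momentum component.
  set fwd : ℝ × (Fin n → ℝ) × (Fin n → ℝ) → ℝ × (Fin n → ℝ) × (Fin n → ℝ) := fun z =>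
    (z.1, (e (z.1, z.2.1)).2, (z.2.2 - dS (z.1, z.2.1)) ᵥ* (D (z.1, z.2.1))⁻¹) with hfwd
  set bwd : ℝ × (Fin n → ℝ) × (Fin n → ℝ) → ℝ × (Fin n → ℝ) × (Fin n → ℝ) := fun z =>
    (z.1, (e.symm (z.1, z.2.1)).2,
      z.2.2 ᵥ* D (e.symm (z.1, z.2.1)) + dS (e.symm (z.1, z.2.1))) with hbwd
  have hfA : ∀ z ∈ A, ((fwd z).1, (fwd z).2.1) = e (z.1, z.2.1) := fun z hz =>
    Prod.ext (he1 _ hz).symm rfl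
  have hbB : ∀ z ∈ B, ((bwd z).1, (bwd z).2.1) = e.symm (z.1, z.2.1) := fun z hz =>
    Prod.ext (he2 _ hz).symm rfl
  have hfs : ContDiffOn ℝ ∞ fwd A := by
    refine contDiff_fst.contDiffOn.prodMk (ContDiffOn.prodMk ?_ (contDiffOn_pi.2 fun a => ?_))
    · have h1 : ContDiffOn ℝ ∞ (fun z => e z) N :=
        (contDiffOn_baseMap hu).congr fun w _ => hef w
      exact contDiff_snd.comp_contDiffOn (h1.comp hπ.contDiffOn fun z hz => hz)
    · change ContDiffOn ℝ ∞ (fun z : ℝ × (Fin n → ℝ) × (Fin n → ℝ) =>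
        ∑ b, (z.2.2 b - dS (z.1, z.2.1) b) * (D (z.1, z.2.1))⁻¹ b a) A
      refine ContDiffOn.sum fun b _ => ContDiffOn.mul ?_ ?_
      · exact (hP b).contDiffOn.sub ((hdSs b).comp hπ.contDiffOn fun z hz => hz)
      · exact (contDiffOn_inv_apply hDs hdet b a).comp hπ.contDiffOn fun z hz => hz
  have hbs : ContDiffOn ℝ ∞ bwd B := by
    have h1 : ContDiffOn ℝ ∞ (fun z : ℝ × (Fin n → ℝ) × (Fin n → ℝ) => e.symm (z.1, z.2.1)) B :=
      hesymm.comp hπ.contDiffOn fun z hz => hz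
    have h2 : Set.MapsTo (fun z : ℝ × (Fin n → ℝ) × (Fin n → ℝ) => e.symm (z.1, z.2.1)) B N :=
      fun z hz => hes ▸ e.map_target hz
    refine contDiff_fst.contDiffOn.prodMk (ContDiffOn.prodMk (contDiff_snd.comp_contDiffOn h1)
      (contDiffOn_pi.2 fun a => ?_))
    change ContDiffOn ℝ ∞ (fun z : ℝ × (Fin n → ℝ) × (Fin n → ℝ) =>
      ∑ b, z.2.2 b * D (e.symm (z.1, z.2.1)) b a + dS (e.symm (z.1, z.2.1)) a) B
    refine ContDiffOn.add (ContDiffOn.sum fun b _ => ?_) ?_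
    · exact (hP b).contDiffOn.mul ((hDs b a).comp h1 h2)
    · exact (hdSs a).comp h1 h2
  have hleft : ∀ z ∈ A, bwd (fwd z) = z := by
    intro z hz
    have h1 : e.symm ((fwd z).1, (fwd z).2.1) = (z.1, z.2.1) := by
      rw [hfA z hz, e.left_inv (hes ▸ hz)]
    simp only [hbwd]
    rw [h1]
    refine Prod.ext rfl (Prod.ext rfl ?_)
    change ((z.2.2 - dS (z.1, z.2.1)) ᵥ* (D (z.1, z.2.1))⁻¹) ᵥ* D (z.1, z.2.1)
      + dS (z.1, z.2.1) = z.2.2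
    rw [vecMul_vecMul, nonsing_inv_mul _ (hdet _ hz).isUnit, vecMul_one, sub_add_cancel]
  have hright : ∀ z ∈ B, fwd (bwd z) = z := by
    intro z hz
    have hmem : e.symm (z.1, z.2.1) ∈ N := hes ▸ e.map_target hz
    simp only [hfwd]
    rw [hbB z hz, e.right_inv hz]
    refine Prod.ext rfl (Prod.ext rfl ?_)
    change (z.2.2 ᵥ* D (e.symm (z.1, z.2.1)) + dS (e.symm (z.1, z.2.1))
      - dS (e.symm (z.1, z.2.1))) ᵥ* (D (e.symm (z.1, z.2.1)))⁻¹ = z.2.2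
    rw [add_sub_cancel_right, vecMul_vecMul, mul_nonsing_inv _ (hdet _ hmem).isUnit, vecMul_one]
  let Φ : OpenPartialHomeomorph (ℝ × (Fin n → ℝ) × (Fin n → ℝ))
      (ℝ × (Fin n → ℝ) × (Fin n → ℝ)) :=
    { toFun := fwd
      invFun := bwd
      source := A
      target := B
      map_source' := fun z hz => by
        change ((fwd z).1, (fwd z).2.1) ∈ e.target
        rw [hfA z hz]
        exact e.map_source (hes ▸ hz)
      map_target' := fun z hz => by
        change ((bwd z).1, (bwd z).2.1) ∈ N
        rw [hbB z hz]
        exact hes ▸ e.map_target hz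
      left_inv' := hleft
      right_inv' := hright
      open_source := hAo
      open_target := hBo
      continuousOn_toFun := hfs.continuousOn
      continuousOn_invFun := hbs.continuousOn }
  have hF : ContDiffOn ℝ ∞ (affineGen u S) A := contDiffOn_affineGen hu hS
  refine ⟨Φ, rfl, ?_, ?_⟩
  · change B = _
    rw [hB, het]
  · refine IsCanonicalGeneratedBy.of_generating (O := A) hfs hbs (fun z _ => rfl) hAo hF
      (fun z hz => hz) (fun z hz a => ?_) fun z hz a => ?_
    · have hz' : (z.1, z.2.1) ∈ N := hz
      rw [(hasFDerivAt_affineGen (z := mixedPoint Φ z)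
        (fun a => (hu a).differentiableAt_of_isOpen hN hz')
        (hS.differentiableAt_of_isOpen hN hz')).2]
      have h1 : ((fwd z).2.2 ᵥ* D (z.1, z.2.1)) a + dS (z.1, z.2.1) a = z.2.2 a := by
        change (((z.2.2 - dS (z.1, z.2.1)) ᵥ* (D (z.1, z.2.1))⁻¹) ᵥ* D (z.1, z.2.1)) a
          + dS (z.1, z.2.1) a = z.2.2 a
        rw [vecMul_vecMul, nonsing_inv_mul _ (hdet _ hz').isUnit, vecMul_one]
        simp
      rw [← h1]
      simp only [Pi.zero_apply, zero_mul, add_zero]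
      rfl
    · have hz' : (z.1, z.2.1) ∈ N := hz
      rw [(hasFDerivAt_affineGen (z := mixedPoint Φ z)
        (fun a => (hu a).differentiableAt_of_isOpen hN hz')
        (hS.differentiableAt_of_isOpen hN hz')).2]
      have h0 : ((0, 0) : ℝ × (Fin n → ℝ)) = 0 := rfl
      simp only [h0, map_zero, mul_zero, zero_add, add_zero, Pi.single_apply, ite_mul, one_mul,
        zero_mul, Finset.sum_ite_eq', Finset.mem_univ, if_true]
      change (e (z.1, z.2.1)).2 a = _
      rw [hef]
      rfl

end LiftedTransformations

/-! ### Smooth dependence of the cofactor coefficients on J. -/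

section CofactorSmoothness

open Polynomial

theorem contDiffOn_coeff_prod {E κ : Type*} [NormedAddCommGroup E] [NormedSpace ℝ E] {U : Set E}
    {k : ℕ∞ω} (s : Finset κ) {P : κ → E → ℝ[X]}
    (hP : ∀ i l, ContDiffOn ℝ k (fun r => (P i r).coeff l) U) (l : ℕ) :
    ContDiffOn ℝ k (fun r => (∏ i ∈ s, P i r).coeff l) U := by
  classical
  induction s using Finset.induction_on generalizing l with
  | empty => simpa using contDiffOn_const
  | insert i s hi ih =>
    simp only [Finset.prod_insert hi, coeff_mul]
    exact ContDiffOn.sum fun x _ => (hP i _).mul (ih _)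

theorem contDiffOn_coeff_det {E κ : Type*} [NormedAddCommGroup E] [NormedSpace ℝ E] [Fintype κ]
    [DecidableEq κ] {U : Set E} {k : ℕ∞ω} {M : E → Matrix κ κ ℝ[X]}
    (hM : ∀ i j l, ContDiffOn ℝ k (fun r => (M r i j).coeff l) U) (l : ℕ) :
    ContDiffOn ℝ k (fun r => (M r).det.coeff l) U := by
  simp only [Matrix.det_apply, finsetSum_coeff, Units.smul_def, coeff_smul]
  exact ContDiffOn.sum fun σ _ =>
    (contDiffOn_coeff_prod Finset.univ (fun i => hM (σ i) i) l).const_smul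
      ((Equiv.Perm.sign σ : ℤ))

theorem contDiffOn_cofCoeff {m n : ℕ} {E : Type*} [NormedAddCommGroup E] [NormedSpace ℝ E]
    {U : Set E} {k : ℕ∞ω} {J : E → Matrix (Fin m ⊕ Fin n) (Fin m ⊕ Fin n) ℝ}
    (hJ : ∀ α β, ContDiffOn ℝ k (fun r => J r α β) U) (i : ℕ) (α β : Fin m ⊕ Fin n) :
    ContDiffOn ℝ k (fun r => cofCoeff (J r) i α β) U := by
  simp only [cofCoeff, Matrix.adjugate_apply]
  refine contDiffOn_coeff_det (fun γ δ l => ?_) _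
  by_cases h : γ = β
  · subst h
    simp only [Matrix.updateRow_self]
    exact contDiffOn_const
  · simp only [Matrix.updateRow_ne h, Matrix.add_apply, Matrix.map_apply, coeff_add, coeff_C]
    refine ContDiffOn.add ?_ contDiffOn_const
    split_ifs
    · exact hJ γ δ
    · exact contDiffOn_const

end CofactorSmoothness

/-! ### The Hamiltonian identity along a solution of the driving system. -/

section AlongSolution

variable {m n : ℕ} {Y : Set (Fin m → ℝ)} {X : Set (Fin n → ℝ)}
  {g J : (Fin m ⊕ Fin n → ℝ) → Matrix (Fin m ⊕ Fin n) (Fin m ⊕ Fin n) ℝ}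
  {Q : (Fin m ⊕ Fin n → ℝ) → Fin m ⊕ Fin n → ℝ}
  (hs : IsDrivenCofactorSystem Y X g Q J)
  (hJ₁ : ∀ q ∈ domain Y X, (J q).toBlocks₁₁.det ≠ 0)
  {I : Set ℝ} (hI : IsOpen I) {y v : ℝ → Fin m → ℝ} {x₀ : Fin n → ℝ} (hx₀ : x₀ ∈ X)
  (hy : IsDrivingSolution Y x₀ g Q I y v)

include hs hI hx₀ hy

theorem contDiffOn_comp_join_along {f : (Fin m ⊕ Fin n → ℝ) → ℝ}
    (hf : ContDiffOn ℝ ∞ f (domain Y X)) :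
    ContDiffOn ℝ ∞ (fun w : ℝ × (Fin n → ℝ) => f (join (y w.1) w.2)) (I ×ˢ X) := by
  have h1 : ContDiffOn ℝ ∞ (fun w : ℝ × (Fin n → ℝ) => y w.1) (I ×ˢ X) :=
    (hy.contDiffOn hs hx₀ hI).1.comp contDiff_fst.contDiffOn fun w hw => hw.1
  have h2 : ContDiffOn ℝ ∞ (fun w : ℝ × (Fin n → ℝ) => join (y w.1) w.2) (I ×ˢ X) :=
    contDiff_join.comp_contDiffOn (h1.prodMk contDiff_snd.contDiffOn)
  exact hf.comp h2 fun w hw => join_mem_domain.2 ⟨hy.mem _ hw.1, hw.2⟩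

omit hI hx₀ in
theorem fderiv_comp_join_along {f : (Fin m ⊕ Fin n → ℝ) → ℝ}
    (hf : ContDiffOn ℝ ∞ f (domain Y X)) {t : ℝ} (ht : t ∈ I) {x : Fin n → ℝ} (hx : x ∈ X) :
    (fderiv ℝ (fun w : ℝ × (Fin n → ℝ) => f (join (y w.1) w.2)) (t, x) (1, 0)
      = ∑ j, v t j * pd f (Sum.inl j) (join (y t) x)) ∧
    ∀ b, fderiv ℝ (fun w : ℝ × (Fin n → ℝ) => f (join (y w.1) w.2)) (t, x) (0, Pi.single b 1)
      = pd f (Sum.inr b) (join (y t) x) := by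
  have hq : join (y t) x ∈ domain Y X := join_mem_domain.2 ⟨hy.mem t ht, hx⟩
  have hd := hf.differentiableAt_of_isOpen hs.isOpen hq
  have h1 : HasFDerivAt (fun w : ℝ × (Fin n → ℝ) => join (y w.1) w.2)
      ((joinL m n).comp ((((ContinuousLinearMap.toSpanSingleton ℝ (v t)).comp
        (ContinuousLinearMap.fst ℝ _ _))).prod (ContinuousLinearMap.snd ℝ _ _))) (t, x) :=
    (joinL m n).hasFDerivAt.comp (t, x)
      (((hy.vel t ht).hasFDerivAt.comp (t, x) hasFDerivAt_fst).prodMk hasFDerivAt_snd)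
  have h2 := (hd.hasFDerivAt.comp (t, x) h1).fderiv
  simp only [Function.comp_def] at h2
  rw [h2]
  constructor
  · simp [fderiv_apply_eq_sum_pd, Fintype.sum_sum_type]
  · intro b
    simp only [ContinuousLinearMap.comp_apply, ContinuousLinearMap.prod_apply, joinL_apply, pd,
      ContinuousLinearMap.coe_fst', ContinuousLinearMap.coe_snd', map_zero]
    congr 1
    ext (i | a) <;> simp [Pi.single_apply]

theorem contDiffOn_drivenHamiltonian {V : (Fin m ⊕ Fin n → ℝ) → ℝ}
    (hV : ContDiffOn ℝ ∞ V (domain Y X)) :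
    ContDiffOn ℝ ∞ (drivenHamiltonian g V y) {z | (z.1, z.2.1) ∈ I ×ˢ X} := by
  have hπ : ContDiff ℝ ∞ fun z : ℝ × (Fin n → ℝ) × (Fin n → ℝ) => (z.1, z.2.1) :=
    contDiff_fst.prodMk (contDiff_fst.comp contDiff_snd)
  have hP : ∀ a, ContDiff ℝ ∞ fun z : ℝ × (Fin n → ℝ) × (Fin n → ℝ) => z.2.2 a := fun a =>
    (contDiff_apply ℝ ℝ a).comp (contDiff_snd.comp contDiff_snd)
  have hf : ∀ {f : (Fin m ⊕ Fin n → ℝ) → ℝ}, ContDiffOn ℝ ∞ f (domain Y X) →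
      ContDiffOn ℝ ∞ (fun z : ℝ × (Fin n → ℝ) × (Fin n → ℝ) => f (join (y z.1) z.2.1))
        {z | (z.1, z.2.1) ∈ I ×ˢ X} := fun hf =>
    (contDiffOn_comp_join_along hs hI hx₀ hy hf).comp hπ.contDiffOn fun z hz => hz
  unfold drivenHamiltonian
  exact (contDiffOn_const.mul (ContDiffOn.sum fun a _ => ContDiffOn.sum fun b _ =>
    ((hf (contDiffOn_inv_apply hs.metric.smooth (fun r hr => hs.metric.det_ne_zero hr) _ _)).mul
      (hP a).contDiffOn).mul (hP b).contDiffOn)).add (hf hV)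

include hJ₁ in
theorem contDiffOn_reducedHamiltonian {W : (Fin m ⊕ Fin n → ℝ) → ℝ}
    (hW : ContDiffOn ℝ ∞ W (domain Y X)) :
    ContDiffOn ℝ ∞ (reducedHamiltonian g J W x₀ y v) {z | (z.1, z.2.1) ∈ I ×ˢ X} := by
  have hπ : ContDiff ℝ ∞ fun z : ℝ × (Fin n → ℝ) × (Fin n → ℝ) => (z.1, z.2.1) :=
    contDiff_fst.prodMk (contDiff_fst.comp contDiff_snd)
  have hf : ∀ {f : (Fin m ⊕ Fin n → ℝ) → ℝ}, ContDiffOn ℝ ∞ f (domain Y X) →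
      ContDiffOn ℝ ∞ (fun z : ℝ × (Fin n → ℝ) × (Fin n → ℝ) => f (join (y z.1) z.2.1))
        {z | (z.1, z.2.1) ∈ I ×ˢ X} := fun hf =>
    (contDiffOn_comp_join_along hs hI hx₀ hy hf).comp hπ.contDiffOn fun z hz => hz
  have hP : ∀ α, ContDiffOn ℝ ∞ (fun z : ℝ × (Fin n → ℝ) × (Fin n → ℝ) =>
      join (drivingMomentum g x₀ y v z.1) z.2.2 α) {z | (z.1, z.2.1) ∈ I ×ˢ X} := by
    rintro (i | a)
    · exact (hy.contDiffOn_drivingMomentum hs hx₀ hI i).comp contDiff_fst.contDiffOn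
        fun z hz => hz.1
    · exact ((contDiff_apply ℝ ℝ a).comp (contDiff_snd.comp contDiff_snd)).contDiffOn
  have hA : ∀ α β, ContDiffOn ℝ ∞ (fun q => (cofCoeff (J q) n * (g q)⁻¹) α β) (domain Y X) := by
    intro α β
    simp only [Matrix.mul_apply]
    exact ContDiffOn.sum fun γ _ => (contDiffOn_cofCoeff hs.scKt.smooth n α γ).mul
      (contDiffOn_inv_apply hs.metric.smooth (fun r hr => hs.metric.det_ne_zero hr) γ β)
  unfold reducedHamiltonian quadIntegral
  exact (hf ((contDiffOn_det (M := fun q => (J q).toBlocks₁₁)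
    fun _ _ => hs.scKt.smooth _ _).inv hJ₁)).mul
    ((contDiffOn_const.mul (ContDiffOn.sum fun α _ => ContDiffOn.sum fun β _ =>
      ((hf (hA α β)).mul (hP α)).mul (hP β))).add (hf hW))

omit hI in
include hJ₁ in
-- By g₁-symmetry, (g₁v)J₁⁻¹ = g₁(J₁⁻¹v): this is the relation p̃ = g₁w on which the computations
-- rest.
theorem drivingTildeMomentum_eq {t : ℝ} (ht : t ∈ I) {x : Fin n → ℝ} (hx : x ∈ X) :
    drivingTildeMomentum g J x₀ y v t = (g (join (y t) x)).toBlocks₁₁ *ᵥ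
      ((J (join (y t) x)).toBlocks₁₁⁻¹ *ᵥ v t) := by
  have hq : join (y t) x ∈ domain Y X := join_mem_domain.2 ⟨hy.mem t ht, hx⟩
  rw [drivingTildeMomentum_change_base hs (hy.mem t ht) hx₀ hx, drivingTildeMomentum,
    mulVec_mulVec, hs.metric₁_mul_inv_J₁₁ hq (hJ₁ _ hq).isUnit, ← mulVec_mulVec, mulVec_transpose]
  rfl

include hJ₁ in
-- The expression contains Q_i and the y-part of θ, taken at x. Yet both sides are the derivative at
-- t of one function p̃, so uniqueness of derivatives gives the independence of x without
-- computation.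
theorem tildeMomentumRate_eq {t : ℝ} (ht : t ∈ I) {x : Fin n → ℝ} (hx : x ∈ X) :
    tildeMomentumRate g J Q (join (y t) x) (v t) (drivingTildeMomentum g J x₀ y v t)
      = tildeMomentumRate g J Q (join (y t) x₀) (v t) (drivingTildeMomentum g J x₀ y v t) := by
  have h1 := (hy.change_base hs hx₀ hx).hasDerivAt_drivingTildeMomentum hs hx hJ₁ hI ht
  have h2 := hy.hasDerivAt_drivingTildeMomentum hs hx₀ hJ₁ hI ht
  have h3 := (h1.congr_of_eventuallyEq (Filter.eventuallyEq_of_mem (hI.mem_nhds ht)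
    fun s hs' => drivingTildeMomentum_change_base hs (hy.mem s hs') hx₀ hx)).unique h2
  rwa [drivingTildeMomentum_change_base hs (hy.mem t ht) hx hx₀] at h3

/-- The residual along a solution of the driving system, as a function of time and position. -/
def residualAlong (g J : (Fin m ⊕ Fin n → ℝ) → Matrix (Fin m ⊕ Fin n) (Fin m ⊕ Fin n) ℝ)
    (Q : (Fin m ⊕ Fin n → ℝ) → Fin m ⊕ Fin n → ℝ) (V W : (Fin m ⊕ Fin n → ℝ) → ℝ)
    (ψ : Fin m → (Fin m ⊕ Fin n → ℝ) → ℝ) (x₀ : Fin n → ℝ) (y v : ℝ → Fin m → ℝ) (t : ℝ)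
    (x : Fin n → ℝ) : ℝ :=
  residual J V W ψ (J (join (y t) x₀)).toBlocks₁₁⁻¹ (J (join (y t) x₀)).toBlocks₁₁.det (v t)
    ((J (join (y t) x₀)).toBlocks₁₁⁻¹ *ᵥ v t) (drivingTildeMomentum g J x₀ y v t)
    (tildeMomentumRate g J Q (join (y t) x₀) (v t) (drivingTildeMomentum g J x₀ y v t))
    (join (y t) x)

include hJ₁ in
/-- The residual is a function of time. -/
theorem residualAlong_eq (hn : n ≠ 0)
    {V : (Fin m ⊕ Fin n → ℝ) → ℝ} (hV : ContDiffOn ℝ ∞ V (domain Y X))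
    (hVQ : ∀ q ∈ domain Y X, ∀ a, Q q (Sum.inr a) = - pd V (Sum.inr a) q)
    {W : (Fin m ⊕ Fin n → ℝ) → ℝ} (hW : IsCofactorPotential (domain Y X) Q J n W)
    {ψ : Fin m → (Fin m ⊕ Fin n → ℝ) → ℝ} (hψ : ∀ i, ContDiffOn ℝ ∞ (ψ i) (domain Y X))
    (hψJ : ∀ q ∈ domain Y X, ∀ i a, pd (ψ i) (Sum.inr a) q = J q (Sum.inl i) (Sum.inr a))
    {t : ℝ} (ht : t ∈ I) {x : Fin n → ℝ} (hx : x ∈ X) :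
    residualAlong g J Q V W ψ x₀ y v t x = residualAlong g J Q V W ψ x₀ y v t x₀ := by
  unfold residualAlong
  have hmem : ∀ x ∈ X, join (y t) x ∈ domain Y X := fun x hx =>
    join_mem_domain.2 ⟨hy.mem t ht, hx⟩
  refine eq_of_pd_inr_eq_zero hs.isOpen_X hs.isConnected_X.isPreconnected
    (fun x hx => differentiableAt_residual hs hV hW.smooth hψ (hmem x hx) _ _ _ _ _ _)
    (fun x hx a => ?_) hx hx₀
  -- The coefficients of the residual are frozen at x₀; the gradient computation needs their values
  -- at x.
  rw [hs.J₁₁_eq (hy.mem t ht) hx₀ hx, ← tildeMomentumRate_eq hs hJ₁ hI hx₀ hy ht hx]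
  have hJu := (hJ₁ _ (hmem x hx)).isUnit
  refine pd_residual_inr_eq_zero hs hV hW.smooth hψ hψJ (hmem x hx) hJu
    (drivingTildeMomentum_eq hs hJ₁ hx₀ hy ht hx) a (hVQ _ (hmem x hx) a) ?_
  -- The component of A_(n)μ = −dW along ∂/∂x^a, to be divided by det J₁.
  have h := hW.eq _ (hmem x hx) (Sum.inr a)
  rw [cofCoeff_eq hn _ hJu] at h
  simp only [Matrix.smul_apply, smul_eq_mul, mul_assoc, ← Finset.mul_sum, Fintype.sum_sum_type,
    fromBlocks_apply₁₂, fromBlocks_apply₂₂, Matrix.neg_apply, Matrix.one_apply, ite_mul, one_mul,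
    zero_mul, Finset.sum_ite_eq', Finset.mem_univ, if_true, neg_mul, Finset.sum_neg_distrib] at h
  have h2 : (fun i => Q (join (y t) x) (Sum.inl i)) ⬝ᵥ ((J (join (y t) x)).toBlocks₁₁⁻¹ *ᵥ
      fun i => J (join (y t) x) (Sum.inl i) (Sum.inr a))
      = ∑ i, ((J (join (y t) x)).toBlocks₁₁⁻¹ * (J (join (y t) x)).toBlocks₁₂) i a
        * Q (join (y t) x) (Sum.inl i) :=
    Finset.sum_congr rfl fun i _ => mul_comm _ _
  rw [h2, show pd W (Sum.inr a) (join (y t) x) = -(-pd W (Sum.inr a) (join (y t) x)) by ring, ← h,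
    mul_neg, ← mul_assoc, inv_mul_cancel₀ hJu.ne_zero]
  ring

omit hI in
include hJ₁ in
/-- The sum `h + ∂F₁/∂t + ∂F₂/∂t`, in terms of the reduced Hamiltonian. -/
theorem drivenHamiltonian_add_eq (hn : n ≠ 0) (V W : (Fin m ⊕ Fin n → ℝ) → ℝ)
    (ψ : Fin m → (Fin m ⊕ Fin n → ℝ) → ℝ)
    {u : Fin n → (Fin m ⊕ Fin n → ℝ) → ℝ} (hu : IsIndependentEigenfunctions (domain Y X) J u)
    {t : ℝ} (ht : t ∈ I) {x : Fin n → ℝ} (hx : x ∈ X) {p s : Fin n → ℝ}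
    (hp : ∀ a, p a = ∑ b, s b * pd (u b) (Sum.inr a) (join (y t) x)
      + ∑ i, J (join (y t) x) (Sum.inl i) (Sum.inr a) * drivingTildeMomentum g J x₀ y v t i) :
    drivenHamiltonian g V y (t, x, p)
      + ∑ i, ((∑ j, v t j * pd (ψ i) (Sum.inl j) (join (y t) x))
          * drivingTildeMomentum g J x₀ y v t i
        + ψ i (join (y t) x) * tildeMomentumRate g J Q (join (y t) x₀) (v t)
          (drivingTildeMomentum g J x₀ y v t) i)
      + ∑ a, s a * ∑ j, v t j * pd (u a) (Sum.inl j) (join (y t) x)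
    = reducedHamiltonian g J W x₀ y v (t, x, p) + residualAlong g J Q V W ψ x₀ y v t x := by
  set q := join (y t) x with hqdef
  have hq : q ∈ domain Y X := join_mem_domain.2 ⟨hy.mem t ht, hx⟩
  have hJu := (hJ₁ q hq).isUnit
  rw [residualAlong, hs.J₁₁_eq (hy.mem t ht) hx₀ hx, ← hqdef, residual]
  set pt := drivingTildeMomentum g J x₀ y v t with hpt
  set p' := tildeMomentumRate g J Q (join (y t) x₀) (v t) pt with hp'
  set w := (J q).toBlocks₁₁⁻¹ *ᵥ v t with hw
  have hv : v t = (J q).toBlocks₁₁ *ᵥ w := by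
    rw [hw, mulVec_mulVec, mul_nonsing_inv _ hJu, one_mulVec]
  have hptw : pt = (g q).toBlocks₁₁ *ᵥ w := drivingTildeMomentum_eq hs hJ₁ hx₀ hy ht hx
  have hmom : drivingMomentum g x₀ y v t
      = (g q).toBlocks₁₁ *ᵥ ((J q).toBlocks₁₁ *ᵥ w) := by
    rw [← hv, drivingMomentum_change_base hs (hy.mem t ht) hx₀ hx]
    rfl
  have hred : reducedHamiltonian g J W x₀ y v (t, x, p) = (J q).toBlocks₁₁.det⁻¹ *
      quadIntegral g J n W q (join ((g q).toBlocks₁₁ *ᵥ ((J q).toBlocks₁₁ *ᵥ w)) p) := by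
    rw [reducedHamiltonian]
    simp only
    rw [← hqdef, hmom]
  have hh : drivenHamiltonian g V y (t, x, p)
      = (1 / 2) * (p ⬝ᵥ (g q).toBlocks₂₂⁻¹ *ᵥ p) + V q := by
    rw [drivenHamiltonian]
    simp only
    rw [← hqdef, hs.inv_metric_eq hq]
    simp only [fromBlocks_apply₂₂, dotProduct, mulVec, Finset.mul_sum]
    congr 1
    exact Finset.sum_congr rfl fun a _ => Finset.sum_congr rfl fun b _ => by ring
  have hF2 : ∑ a, s a * ∑ j, v t j * pd (u a) (Sum.inl j) q
      = -(p ⬝ᵥ (J q).toBlocks₂₁ *ᵥ w) + pt ⬝ᵥ ((J q).toBlocks₁₂ * (J q).toBlocks₂₁) *ᵥ w := by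
    -- With v = J₁w, the relation du(J ∂/∂y^i) = 0 contracted with w^i trades the derivative along v
    -- for minus the derivative along J₂₁w.
    have h1 : ∀ a, ∑ j, v t j * pd (u a) (Sum.inl j) q
        = -∑ b, pd (u a) (Sum.inr b) q * ((J q).toBlocks₂₁ *ᵥ w) b := by
      intro a
      have h2 : ∑ i, w i * ∑ α, pd (u a) α q * J q α (Sum.inl i) = 0 :=
        Finset.sum_eq_zero fun i _ => by rw [hu.sum_J_mul_pd_eq_zero hs hJ₁ hq, mul_zero]
      simp only [Fintype.sum_sum_type, mul_add, Finset.sum_add_distrib] at h2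
      have h3 : ∑ j, v t j * pd (u a) (Sum.inl j) q
          = ∑ i, w i * ∑ j, pd (u a) (Sum.inl j) q * J q (Sum.inl j) (Sum.inl i) := by
        simp only [Finset.mul_sum]
        rw [Finset.sum_comm]
        refine Finset.sum_congr rfl fun j _ => ?_
        rw [hv, mulVec, dotProduct, Finset.sum_mul]
        exact Finset.sum_congr rfl fun i _ => by
          simp only [toBlocks₁₁, of_apply]; ring
      have h4 : ∑ b, pd (u a) (Sum.inr b) q * ((J q).toBlocks₂₁ *ᵥ w) b
          = ∑ i, w i * ∑ b, pd (u a) (Sum.inr b) q * J q (Sum.inr b) (Sum.inl i) := by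
        simp only [Finset.mul_sum]
        rw [Finset.sum_comm]
        refine Finset.sum_congr rfl fun b _ => ?_
        rw [mulVec, dotProduct, Finset.mul_sum]
        exact Finset.sum_congr rfl fun i _ => by
          simp only [toBlocks₂₁, of_apply]; ring
      rw [h3, h4]
      linarith
    -- The momentum relations say s_b ∂_a u^b = p_a − J^i_a p̃_i, which eliminates s from ∂F₂/∂t.
    have h5 : p = (fun a => ∑ b, s b * pd (u b) (Sum.inr a) q) + pt ᵥ* (J q).toBlocks₁₂ := by
      ext a
      rw [hp a, Pi.add_apply]
      congr 1
      exact Finset.sum_congr rfl fun i _ => mul_comm _ _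
    have h6 : pt ⬝ᵥ ((J q).toBlocks₁₂ * (J q).toBlocks₂₁) *ᵥ w
        = (pt ᵥ* (J q).toBlocks₁₂) ⬝ᵥ (J q).toBlocks₂₁ *ᵥ w := by
      rw [← mulVec_mulVec, dotProduct_mulVec]
    rw [h6]
    nth_rw 1 [h5]
    rw [add_dotProduct]
    simp only [h1]
    have h7 : (fun a => ∑ b, s b * pd (u b) (Sum.inr a) q) ⬝ᵥ (J q).toBlocks₂₁ *ᵥ w
        = ∑ a, s a * ∑ b, pd (u a) (Sum.inr b) q * ((J q).toBlocks₂₁ *ᵥ w) b := by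
      simp only [dotProduct, Finset.sum_mul, Finset.mul_sum]
      rw [Finset.sum_comm]
      exact Finset.sum_congr rfl fun a _ => Finset.sum_congr rfl fun b _ => by ring
    rw [h7]
    simp only [mul_neg, Finset.sum_neg_distrib]
    ring
  have hψs : ∑ i, ((∑ j, v t j * pd (ψ i) (Sum.inl j) q) * pt i + ψ i q * p' i)
      = ∑ j, ∑ i, pd (ψ i) (Sum.inl j) q * (pt i * v t j) + ∑ i, ψ i q * p' i := by
    rw [Finset.sum_add_distrib, Finset.sum_comm (γ := Fin m)]
    congr 1
    refine Finset.sum_congr rfl fun i _ => ?_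
    rw [Finset.sum_mul]
    exact Finset.sum_congr rfl fun j _ => by ring
  rw [hh, hψs, hF2, hred, det_inv_mul_quadIntegral hs hn hq hJu W w p, trace_schur, ← hptw, ← hv]
  ring

end AlongSolution

/-! ### The two transformations of the proposition. -/

section MomentumShift

variable {m n : ℕ} {Y : Set (Fin m → ℝ)} {X : Set (Fin n → ℝ)}
  {g J : (Fin m ⊕ Fin n → ℝ) → Matrix (Fin m ⊕ Fin n) (Fin m ⊕ Fin n) ℝ}
  {Q : (Fin m ⊕ Fin n → ℝ) → Fin m ⊕ Fin n → ℝ}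
  {I : Set ℝ} {y v : ℝ → Fin m → ℝ} {x₀ : Fin n → ℝ}
  {ψ : Fin m → (Fin m ⊕ Fin n → ℝ) → ℝ} {u : Fin n → (Fin m ⊕ Fin n → ℝ) → ℝ}

/-- The function `ψ^i(x, y(t)) p̃_i(t)`. -/
def momentumShift (g J : (Fin m ⊕ Fin n → ℝ) → Matrix (Fin m ⊕ Fin n) (Fin m ⊕ Fin n) ℝ)
    (ψ : Fin m → (Fin m ⊕ Fin n → ℝ) → ℝ) (x₀ : Fin n → ℝ) (y v : ℝ → Fin m → ℝ)
    (w : ℝ × (Fin n → ℝ)) : ℝ :=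
  ∑ i, ψ i (join (y w.1) w.2) * drivingTildeMomentum g J x₀ y v w.1 i

/-- F₁ is the affine generating function with identity base map and S = ψ^i p̃_i; F₂ is the one with
S = 0. One general construction serves both. -/
theorem momentumShiftGen_eq : momentumShiftGen g J ψ x₀ y v
    = affineGen (fun a w => w.2 a) (momentumShift g J ψ x₀ y v) := by
  funext z
  simp only [momentumShiftGen, affineGen, momentumShift, mul_comm (z.2.1 _)]

theorem pointGen_eq : pointGen u y = affineGen (fun a w => u a (join (y w.1) w.2)) 0 := by
  funext z
  simp only [pointGen, affineGen, Pi.zero_apply, add_zero]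

theorem baseMap_snd : baseMap (fun (a : Fin n) w => w.2 a) = id := rfl

theorem hasFDerivAt_snd_apply (a : Fin n) (w : ℝ × (Fin n → ℝ)) :
    HasFDerivAt (fun w : ℝ × (Fin n → ℝ) => w.2 a)
      ((ContinuousLinearMap.proj (R := ℝ) (φ := fun _ : Fin n => ℝ) a).comp
        (ContinuousLinearMap.snd ℝ ℝ (Fin n → ℝ))) w :=
  (ContinuousLinearMap.proj (R := ℝ) (φ := fun _ : Fin n => ℝ) a).hasFDerivAt.comp w
    hasFDerivAt_snd

theorem fderiv_snd_apply (a : Fin n) (w ζ : ℝ × (Fin n → ℝ)) :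
    fderiv ℝ (fun w : ℝ × (Fin n → ℝ) => w.2 a) w ζ = ζ.2 a := by
  rw [(hasFDerivAt_snd_apply a w).fderiv]
  rfl

theorem baseJacobian_snd (w : ℝ × (Fin n → ℝ)) :
    baseJacobian (fun (a : Fin n) w => w.2 a) w = 1 := by
  ext a b
  rw [baseJacobian, Matrix.of_apply, fderiv_snd_apply]
  simp [Matrix.one_apply, Pi.single_apply]

variable (hs : IsDrivenCofactorSystem Y X g Q J)
  (hJ₁ : ∀ q ∈ domain Y X, (J q).toBlocks₁₁.det ≠ 0) (hI : IsOpen I) (hx₀ : x₀ ∈ X)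
  (hy : IsDrivingSolution Y x₀ g Q I y v)
include hs hI hx₀ hy

include hJ₁ in
theorem contDiffOn_momentumShift (hψ : ∀ i, ContDiffOn ℝ ∞ (ψ i) (domain Y X)) :
    ContDiffOn ℝ ∞ (momentumShift g J ψ x₀ y v) (I ×ˢ X) := by
  unfold momentumShift
  exact ContDiffOn.sum fun i _ => (contDiffOn_comp_join_along hs hI hx₀ hy (hψ i)).mul
    ((hy.contDiffOn_drivingTildeMomentum hs hx₀ hJ₁ hI i).comp contDiff_fst.contDiffOn
      fun w hw => hw.1)

include hJ₁ in
theorem fderiv_momentumShift (hψ : ∀ i, ContDiffOn ℝ ∞ (ψ i) (domain Y X)) {t : ℝ} (ht : t ∈ I)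
    {x : Fin n → ℝ} (hx : x ∈ X) :
    fderiv ℝ (momentumShift g J ψ x₀ y v) (t, x) (1, 0)
      = ∑ i, ((∑ j, v t j * pd (ψ i) (Sum.inl j) (join (y t) x))
          * drivingTildeMomentum g J x₀ y v t i
        + ψ i (join (y t) x) * tildeMomentumRate g J Q (join (y t) x₀) (v t)
          (drivingTildeMomentum g J x₀ y v t) i) ∧
    ∀ b, fderiv ℝ (momentumShift g J ψ x₀ y v) (t, x) (0, Pi.single b 1)
      = ∑ i, pd (ψ i) (Sum.inr b) (join (y t) x) * drivingTildeMomentum g J x₀ y v t i := by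
  have hp : ∀ i, HasDerivAt (fun τ => drivingTildeMomentum g J x₀ y v τ i)
      (tildeMomentumRate g J Q (join (y t) x₀) (v t) (drivingTildeMomentum g J x₀ y v t) i) t :=
    hasDerivAt_pi.1 (hy.hasDerivAt_drivingTildeMomentum hs hx₀ hJ₁ hI ht)
  have hP : ∀ i, HasFDerivAt
      (fun w : ℝ × (Fin n → ℝ) => drivingTildeMomentum g J x₀ y v w.1 i)
      (tildeMomentumRate g J Q (join (y t) x₀) (v t) (drivingTildeMomentum g J x₀ y v t) i •
        ContinuousLinearMap.fst ℝ ℝ (Fin n → ℝ)) (t, x) := fun i =>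
    HasDerivAt.comp_hasFDerivAt (h₂ := fun τ => drivingTildeMomentum g J x₀ y v τ i) (t, x) (hp i)
      hasFDerivAt_fst
  have hd : ∀ i, DifferentiableAt ℝ
      (fun w : ℝ × (Fin n → ℝ) => ψ i (join (y w.1) w.2)) (t, x) := fun i =>
    (contDiffOn_comp_join_along hs hI hx₀ hy (hψ i)).differentiableAt_of_isOpen
      (hI.prod hs.isOpen_X) ⟨ht, hx⟩
  have h : HasFDerivAt (momentumShift g J ψ x₀ y v) _ (t, x) :=
    HasFDerivAt.fun_sum (u := Finset.univ) fun i _ =>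
      (hd i).hasFDerivAt.fun_mul (hP i)
  have hf := fun i => fderiv_comp_join_along hs hy (hψ i) ht hx
  rw [h.fderiv]
  simp only [_root_.sum_apply, _root_.add_apply, _root_.smul_apply, smul_eq_mul,
    ContinuousLinearMap.coe_fst', (hf _).1, (hf _).2]
  constructor
  · exact Finset.sum_congr rfl fun i _ => by ring
  · exact fun b => Finset.sum_congr rfl fun i _ => by ring

theorem baseJacobian_along (hu : IsIndependentEigenfunctions (domain Y X) J u) {t : ℝ} (ht : t ∈ I)
    {x : Fin n → ℝ} (hx : x ∈ X) :
    baseJacobian (fun a w => u a (join (y w.1) w.2)) (t, x)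
      = Matrix.of fun a b => pd (u a) (Sum.inr b) (join (y t) x) := by
  ext a b
  exact (fderiv_comp_join_along hs hy (hu.smooth a) ht hx).2 b

theorem det_baseJacobian_along_ne_zero (hu : IsIndependentEigenfunctions (domain Y X) J u)
    {w : ℝ × (Fin n → ℝ)} (hw : w ∈ I ×ˢ X) :
    (baseJacobian (fun a w => u a (join (y w.1) w.2)) w).det ≠ 0 := by
  obtain ⟨t, x⟩ := w
  rw [baseJacobian_along hs hI hx₀ hy hu hw.1 hw.2]
  exact hu.independent _ (join_mem_domain.2 ⟨hy.mem t hw.1, hw.2⟩)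

include hJ₁ in
/-- The canonical transformation `p_a = p̃_a + J^i_a p̃_i(t)`. -/
theorem exists_canonical_momentumShiftGen (hψ : ∀ i, ContDiffOn ℝ ∞ (ψ i) (domain Y X)) :
    ∃ Φ : OpenPartialHomeomorph (ℝ × (Fin n → ℝ) × (Fin n → ℝ))
        (ℝ × (Fin n → ℝ) × (Fin n → ℝ)),
      Φ.source = {z | z.1 ∈ I ∧ z.2.1 ∈ X} ∧ Φ.target = {z | z.1 ∈ I ∧ z.2.1 ∈ X} ∧
      IsCanonicalGeneratedBy Φ (momentumShiftGen g J ψ x₀ y v) := by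
  obtain ⟨Φ, hsrc, htgt, hΦ⟩ := exists_canonical_affineGen
    (u := fun (a : Fin n) w => w.2 a) (hI.prod hs.isOpen_X)
    (fun a => ((contDiff_apply ℝ ℝ a).comp contDiff_snd).contDiffOn)
    (contDiffOn_momentumShift hs hJ₁ hI hx₀ hy hψ)
    (fun w _ => by rw [baseJacobian_snd]; simp) (by rw [baseMap_snd]; exact Set.injOn_id _)
  refine ⟨Φ, hsrc, ?_, momentumShiftGen_eq ▸ hΦ⟩
  rw [htgt, baseMap_snd, Set.image_id]
  rfl

/-- The map `(t, x) ↦ (t, u(y(t), x))` is locally injective. -/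
theorem exists_injOn_along (hu : IsIndependentEigenfunctions (domain Y X) J u) {t : ℝ} (ht : t ∈ I)
    {x : Fin n → ℝ} (hx : x ∈ X) :
    ∃ N : Set (ℝ × (Fin n → ℝ)), IsOpen N ∧ (t, x) ∈ N ∧ N ⊆ I ×ˢ X ∧
      Set.InjOn (fun w : ℝ × (Fin n → ℝ) => (w.1, fun a => u a (join (y w.1) w.2))) N := by
  have hc := fun a => contDiffOn_comp_join_along hs hI hx₀ hy (hu.smooth a)
  exact exists_isOpen_injOn (hI.prod hs.isOpen_X) ⟨ht, hx⟩ (contDiffOn_baseMap hc)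
    (injective_fderiv_baseMap
      (fun a => (hc a).differentiableAt_of_isOpen (hI.prod hs.isOpen_X) ⟨ht, hx⟩)
      (det_baseJacobian_along_ne_zero hs hI hx₀ hy hu ⟨ht, hx⟩))

theorem exists_canonical_pointGen (hu : IsIndependentEigenfunctions (domain Y X) J u)
    {N : Set (ℝ × (Fin n → ℝ))} (hN : IsOpen N) (hNI : N ⊆ I ×ˢ X)
    (hinj : Set.InjOn (fun w : ℝ × (Fin n → ℝ) => (w.1, fun a => u a (join (y w.1) w.2))) N) :
    ∃ Φ : OpenPartialHomeomorph (ℝ × (Fin n → ℝ) × (Fin n → ℝ))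
        (ℝ × (Fin n → ℝ) × (Fin n → ℝ)),
      Φ.source = {z | (z.1, z.2.1) ∈ N} ∧ IsCanonicalGeneratedBy Φ (pointGen u y) := by
  obtain ⟨Φ, hsrc, -, hΦ⟩ := exists_canonical_affineGen hN
    (u := fun a w => u a (join (y w.1) w.2)) (S := 0)
    (fun a => (contDiffOn_comp_join_along hs hI hx₀ hy (hu.smooth a)).mono hNI)
    contDiffOn_const (fun w hw => det_baseJacobian_along_ne_zero hs hI hx₀ hy hu (hNI hw)) hinj
  exact ⟨Φ, hsrc, pointGen_eq ▸ hΦ⟩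

end MomentumShift

/-! ### The transformed Hamiltonian and its equations of motion. -/

section Reduction

variable {m n : ℕ} {Y : Set (Fin m → ℝ)} {X : Set (Fin n → ℝ)}
  {g J : (Fin m ⊕ Fin n → ℝ) → Matrix (Fin m ⊕ Fin n) (Fin m ⊕ Fin n) ℝ}
  {Q : (Fin m ⊕ Fin n → ℝ) → Fin m ⊕ Fin n → ℝ}
  (hs : IsDrivenCofactorSystem Y X g Q J)
  (hJ₁ : ∀ q ∈ domain Y X, (J q).toBlocks₁₁.det ≠ 0)
  {V : (Fin m ⊕ Fin n → ℝ) → ℝ} (hV : ContDiffOn ℝ ∞ V (domain Y X))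
  (hVQ : ∀ q ∈ domain Y X, ∀ a, Q q (Sum.inr a) = - pd V (Sum.inr a) q)
  {W : (Fin m ⊕ Fin n → ℝ) → ℝ} (hW : IsCofactorPotential (domain Y X) Q J n W)
  {ψ : Fin m → (Fin m ⊕ Fin n → ℝ) → ℝ} (hψ : ∀ i, ContDiffOn ℝ ∞ (ψ i) (domain Y X))
  (hψJ : ∀ q ∈ domain Y X, ∀ i a, pd (ψ i) (Sum.inr a) q = J q (Sum.inl i) (Sum.inr a))
  {u : Fin n → (Fin m ⊕ Fin n → ℝ) → ℝ}
  (hu : IsIndependentEigenfunctions (domain Y X) J u)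
  {x₀ : Fin n → ℝ} (hx₀ : x₀ ∈ X) {I : Set ℝ} (hI : IsOpen I) {y v : ℝ → Fin m → ℝ}
  (hy : IsDrivingSolution Y x₀ g Q I y v)
  {Φ₁ Φ₂ : OpenPartialHomeomorph (ℝ × (Fin n → ℝ) × (Fin n → ℝ)) (ℝ × (Fin n → ℝ) × (Fin n → ℝ))}
  (hsrc₁ : Φ₁.source = {z | z.1 ∈ I ∧ z.2.1 ∈ X})
  (hΦ₁ : IsCanonicalGeneratedBy Φ₁ (momentumShiftGen g J ψ x₀ y v))
  (hsrc₂ : Φ₂.source ⊆ {z | z.1 ∈ I ∧ z.2.1 ∈ X})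
  (hΦ₂ : IsCanonicalGeneratedBy Φ₂ (pointGen u y))

include hs hJ₁ hψ hx₀ hI hy hsrc₁ hΦ₁ in
theorem new_position_momentumShiftGen {z : ℝ × (Fin n → ℝ) × (Fin n → ℝ)} (hz : z ∈ Φ₁.source) :
    (Φ₁ z).2.1 = z.2.1 := by
  have hz' : (z.1, z.2.1) ∈ I ×ˢ X := by rw [hsrc₁] at hz; exact hz
  ext a
  rw [hΦ₁.new_position z hz a, momentumShiftGen_eq, (hasFDerivAt_affineGen (z := (z.1, z.2.1, (Φ₁ z).2.2))
    (u := fun a w => w.2 a) (fun a => (hasFDerivAt_snd_apply a _).differentiableAt)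
    ((contDiffOn_momentumShift hs hJ₁ hI hx₀ hy hψ).differentiableAt_of_isOpen
      (hI.prod hs.isOpen_X) hz')).2]
  have h0 : ((0, 0) : ℝ × (Fin n → ℝ)) = 0 := rfl
  simp [h0, Pi.single_apply]

include hs hJ₁ hV hVQ hW hψ hψJ hu hx₀ hI hy hsrc₁ hΦ₁ hsrc₂ hΦ₂

theorem transformedHamiltonian_eq (hn : n ≠ 0) {z : ℝ × (Fin n → ℝ) × (Fin n → ℝ)}
    (hz : z ∈ (Φ₁.trans Φ₂).source) :
    transformedHamiltonian Φ₂ (pointGen u y)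
        (transformedHamiltonian Φ₁ (momentumShiftGen g J ψ x₀ y v)
          (drivenHamiltonian g V y)) (Φ₁.trans Φ₂ z)
      = reducedHamiltonian g J W x₀ y v z + residualAlong g J Q V W ψ x₀ y v z.1 x₀ := by
  obtain ⟨hz1, hz2⟩ : z ∈ Φ₁.source ∧ Φ₁ z ∈ Φ₂.source := by simpa using hz
  have hmem : z.1 ∈ I ∧ z.2.1 ∈ X := by rw [hsrc₁] at hz1; exact hz1
  have ht := hmem.1
  have hx := hmem.2
  have hpos := new_position_momentumShiftGen hs hJ₁ hψ hx₀ hI hy hsrc₁ hΦ₁ hz1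
  have htime := hΦ₁.time z hz1
  have hUo := hI.prod hs.isOpen_X
  have hg₁ := fun ζ => (hasFDerivAt_affineGen (z := mixedPoint Φ₁ z) (u := fun a w => w.2 a)
    (fun a => (hasFDerivAt_snd_apply a _).differentiableAt)
    ((contDiffOn_momentumShift hs hJ₁ hI hx₀ hy hψ).differentiableAt_of_isOpen
      hUo hmem)).2 ζ
  have hg₂ := fun ζ => (hasFDerivAt_affineGen (z := mixedPoint Φ₂ (Φ₁ z))
    (u := fun a w => u a (join (y w.1) w.2)) (S := 0)
    (fun a => (contDiffOn_comp_join_along hs hI hx₀ hy (hu.smooth a)).differentiableAt_of_isOpen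
      hUo (hsrc₂ hz2 : (Φ₁ z).1 ∈ I ∧ (Φ₁ z).2.1 ∈ X)) (differentiableAt_const 0)).2 ζ
  have hm₁ : mixedPoint Φ₁ z = (z.1, z.2.1, (Φ₁ z).2.2) := rfl
  have hm₂ : mixedPoint Φ₂ (Φ₁ z) = (z.1, z.2.1, (Φ₂ (Φ₁ z)).2.2) := by
    rw [mixedPoint, htime, hpos]
  have hS := fderiv_momentumShift hs hJ₁ hI hx₀ hy hψ ht hx
  have hu' := fun a => fderiv_comp_join_along hs hy (hu.smooth a) ht hx
  have h0 : fderiv ℝ (0 : ℝ × (Fin n → ℝ) → ℝ) = 0 := fderiv_zero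
  have hp₁ := hΦ₁.old_momentum z hz1
  have hp₂ := hΦ₂.old_momentum (Φ₁ z) hz2
  change ∀ a, z.2.2 a = fderiv ℝ _ (mixedPoint Φ₁ z) (0, Pi.single a 1, 0) at hp₁
  change ∀ a, (Φ₁ z).2.2 a = fderiv ℝ _ (mixedPoint Φ₂ (Φ₁ z)) (0, Pi.single a 1, 0) at hp₂
  rw [momentumShiftGen_eq] at hp₁
  rw [pointGen_eq] at hp₂
  rw [OpenPartialHomeomorph.coe_trans, Function.comp_apply,
    hΦ₂.transformedHamiltonian_apply hz2, hΦ₁.transformedHamiltonian_apply hz1,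
    momentumShiftGen_eq, pointGen_eq]
  rw [hm₁] at hg₁ hp₁ ⊢
  rw [hm₂] at hg₂ hp₂ ⊢
  simp only [hg₁, fderiv_snd_apply, hS.1, hS.2] at hp₁ ⊢
  simp only [hg₂, (hu' _).1, (hu' _).2, h0] at hp₂ ⊢
  -- Chaining the momentum relations of the two steps expresses p through s; this is the input of
  -- `drivenHamiltonian_add_eq`.
  have hp : ∀ a, z.2.2 a = ∑ b, (Φ₂ (Φ₁ z)).2.2 b * pd (u b) (Sum.inr a) (join (y z.1) z.2.1)
      + ∑ i, J (join (y z.1) z.2.1) (Sum.inl i) (Sum.inr a)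
        * drivingTildeMomentum g J x₀ y v z.1 i := by
    intro a
    have h := hp₁ a
    simp only [hψJ _ (join_mem_domain.2 ⟨hy.mem _ ht, hx⟩)] at h
    simp [Pi.single_apply] at h
    rw [h, hp₂ a]
    simp
  rw [← residualAlong_eq hs hJ₁ hI hx₀ hy hn hV hVQ hW hψ hψJ ht hx,
    ← drivenHamiltonian_add_eq hs hJ₁ hx₀ hy hn V W ψ hu ht hx hp]
  simp

/-- The correspondences of the two canonical steps compose, and the additive function of time does
not enter Hamilton's equations. -/
theorem intertwinesHamilton_reducedHamiltonian (hn : n ≠ 0)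
    (htgt₁ : Φ₁.target = {z | z.1 ∈ I ∧ z.2.1 ∈ X}) :
    IntertwinesHamilton (Φ₁.trans Φ₂) (drivenHamiltonian g V y)
      (fun w => reducedHamiltonian g J W x₀ y v ((Φ₁.trans Φ₂).symm w)) := by
  have hUo := hI.prod hs.isOpen_X
  have hπ : Continuous fun z : ℝ × (Fin n → ℝ) × (Fin n → ℝ) => (z.1, z.2.1) := by fun_prop
  have hO := hUo.preimage hπ
  have hF₁ : ContDiffOn ℝ ∞ (momentumShiftGen g J ψ x₀ y v) {z | (z.1, z.2.1) ∈ I ×ˢ X} := by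
    rw [momentumShiftGen_eq]
    exact contDiffOn_affineGen (fun a => ((contDiff_apply ℝ ℝ a).comp contDiff_snd).contDiffOn)
      (contDiffOn_momentumShift hs hJ₁ hI hx₀ hy hψ)
  have hF₂ : ContDiffOn ℝ ∞ (pointGen u y) {z | (z.1, z.2.1) ∈ I ×ˢ X} := by
    rw [pointGen_eq]
    exact contDiffOn_affineGen
      (fun a => contDiffOn_comp_join_along hs hI hx₀ hy (hu.smooth a)) contDiffOn_const
  have hmix₁ : ∀ z ∈ Φ₁.source, mixedPoint Φ₁ z ∈ {z | (z.1, z.2.1) ∈ I ×ˢ X} :=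
    fun z hz => by rw [hsrc₁] at hz; exact hz
  have hmix₂ : ∀ z ∈ Φ₂.source, mixedPoint Φ₂ z ∈ {z | (z.1, z.2.1) ∈ I ×ˢ X} :=
    fun z hz => (hsrc₂ hz : z.1 ∈ I ∧ z.2.1 ∈ X)
  have hdh : ∀ z ∈ Φ₁.source, DifferentiableAt ℝ (drivenHamiltonian g V y) z := fun z hz =>
    (contDiffOn_drivenHamiltonian hs hI hx₀ hy hV).differentiableAt_of_isOpen hO (hmix₁ z hz)
  have hd₁ : ∀ w ∈ Φ₁.target, DifferentiableAt ℝ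
      (transformedHamiltonian Φ₁ (momentumShiftGen g J ψ x₀ y v) (drivenHamiltonian g V y)) w := by
    intro w hw
    have hw' := Φ₁.map_target hw
    have h := hΦ₁.differentiableAt_transformedHamiltonian hO hF₁ hmix₁ hw' (hdh _ hw')
    rwa [Φ₁.right_inv hw] at h
  have hd₂ : ∀ w ∈ Φ₂.source, DifferentiableAt ℝ
      (transformedHamiltonian Φ₁ (momentumShiftGen g J ψ x₀ y v) (drivenHamiltonian g V y)) w :=
    fun w hw => hd₁ w (htgt₁ ▸ hsrc₂ hw)
  have htime : ∀ z ∈ (Φ₁.trans Φ₂).source, (Φ₁.trans Φ₂ z).1 = z.1 := by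
    intro z hz
    rw [OpenPartialHomeomorph.trans_source] at hz
    exact (hΦ₂.time _ hz.2).trans (hΦ₁.time _ hz.1)
  refine ((hΦ₁.intertwinesHamilton hO hF₁ hmix₁ hdh).trans hΦ₁.time
    (hΦ₂.intertwinesHamilton hO hF₂ hmix₂ hd₂)).congr_of_eq_add_time htime
    (c := fun t => residualAlong g J Q V W ψ x₀ y v t x₀) (fun w hw => ?_) (fun w hw => ?_)
    fun w hw => ?_
  · rw [OpenPartialHomeomorph.trans_target] at hw
    have hw' := Φ₂.map_target hw.1
    have h := hΦ₂.differentiableAt_transformedHamiltonian hO hF₂ hmix₂ hw' (hd₂ _ hw')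
    rwa [Φ₂.right_inv hw.1] at h
  · have hw' := (Φ₁.trans Φ₂).map_target hw
    rw [OpenPartialHomeomorph.trans_source] at hw'
    rw [OpenPartialHomeomorph.trans_target] at hw
    have h1 : DifferentiableAt ℝ (reducedHamiltonian g J W x₀ y v) ((Φ₁.trans Φ₂).symm w) :=
      (contDiffOn_reducedHamiltonian hs hJ₁ hI hx₀ hy hW.smooth).differentiableAt_of_isOpen
        hO (hmix₁ _ hw'.1)
    exact h1.comp w ((hΦ₁.smooth_symm.differentiableAt_of_isOpen Φ₁.open_target hw.2).comp w
      (hΦ₂.smooth_symm.differentiableAt_of_isOpen Φ₂.open_target hw.1))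
  · have hw' := (Φ₁.trans Φ₂).map_target hw
    have h := transformedHamiltonian_eq hs hJ₁ hV hVQ hW hψ hψJ hu hx₀ hI hy hsrc₁ hΦ₁ hsrc₂ hΦ₂ hn
      hw'
    have h1 := htime _ hw'
    rw [(Φ₁.trans Φ₂).right_inv hw] at h h1
    rw [h, h1]

end Reduction

end DrivenCofactor

end

/-! ### The proposition. -/

theorem proposition4 {m n : ℕ}
    (Y : Set (Fin m → ℝ)) (X : Set (Fin n → ℝ))
    (g J : (Fin m ⊕ Fin n → ℝ) → Matrix (Fin m ⊕ Fin n) (Fin m ⊕ Fin n) ℝ)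
    (Q : (Fin m ⊕ Fin n → ℝ) → Fin m ⊕ Fin n → ℝ)
    (hsys : IsDrivenCofactorSystem Y X g Q J)
    (hJ₁ : ∀ q ∈ domain Y X, (J q).toBlocks₁₁.det ≠ 0)
    -- the potential of the driven system
    (V : (Fin m ⊕ Fin n → ℝ) → ℝ) (hV : ContDiffOn ℝ ∞ V (domain Y X))
    (hVQ : ∀ q ∈ domain Y X, ∀ a, Q q (Sum.inr a) = - pd V (Sum.inr a) q)
    -- the function `W_(n)`
    (W : (Fin m ⊕ Fin n → ℝ) → ℝ) (hW : IsCofactorPotential (domain Y X) Q J n W)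
    -- the functions `ψ^i`, with `∂ψ^i/∂x^a = J^i_a`
    (ψ : Fin m → (Fin m ⊕ Fin n → ℝ) → ℝ) (hψ : ∀ i, ContDiffOn ℝ ∞ (ψ i) (domain Y X))
    (hψJ : ∀ q ∈ domain Y X, ∀ i a, pd (ψ i) (Sum.inr a) q = J q (Sum.inl i) (Sum.inr a))
    -- the eigenfunctions `u^a`
    (u : Fin n → (Fin m ⊕ Fin n → ℝ) → ℝ)
    (hu : IsIndependentEigenfunctions (domain Y X) J u)
    -- the solution of the driving system
    (x₀ : Fin n → ℝ) (hx₀ : x₀ ∈ X) (I : Set ℝ) (hI : IsOpen I)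
    (y v : ℝ → Fin m → ℝ) (hy : IsDrivingSolution Y x₀ g Q I y v) :
    ∃ (Φ₁ : OpenPartialHomeomorph (ℝ × (Fin n → ℝ) × (Fin n → ℝ))
        (ℝ × (Fin n → ℝ) × (Fin n → ℝ))) (c : ℝ → ℝ),
      Φ₁.source = {z | z.1 ∈ I ∧ z.2.1 ∈ X} ∧
      Φ₁.target = {z | z.1 ∈ I ∧ z.2.1 ∈ X} ∧
      IsCanonicalGeneratedBy Φ₁ (momentumShiftGen g J ψ x₀ y v) ∧
      (∀ t ∈ I, ∀ x ∈ X, ∃ N : Set (ℝ × (Fin n → ℝ)), IsOpen N ∧ (t, x) ∈ N ∧ N ⊆ I ×ˢ X ∧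
        Set.InjOn (fun w : ℝ × (Fin n → ℝ) => (w.1, fun a => u a (join (y w.1) w.2))) N) ∧
      ∀ N : Set (ℝ × (Fin n → ℝ)), IsOpen N → N ⊆ I ×ˢ X →
        Set.InjOn (fun w : ℝ × (Fin n → ℝ) => (w.1, fun a => u a (join (y w.1) w.2))) N →
        ∃ Φ₂ : OpenPartialHomeomorph (ℝ × (Fin n → ℝ) × (Fin n → ℝ))
            (ℝ × (Fin n → ℝ) × (Fin n → ℝ)),
          Φ₂.source = {z | (z.1, z.2.1) ∈ N} ∧
          IsCanonicalGeneratedBy Φ₂ (pointGen u y) ∧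
          (∀ z ∈ (Φ₁.trans Φ₂).source,
            transformedHamiltonian Φ₂ (pointGen u y)
                (transformedHamiltonian Φ₁ (momentumShiftGen g J ψ x₀ y v)
                  (drivenHamiltonian g V y)) (Φ₁.trans Φ₂ z)
              = reducedHamiltonian g J W x₀ y v z + c z.1) ∧
          IntertwinesHamilton (Φ₁.trans Φ₂) (drivenHamiltonian g V y)
            (fun w => reducedHamiltonian g J W x₀ y v ((Φ₁.trans Φ₂).symm w)) := by
  obtain ⟨Φ₁, hsrc₁, htgt₁, hΦ₁⟩ :=
    exists_canonical_momentumShiftGen hsys hJ₁ hI hx₀ hy hψ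
  -- The coupling condition supplies an index a in `Fin n`; positivity of n keeps the exponent n − 1
  -- genuine.
  have hn : n ≠ 0 := by
    obtain ⟨_, _, _, _, a, _⟩ := hsys.coupled
    exact a.pos.ne'
  -- The function c(t) is the residual at the base point x₀. It does not involve the second
  -- transformation, hence not N.
  refine ⟨Φ₁, fun t => residualAlong g J Q V W ψ x₀ y v t x₀, hsrc₁, htgt₁, hΦ₁,
    fun t ht x hx => exists_injOn_along hsys hI hx₀ hy hu ht hx, fun N hN hNI hinj => ?_⟩
  obtain ⟨Φ₂, hsrc₂, hΦ₂⟩ := exists_canonical_pointGen hsys hI hx₀ hy hu hN hNI hinj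
  have hsub : Φ₂.source ⊆ {z | z.1 ∈ I ∧ z.2.1 ∈ X} := hsrc₂ ▸ fun z hz => hNI hz
  exact ⟨Φ₂, hsrc₂, hΦ₂,
    fun z hz => transformedHamiltonian_eq hsys hJ₁ hV hVQ hW hψ hψJ hu hx₀ hI hy hsrc₁ hΦ₁ hsub hΦ₂
      hn hz,
    intertwinesHamilton_reducedHamiltonian hsys hJ₁ hV hVQ hW hψ hψJ hu hx₀ hI hy hsrc₁ hΦ₁ hsub hΦ₂
      hn htgt₁⟩
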